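/- **Lemma (well-posedness of the $hp$-HDG formulation of steady convection–diffusion).** *Setting.* Let $d\ge 2$, let $\Omega\subset\mathbb R^d$ be an open set with $\Omega=\operatorname{int}\overline\Omega$ (e.g. a Lipschitz domain), partitioned into finitely many $d$-simplices $K$ with disjoint interiors and $\bigcup_K\overline K=\overline\Omega$; hanging nodes are allowed. Interior mortars are the sets $e=F\cap F'$ ($F,F'$ faces of two different elements) and boundary mortars the sets $e=F\cap\partial\Omega$, in both cases with positive $(d-1)$-measure; $\mathcal E$ is the set of all mortars, $\mathcal E^\partial$ that of the boundary mortars. Let $p_K\ge0$ be polynomial degrees on the elements and $p_e=\max\{p_K: e\subset\partial K\}$. Let $n$ be the outward unit normal of $\partial K$, and $[\![q]\!]$ the sum over the (one or two) elements adjacent to $e$ of the one-sided values of $q$. Let $\kappa\in[L^\infty(\Omega)]^{d\times d}$ be symmetric and uniformly positive definite, $\beta\in[L^\infty(\Omega)]^d$ with $\nabla\cdot\beta\in L^\infty(\Omega)$ (weak divergence), and let $\beta\cdot n\in L^\infty(\partial K)$ be the normal trace. Consider $$\nabla\cdot(\beta u-\kappa\nabla u)=f\ \text{in }\Omega,\qquad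 u=g\ \text{on }\partial\Omega^+,\qquad(\beta u-\kappa\nabla u)\cdot n=g\ \text{on }\partial\Omega^-\cup\partial\Omega_0,$$ where $\partial\Omega^\pm,\partial\Omega_0$ are the parts of $\partial\Omega$ with $\pm\beta\cdot n>0$, $\beta\cdot n=0$. With $\sigma=-\kappa\nabla u$ it is the system $\sum_k\partial_k(A_kz)+Gz=(0,f)$ for $z=(\sigma,u)$ with $$G=\begin{bmatrix}\kappa^{-1}&0\\0&0\end{bmatrix},\quad A_k=\begin{bmatrix}0&B_k\\B_k^T&C_k\end{bmatrix}=\begin{bmatrix}0&e_k\\e_k^T&\beta_k\end{bmatrix},\quad A=\sum_kn_kA_k=\begin{bmatrix}0&B\\B^T&C\end{bmatrix}=\begin{bmatrix}0&n\\n^T&\beta\cdot n\end{bmatrix}.$$ *Assumptions.* $\tfrac12\nabla\cdot\beta\ge0$ a.e. in $\Omega$; on every mortar $\beta\cdot n\ne0$ a.e.; $[\![\beta\cdot n]\!]=0$ a.e. on every interior mortar; every boundary mortar lies, up to a null set, in $\partial\Omega^+$ or in $\partial\Omega^-\cup\partial\Omega_0$ (automatic if $\beta\cdot n$ is continuous and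 nonzero along a connected mortar). Mortars of the first kind are called Dirichlet mortars, $\mathcal E_D$. Put $\varrho=\tfrac12$ where $\beta\cdot n>0$, $\varrho=0$ where $\beta\cdot n=0$, $\varrho=-\beta\cdot n$ where $\beta\cdot n<0$, and $T=\tfrac12\bigl(\sqrt{|\beta\cdot n|^2+4}-\beta\cdot n\bigr)$ (separately on each side of a mortar). *Conclusions.* (Matrix inequalities are in the sense of quadratic forms.) 1. *The system is a two-field Friedrichs' system with partial coercivity:* $G$, $A_k$ and $\sum_k\partial_kA_k$ are in $L^\infty(\Omega)$; $A_k=A_k^T$; the $\sigma\sigma$-block of $A_k$ vanishes; the off-diagonal blocks of $G$ vanish and the $B_k$ are constant; $G^{\sigma\sigma}\ge k_0I$ for some $k_0>0$; and $G+G^T+\sum_k\partial_kA_k\ge2\mu_0\begin{bmatrix}I&0\\0&0\end{bmatrix}$ a.e. for some $\mu_0>0$. 2. *The reduced upwind flux exists, with stabilization $T$:* write $|A|=\begin{bmatrix}\mathcal A^{\sigma\sigma}&\mathcal A^{\sigma u}\\\mathcal A^{u\sigma}&\mathcal A^{uu}\end{bmatrix}$ for the spectral absolute value of $A$. On each side of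 every mortar, a.e., there are an invertible $\Phi$ and a $\Psi$ with $B\Phi\mathcal A^{u\sigma}=\mathcal A^{\sigma\sigma}$, $\mathcal A^{\sigma u}=B\Psi$, and $$-(\Phi^TB^TB\Phi)^{-1}\Phi^TB^TB(\Psi+I)+\mathcal A^{uu}=T ;$$ moreover $\bigcap_k\operatorname{Range}B_k=\{0\}$, $\operatorname{Null}B_k=\{0\}$ for all $k$, and $\tfrac12C+T>0$. 3. *The boundary operator is admissible:* on boundary mortars, a.e., $M=\begin{bmatrix}0&-\alpha B\\\alpha B^T&2\varrho I+C\end{bmatrix}$, with $\alpha=1$ on $\mathcal E_D$ and $\alpha=-1$ otherwise, satisfies $M\ge0$ and $\operatorname{Null}(A-M)+\operatorname{Null}(A+M)=\mathbb R^{d+1}$. 4. *Local well-posedness:* for all $f^\sigma\in[L^2(\Omega)]^d$, $f^u\in L^2(\Omega)$, every $\hat u$ with $\hat u|_e\in\mathcal P_{p_e}(e)$ for all $e\in\mathcal E$, and every $K$, there is exactly one $(\sigma,u)\in[\mathcal P_{p_K}(K)]^d\times\mathcal P_{p_K}(K)$ with, for all $(s,v)\in[\mathcal P_{p_K}(K)]^d\times\mathcal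 P_{p_K}(K)$, $$-(u,\nabla\cdot s)_K+(\kappa^{-1}\sigma,s)_K+\langle\hat u\,n,s\rangle_{\partial K}=(f^\sigma,s)_K,$$ $$-(\sigma+\beta u,\nabla v)_K+\langle\sigma\cdot n+(\beta\cdot n)u+T(u-\hat u),v\rangle_{\partial K}=(f^u,v)_K,$$ where $\langle\cdot,\cdot\rangle_{\partial K}$ is the sum of the integrals over the mortars in the faces of $K$. 5. *Global well-posedness:* for all $f^\sigma\in[L^2(\Omega)]^d$, $f^u\in L^2(\Omega)$, $g\in L^2(\partial\Omega)$ there is exactly one $(\sigma_h,u_h,\hat u_h)$, with $(\sigma_h,u_h)|_K\in[\mathcal P_{p_K}(K)]^{d}\times\mathcal P_{p_K}(K)$ for all $K$ and $\hat u_h|_e\in\mathcal P_{p_e}(e)$ for all $e\in\mathcal E$, that solves the two local equations on every $K$ and, for all $\hat v$ with $\hat v|_e\in\mathcal P_{p_e}(e)$, $$\sum_{e\in\mathcal E\setminus\mathcal E_D}\langle[\![\sigma_h\cdot n+(\beta\cdot n)u_h+T(u_h-\hat u_h)]\!],\hat v\rangle_e=\sum_{e\in\mathcal E^\partial\setminus\mathcal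 E_D}\langle(\varrho+\beta\cdot n)\hat u_h+g,\hat v\rangle_e,\qquad\sum_{e\in\mathcal E_D}\langle\hat u_h,\hat v\rangle_e=\sum_{e\in\mathcal E_D}\langle g,\hat v\rangle_e .$$ (The case $f^\sigma=0$, $f^u=f$ is the formulation of the problem above; $g=0$ is the homogeneous boundary condition.) -/

import Mathlib

open MeasureTheory Matrix
open scoped ENNReal ContDiff

/-- Euclidean space `ℝ^d`. -/
abbrev Eu (d : ℕ) : Type := EuclideanSpace ℝ (Fin d)

/-! ### Weak divergence -/

/-- `g` is the distributional divergence of the vector field `F` in `Ω`. -/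
def HasWeakDivergence {d : ℕ} (Ω : Set (Eu d)) (F : Eu d → Eu d) (g : Eu d → ℝ) : Prop :=
  ∀ φ : Eu d → ℝ, ContDiff ℝ ∞ φ → HasCompactSupport φ → tsupport φ ⊆ Ω →
    ∫ x in Ω, fderiv ℝ φ x (F x) = - ∫ x in Ω, g x * φ x

/-- The order `N ≤ Q` of square matrices in the sense of quadratic forms
(the matrices need not be symmetric). -/
def QuadLE {m : Type*} [Fintype m] (N Q : Matrix m m ℝ) : Prop :=
  ∀ v : m → ℝ, v ⬝ᵥ (N *ᵥ v) ≤ v ⬝ᵥ (Q *ᵥ v)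

open Classical in
/-- `|A| = R |Λ| R⁻¹` for a symmetric matrix `A = R Λ R⁻¹` (and `0` if `A` is not symmetric). -/
noncomputable def absMatrix {m : Type*} [Fintype m] [DecidableEq m] (A : Matrix m m ℝ) :
    Matrix m m ℝ :=
  if h : A.IsHermitian then h.cfc (fun t => |t|) else 0

/-! ### Two-field Friedrichs' systems -/

/-- The coefficients of a first-order system `∑ₖ ∂ₖ (Aₖ z) + G z = f` in `ℝ^d` whose unknown
`z = (σ, u)` is split into an auxiliary field `σ` (components `a`) and a field `u`
(components `u`). -/
structure TwoFieldSystem (d : ℕ) (a u : Type) where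
  /-- zeroth-order coefficient -/
  G : Eu d → Matrix (a ⊕ u) (a ⊕ u) ℝ
  /-- first-order coefficients -/
  A : Fin d → Eu d → Matrix (a ⊕ u) (a ⊕ u) ℝ

namespace TwoFieldSystem

variable {d : ℕ} {a u : Type}

/-- The upper right block `Bₖ` of `Aₖ`. -/
def B (S : TwoFieldSystem d a u) (k : Fin d) (x : Eu d) : Matrix a u ℝ := (S.A k x).toBlocks₁₂

/-- The lower right block `Cₖ` of `Aₖ`. -/
def C (S : TwoFieldSystem d a u) (k : Fin d) (x : Eu d) : Matrix u u ℝ := (S.A k x).toBlocks₂₂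

/-- The system is a two-field Friedrichs' system with partial coercivity in `Ω`. -/
structure IsPartiallyCoercive [Fintype a] [Fintype u] [DecidableEq a] [DecidableEq u]
    (Ω : Set (Eu d)) (S : TwoFieldSystem d a u) : Prop where
  G_bounded : ∀ i j, MemLp (fun x => S.G x i j) ∞ (volume.restrict Ω)
  A_bounded : ∀ k i j, MemLp (fun x => S.A k x i j) ∞ (volume.restrict Ω)
  A_symm : ∀ k, ∀ᵐ x ∂(volume.restrict Ω), (S.A k x)ᵀ = S.A k x
  /-- `∑ₖ ∂ₖ Aₖ = D ∈ L^∞` and `G + Gᵀ + ∑ₖ ∂ₖ Aₖ ≥ 2 μ₀ diag(I, 0)`. -/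
  partial_coercivity : ∃ D : Eu d → Matrix (a ⊕ u) (a ⊕ u) ℝ,
    (∀ i j, MemLp (fun x => D x i j) ∞ (volume.restrict Ω)) ∧
    (∀ i j, HasWeakDivergence Ω (fun x => WithLp.toLp 2 (fun k => S.A k x i j))
      (fun x => D x i j)) ∧
    ∃ μ₀ : ℝ, 0 < μ₀ ∧ ∀ᵐ x ∂(volume.restrict Ω),
      QuadLE ((2 * μ₀) • (fromBlocks 1 0 0 0 : Matrix (a ⊕ u) (a ⊕ u) ℝ))
        (S.G x + (S.G x)ᵀ + D x)
  G_offdiag : ∀ᵐ x ∂(volume.restrict Ω), (S.G x).toBlocks₁₂ = 0 ∧ (S.G x).toBlocks₂₁ = 0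
  B_const : ∀ k, ∃ B₀ : Matrix a u ℝ, ∀ᵐ x ∂(volume.restrict Ω), S.B k x = B₀
  A_aux_zero : ∀ k, ∀ᵐ x ∂(volume.restrict Ω), (S.A k x).toBlocks₁₁ = 0
  G_aux_coercive : ∃ k₀ : ℝ, 0 < k₀ ∧ ∀ᵐ x ∂(volume.restrict Ω),
    QuadLE (k₀ • (1 : Matrix a a ℝ)) (S.G x).toBlocks₁₁

end TwoFieldSystem

/-- The first of the two alternative hypotheses that allow the auxiliary upwind state to be
eliminated from the upwind flux. `Bk` are the blocks `Bₖ` and `An` is `∑ₖ nₖ Aₖ`. -/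
structure UpwindReduction {d : ℕ} {a u : Type} [Fintype a] [Fintype u]
    [DecidableEq a] [DecidableEq u] (Bk : Fin d → Matrix a u ℝ)
    (An : Matrix (a ⊕ u) (a ⊕ u) ℝ) (Φ Ψ : Matrix u u ℝ) : Prop where
  isUnit : IsUnit Φ
  aux_aux : An.toBlocks₁₂ * Φ * (absMatrix An).toBlocks₂₁ = (absMatrix An).toBlocks₁₁
  aux_sol : (absMatrix An).toBlocks₁₂ = An.toBlocks₁₂ * Ψ
  range_inf : ⨅ k, LinearMap.range (Bk k).mulVecLin = ⊥
  ker_eq : ∀ k, LinearMap.ker (Bk k).mulVecLin = ⊥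

/-- The stabilization matrix
`T = -(Φᵀ Bᵀ B Φ)⁻¹ Φᵀ Bᵀ B (Ψ + I) + |A|^{uu}` of the reduced upwind flux. -/
noncomputable def upwindStabilization {a u : Type} [Fintype a] [Fintype u]
    [DecidableEq a] [DecidableEq u] (An : Matrix (a ⊕ u) (a ⊕ u) ℝ) (Φ Ψ : Matrix u u ℝ) :
    Matrix u u ℝ :=
  -((Φᵀ * An.toBlocks₁₂ᵀ * An.toBlocks₁₂ * Φ)⁻¹ *
      (Φᵀ * An.toBlocks₁₂ᵀ * An.toBlocks₁₂ * (Ψ + 1))) + (absMatrix An).toBlocks₂₂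

/-- The boundary operator `M = [[0, -α B], [α Bᵀ, 2ϱ I + C]]`. -/
def boundaryOperator {a u : Type} [DecidableEq u] (An : Matrix (a ⊕ u) (a ⊕ u) ℝ) (α ϱ : ℝ) :
    Matrix (a ⊕ u) (a ⊕ u) ℝ :=
  fromBlocks 0 (-(α • An.toBlocks₁₂)) (α • An.toBlocks₁₂ᵀ)
    ((2 * ϱ) • (1 : Matrix u u ℝ) + An.toBlocks₂₂)

/-- Admissibility of a boundary operator `Q` for the boundary condition `(A - Q) z = 0`:
`Q ≥ 0` and `Null(A - Q) + Null(A + Q) = ℝ^m`. -/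
def AdmissibleBoundaryOperator {m : Type*} [Fintype m] (A Q : Matrix m m ℝ) : Prop :=
  QuadLE 0 Q ∧ LinearMap.ker (A - Q).mulVecLin ⊔ LinearMap.ker (A + Q).mulVecLin = ⊤

/-! ### Simplicial meshes, possibly with hanging nodes, and their mortars -/

/-- A finite partition of `Ω` into simplices. No conformity is required. -/
structure SimplexMesh (d : ℕ) (Ω : Set (Eu d)) (ι : Type*) where
  simplex : ι → Affine.Simplex ℝ (Eu d) d
  disjoint : Pairwise fun K K' => Disjoint (simplex K).interior (simplex K').interior
  cover : ⋃ K, (simplex K).closedInterior = closure Ω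

namespace SimplexMesh

variable {d : ℕ} {Ω : Set (Eu d)} {ι : Type*}

/-- The (closed) element `K`. -/
def elem (M : SimplexMesh d Ω ι) (K : ι) : Set (Eu d) := (M.simplex K).closedInterior

/-- The (closed) face of `K` opposite to its `i`-th vertex. -/
def face [NeZero d] (M : SimplexMesh d Ω ι) (K : ι) (i : Fin (d + 1)) : Set (Eu d) :=
  ((M.simplex K).faceOpposite i).closedInterior

/-- The outward unit normal of `K` on its `i`-th face: it points from the `i`-th vertex to the
foot of the altitude through that vertex. -/
noncomputable def normal [NeZero d] (M : SimplexMesh d Ω ι) (K : ι) (i : Fin (d + 1)) : Eu d :=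
  ((M.simplex K).height i)⁻¹ • ((M.simplex K).altitudeFoot i - (M.simplex K).points i)

/-- `(d-1)`-dimensional surface measure (Hausdorff measure, normalized as Lebesgue measure). -/
noncomputable def surf (d : ℕ) : Measure (Eu d) := Measure.euclideanHausdorffMeasure (d - 1)

open Classical in
/-- Interior mortars: intersections `e = F ∩ F'` of positive surface measure of faces of two
different elements. -/
noncomputable def interiorMortars [NeZero d] [Fintype ι] (M : SimplexMesh d Ω ι) :
    Finset (Set (Eu d)) :=
  ((Finset.univ : Finset ((ι × Fin (d + 1)) × (ι × Fin (d + 1)))).filter (fun q =>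
      q.1.1 ≠ q.2.1 ∧ 0 < surf d (M.face q.1.1 q.1.2 ∩ M.face q.2.1 q.2.2))).image
    (fun q => M.face q.1.1 q.1.2 ∩ M.face q.2.1 q.2.2)

open Classical in
/-- Boundary mortars: intersections `e = F ∩ ∂Ω` of positive surface measure. -/
noncomputable def boundaryMortars [NeZero d] [Fintype ι] (M : SimplexMesh d Ω ι) :
    Finset (Set (Eu d)) :=
  ((Finset.univ : Finset (ι × Fin (d + 1))).filter (fun q =>
      0 < surf d (M.face q.1 q.2 ∩ frontier Ω))).image
    (fun q => M.face q.1 q.2 ∩ frontier Ω)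

open Classical in
/-- The mesh skeleton. -/
noncomputable def skeleton [NeZero d] [Fintype ι] (M : SimplexMesh d Ω ι) :
    Finset (Set (Eu d)) :=
  M.interiorMortars ∪ M.boundaryMortars

open Classical in
/-- The element sides `(K, i)` whose face contains the mortar `e`: two of them for an interior
mortar, one for a boundary mortar. -/
noncomputable def sides [NeZero d] [Fintype ι] (M : SimplexMesh d Ω ι) (e : Set (Eu d)) :
    Finset (ι × Fin (d + 1)) :=
  Finset.univ.filter (fun s => e ⊆ M.face s.1 s.2)

open Classical in
/-- The mortars contained in the `i`-th face of `K`. -/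
noncomputable def mortarsOn [NeZero d] [Fintype ι] (M : SimplexMesh d Ω ι) (K : ι)
    (i : Fin (d + 1)) : Finset {e // e ∈ M.skeleton} :=
  Finset.univ.filter (fun e => e.1 ⊆ M.face K i)

/-- The polynomial degree on a mortar: the maximum of the degrees of the adjacent elements. -/
noncomputable def mortarDegree [NeZero d] [Fintype ι] (M : SimplexMesh d Ω ι) (p : ι → ℕ)
    (e : Set (Eu d)) : ℕ := (M.sides e).sup (fun s => p s.1)

/-- `b` is the normal trace `F · n` on `∂K` of a bounded vector field `F` with bounded divergence
`g`: `b ∈ L^∞(∂K)` and Green's formula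
`∫_K (F · ∇φ + g φ) = ∫_{∂K} b φ` holds for all smooth `φ`. -/
def IsNormalTrace [NeZero d] (M : SimplexMesh d Ω ι) (K : ι) (F : Eu d → Eu d)
    (g b : Eu d → ℝ) : Prop :=
  (∀ i, MemLp b ∞ ((surf d).restrict (M.face K i))) ∧
  ∀ φ : Eu d → ℝ, ContDiff ℝ ∞ φ →
    ∫ x in M.elem K, (fderiv ℝ φ x (F x) + g x * φ x)
      = ∑ i, ∫ x in M.face K i, b x * φ x ∂(surf d)

/-- The jump (sum of the one-sided values) on the mortar `e` of a quantity living on the element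
sides. -/
noncomputable def jump [NeZero d] [Fintype ι] (M : SimplexMesh d Ω ι) {V : Type*}
    [AddCommMonoid V] (q : ι → Fin (d + 1) → Eu d → V) (e : Set (Eu d)) (x : Eu d) : V :=
  ∑ s ∈ M.sides e, q s.1 s.2 x

end SimplexMesh

/-! ### Discrete spaces -/

/-- Polynomials of degree at most `p` in `d` variables (determined by their values on any
simplex). -/
noncomputable abbrev PolySpace (d p : ℕ) : Submodule ℝ (MvPolynomial (Fin d) ℝ) :=
  MvPolynomial.restrictTotalDegree (Fin d) ℝ p

/-- Value at `x` of a vector of polynomials. -/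
noncomputable def pval {d p : ℕ} {c : Type} (w : c → PolySpace d p) (x : Eu d) : c → ℝ :=
  fun j => MvPolynomial.eval (fun l => x l) (w j).1

/-- Value at `x` of the `k`-th partial derivative of a vector of polynomials. -/
noncomputable def pderivVal {d p : ℕ} {c : Type} (k : Fin d) (w : c → PolySpace d p) (x : Eu d) :
    c → ℝ :=
  fun j => MvPolynomial.eval (fun l => x l) (MvPolynomial.pderiv k (w j).1)

/-- Polynomial functions of degree at most `p` on a set `e`, each represented by its extension
by zero. -/
noncomputable def TracePoly (d p : ℕ) (e : Set (Eu d)) : Submodule ℝ (Eu d → ℝ) :=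
  (PolySpace d p).map
    ({ toFun := fun q => e.indicator (fun x => MvPolynomial.eval (fun l => x l) q)
       map_add' := by
        intro q r
        ext x
        by_cases hx : x ∈ e <;> simp [hx]
       map_smul' := by
        intro c q
        ext x
        by_cases hx : x ∈ e <;> simp [hx] } :
      MvPolynomial (Fin d) ℝ →ₗ[ℝ] (Eu d → ℝ))

/-- The trace space: one polynomial per mortar and component, of the mortar's degree. -/
abbrev TraceSpace {d : ℕ} [NeZero d] {Ω : Set (Eu d)} {ι : Type*} [Fintype ι]
    (M : SimplexMesh d Ω ι) (p : ι → ℕ) (u : Type) : Type :=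
  (e : {e // e ∈ M.skeleton}) → u → TracePoly d (M.mortarDegree p e.1) e.1

/-- Value at `x` of a vector of trace polynomials. -/
def tval {d p : ℕ} {c : Type} {e : Set (Eu d)} (w : c → TracePoly d p e) (x : Eu d) : c → ℝ :=
  fun j => (w j).1 x

/-! ### The `hp`-HDG formulation of a two-field system -/

section HDG

variable {d : ℕ} [NeZero d] {Ω : Set (Eu d)} {ι : Type*} [Fintype ι]
  {a u : Type} [Fintype a] [Fintype u] [DecidableEq a] [DecidableEq u]

/-- Second component `Bᵀ σ + C w + T (w - ŵ)` of the numerical flux, from given point values. -/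
noncomputable def hdgFlux (An : Matrix (a ⊕ u) (a ⊕ u) ℝ) (T : Matrix u u ℝ)
    (σ : a → ℝ) (w wh : u → ℝ) : u → ℝ :=
  An.toBlocks₁₂ᵀ *ᵥ σ + An.toBlocks₂₂ *ᵥ w + T *ᵥ (w - wh)

/-- The pair `(σ, w)` solves the local equations on the element `K` for the trace `ŵ` and the
forcing `(fσ, fw)`. `An K i` is the matrix `∑ₖ nₖ Aₖ` on the `i`-th face of `K`. -/
def SolvesLocal (M : SimplexMesh d Ω ι) (p : ι → ℕ) (S : TwoFieldSystem d a u)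
    (An : ι → Fin (d + 1) → Eu d → Matrix (a ⊕ u) (a ⊕ u) ℝ)
    (T : ι → Fin (d + 1) → Eu d → Matrix u u ℝ)
    (fσ : Eu d → a → ℝ) (fw : Eu d → u → ℝ) (wh : TraceSpace M p u) (K : ι)
    (σ : a → PolySpace d (p K)) (w : u → PolySpace d (p K)) : Prop :=
  (∀ s : a → PolySpace d (p K),
    - (∑ k, ∫ x in M.elem K, (S.B k x *ᵥ pval w x) ⬝ᵥ pderivVal k s x)
    + (∫ x in M.elem K, ((S.G x).toBlocks₁₁ *ᵥ pval σ x + (S.G x).toBlocks₁₂ *ᵥ pval w x)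
        ⬝ᵥ pval s x)
    + (∑ i, ∑ e ∈ M.mortarsOn K i, ∫ x in e.1,
        ((An K i x).toBlocks₁₂ *ᵥ tval (wh e) x) ⬝ᵥ pval s x ∂(SimplexMesh.surf d))
    = ∫ x in M.elem K, fσ x ⬝ᵥ pval s x) ∧
  (∀ v : u → PolySpace d (p K),
    - (∑ k, ∫ x in M.elem K,
        ((S.B k x)ᵀ *ᵥ pval σ x + S.C k x *ᵥ pval w x) ⬝ᵥ pderivVal k v x)
    + (∫ x in M.elem K, ((S.G x).toBlocks₂₁ *ᵥ pval σ x + (S.G x).toBlocks₂₂ *ᵥ pval w x)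
        ⬝ᵥ pval v x)
    + (∑ i, ∑ e ∈ M.mortarsOn K i, ∫ x in e.1,
        hdgFlux (An K i x) (T K i x) (pval σ x) (pval w x) (tval (wh e) x)
          ⬝ᵥ pval v x ∂(SimplexMesh.surf d))
    = ∫ x in M.elem K, fw x ⬝ᵥ pval v x)

open Classical in
/-- The triple `(σ, w, ŵ)` solves the complete `hp`-HDG formulation: the local equations on all
elements, the conservation and Neumann/Robin conditions on the mortars that are not in the set
`Dir` of Dirichlet mortars, and the Dirichlet condition on the mortars in `Dir`. The boundary
datum is `g` (zero for homogeneous boundary conditions). -/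
def SolvesHDG (M : SimplexMesh d Ω ι) (p : ι → ℕ) (S : TwoFieldSystem d a u)
    (An : ι → Fin (d + 1) → Eu d → Matrix (a ⊕ u) (a ⊕ u) ℝ)
    (T : ι → Fin (d + 1) → Eu d → Matrix u u ℝ) (ϱ : ι → Fin (d + 1) → Eu d → ℝ)
    (Dir : Set (Set (Eu d)))
    (fσ : Eu d → a → ℝ) (fw : Eu d → u → ℝ) (g : Eu d → u → ℝ)
    (σ : (K : ι) → a → PolySpace d (p K)) (w : (K : ι) → u → PolySpace d (p K))
    (wh : TraceSpace M p u) : Prop :=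
  (∀ K, SolvesLocal M p S An T fσ fw wh K (σ K) (w K)) ∧
  (∀ vh : TraceSpace M p u,
    (∑ e : {e // e ∈ M.skeleton}, if e.1 ∈ Dir then 0 else
      ∫ x in e.1, M.jump (fun K i y =>
        hdgFlux (An K i y) (T K i y) (pval (σ K) y) (pval (w K) y) (tval (wh e) y)) e.1 x
          ⬝ᵥ tval (vh e) x ∂(SimplexMesh.surf d))
    = ∑ e : {e // e ∈ M.skeleton}, if e.1 ∈ M.boundaryMortars ∧ e.1 ∉ Dir then
        (∑ s ∈ M.sides e.1, ∫ x in e.1,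
          ((ϱ s.1 s.2 x • (1 : Matrix u u ℝ) + (An s.1 s.2 x).toBlocks₂₂) *ᵥ tval (wh e) x)
            ⬝ᵥ tval (vh e) x ∂(SimplexMesh.surf d))
        + ∫ x in e.1, g x ⬝ᵥ tval (vh e) x ∂(SimplexMesh.surf d)
      else 0) ∧
  (∀ vh : TraceSpace M p u,
    (∑ e : {e // e ∈ M.skeleton}, if e.1 ∈ M.boundaryMortars ∧ e.1 ∈ Dir then
      ∫ x in e.1, tval (wh e) x ⬝ᵥ tval (vh e) x ∂(SimplexMesh.surf d) else 0)
    = ∑ e : {e // e ∈ M.skeleton}, if e.1 ∈ M.boundaryMortars ∧ e.1 ∈ Dir then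
      ∫ x in e.1, g x ⬝ᵥ tval (vh e) x ∂(SimplexMesh.surf d) else 0)

/-- The local solver is well-posed: on every element, for all square-integrable forcings and all
traces, the local equations have exactly one solution. -/
def LocallyWellPosed (M : SimplexMesh d Ω ι) (p : ι → ℕ) (S : TwoFieldSystem d a u)
    (An : ι → Fin (d + 1) → Eu d → Matrix (a ⊕ u) (a ⊕ u) ℝ)
    (T : ι → Fin (d + 1) → Eu d → Matrix u u ℝ) : Prop :=
  ∀ (fσ : Eu d → a → ℝ) (fw : Eu d → u → ℝ),
    (∀ j, MemLp (fun x => fσ x j) 2 (volume.restrict Ω)) →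
    (∀ j, MemLp (fun x => fw x j) 2 (volume.restrict Ω)) →
    ∀ (wh : TraceSpace M p u) (K : ι),
      ∃! z : (a → PolySpace d (p K)) × (u → PolySpace d (p K)),
        SolvesLocal M p S An T fσ fw wh K z.1 z.2

/-- The formulation is globally well-posed: for all square-integrable forcings and boundary data
there is exactly one discrete solution `(σ, w, ŵ)`. -/
def GloballyWellPosed (M : SimplexMesh d Ω ι) (p : ι → ℕ) (S : TwoFieldSystem d a u)
    (An : ι → Fin (d + 1) → Eu d → Matrix (a ⊕ u) (a ⊕ u) ℝ)
    (T : ι → Fin (d + 1) → Eu d → Matrix u u ℝ) (ϱ : ι → Fin (d + 1) → Eu d → ℝ)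
    (Dir : Set (Set (Eu d))) : Prop :=
  ∀ (fσ : Eu d → a → ℝ) (fw : Eu d → u → ℝ) (g : Eu d → u → ℝ),
    (∀ j, MemLp (fun x => fσ x j) 2 (volume.restrict Ω)) →
    (∀ j, MemLp (fun x => fw x j) 2 (volume.restrict Ω)) →
    (∀ j, MemLp (fun x => g x j) 2 ((SimplexMesh.surf d).restrict (frontier Ω))) →
    ∃! z : ((K : ι) → a → PolySpace d (p K)) × ((K : ι) → u → PolySpace d (p K)) × TraceSpace M p u,
      SolvesHDG M p S An T ϱ Dir fσ fw g z.1 z.2.1 z.2.2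

end HDG

/-! ### The convection–diffusion problem -/

namespace ConvDiff

variable {d : ℕ}

/-- The system for `z = (-κ ∇u, u)` equivalent to `∇·(β u - κ ∇u) = f`:
`G = diag(κ⁻¹, 0)` and `Aₖ = [[0, eₖ], [eₖᵀ, βₖ]]`. -/
noncomputable def system (κ : Eu d → Matrix (Fin d) (Fin d) ℝ) (β : Eu d → Eu d) :
    TwoFieldSystem d (Fin d) (Fin 1) where
  G x := fromBlocks (κ x)⁻¹ 0 0 0
  A k x := fromBlocks 0 (replicateCol (Fin 1) (Pi.single k 1)) (replicateRow (Fin 1) (Pi.single k 1))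
    (Matrix.of fun _ _ => β x k)

variable [NeZero d] {Ω : Set (Eu d)} {ι : Type*}

/-- `∑ₖ nₖ Aₖ = [[0, n], [nᵀ, β·n]]` on the `i`-th face of `K`, where `b K` is the normal
trace `β·n` on `∂K`. -/
noncomputable def normalMatrix (M : SimplexMesh d Ω ι) (b : ι → Eu d → ℝ) (K : ι)
    (i : Fin (d + 1)) (x : Eu d) : Matrix (Fin d ⊕ Fin 1) (Fin d ⊕ Fin 1) ℝ :=
  fromBlocks 0 (replicateCol (Fin 1) (fun k => M.normal K i k))
    (replicateRow (Fin 1) (fun k => M.normal K i k)) (Matrix.of fun _ _ => b K x)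

/-- `T = ½ (√(|β·n|² + 4) - β·n)`. -/
noncomputable def stab (b : ι → Eu d → ℝ) (K : ι) (_i : Fin (d + 1)) (x : Eu d) :
    Matrix (Fin 1) (Fin 1) ℝ :=
  Matrix.of fun _ _ => (1 / 2) * (Real.sqrt (|b K x| ^ 2 + 4) - b K x)

open Classical in
/-- `ϱ = 1/2` where `β·n > 0` (Dirichlet), `ϱ = 0` where `β·n = 0` (Neumann) and `ϱ = -β·n`
where `β·n < 0` (Robin). -/
noncomputable def rho (b : ι → Eu d → ℝ) (K : ι) (_i : Fin (d + 1)) (x : Eu d) : ℝ :=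
  if 0 < b K x then 1 / 2 else if b K x = 0 then 0 else - b K x

/-- The Dirichlet mortars: the boundary mortars on the outflow boundary `{β·n > 0}`. -/
def outflowMortars [Fintype ι] (M : SimplexMesh d Ω ι) (b : ι → Eu d → ℝ) :
    Set (Set (Eu d)) :=
  {e | e ∈ M.boundaryMortars ∧
    ∀ s ∈ M.sides e, ∀ᵐ x ∂((SimplexMesh.surf d).restrict e), 0 < b s.1 x}

/-- The boundary mortars on the inflow and zero-flow boundary `{β·n ≤ 0}`. -/
def inflowMortars [Fintype ι] (M : SimplexMesh d Ω ι) (b : ι → Eu d → ℝ) :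
    Set (Set (Eu d)) :=
  {e | e ∈ M.boundaryMortars ∧
    ∀ s ∈ M.sides e, ∀ᵐ x ∂((SimplexMesh.surf d).restrict e), b s.1 x ≤ 0}

open Classical in
/-- `α = 1` on Dirichlet mortars and `α = -1` on Neumann and Robin mortars. -/
noncomputable def alpha [Fintype ι] (M : SimplexMesh d Ω ι) (b : ι → Eu d → ℝ)
    (e : Set (Eu d)) : ℝ :=
  if e ∈ outflowMortars M b then 1 else -1

end ConvDiff

/-! The first three conclusions are pointwise linear algebra. Put `b = β·n`. As `|n| = 1`, the
normal matrix satisfies `A³ = b A² + A`, and on the roots of this cubic `|t|` agrees with the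
quadratic `(2t² - b t) / √(b² + 4)`. So `|A|` is explicit, and `Φ = 2/b`, `Ψ = b/√(b² + 4)` produce
`T = ½(√(b² + 4) - b)`. The fact used later is `½b + T = ½√(b² + 4) > 0`. Coercivity of `κ⁻¹`
follows from the lower and the upper bound on `κ` together.

The last two conclusions concern linear systems whose trial and test spaces coincide and have finite
dimension, so only uniqueness for zero data has to be shown (`existsUnique_of_bilinear`). This is an
energy argument. Test the local equations with `(σ, u)`, and use the divergence theorem for `u σ`
and Green's formula for `β u²`. The result is `energy_elem`: `(κ⁻¹σ, σ)_K + ½ (∇·β u, u)_K + ⟨û σ·n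
+ ½ b u² + T (u - û) u, 1⟩_{∂K} = 0`. The boundary integrand equals `(flux) û + (½b + T)(u - û)² - ½
b û²`. For `û = 0` this already settles the local problem. In the global problem, sum over the
elements: the flux terms vanish by the conservation and boundary conditions. The terms `b û²` cancel
on interior mortars because `b` has no jump, vanish on Dirichlet mortars, and have the good sign on
inflow mortars. Hence `σ = 0`, `û = u` on both sides of each mortar, and `û = 0` on the boundary, on
the inflow because `b ≠ 0` there. The first local equation with `s = ∇u` then gives `∇u = 0` on each
element. Instead of propagating the zero from element to element, apply the divergence theorem to
`x₀ u²` on each element: `‖u‖²_K` becomes the integral of `n₀ x₀ û²` over `∂K`, and in the sum over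
all elements the opposite normals cancel on interior mortars (`eq_zero_of_piecewise_constant`).

Much of the remaining work is geometry. The divergence theorem on a simplex (`integral_fderiv_eq`)
is proved one edge direction at a time by Cavalieri's principle. For meshes with hanging nodes, the
mortars on a face must partition it up to null sets (`ae_mem_mortar`, `surf_inter_mortars`), and an
interior mortar must have exactly two sides, with opposite normals (`sum_normal_eq_zero`). These
facts rest on two principles. An analytic function that is not identically zero on a hyperplane has
a null zero set there, so overlapping faces are coplanar. And `interior (closure Ω) = Ω` puts almost
every point common to two overlapping sides inside `Ω`. -/

/-! ### Zero sets of real-analytic functions are null. -/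

theorem AnalyticOnNhd.volume_zeros_eq_zero_real {f : ℝ → ℝ} (hf : AnalyticOnNhd ℝ f Set.univ)
    {x : ℝ} (hx : f x ≠ 0) : volume {t | f t = 0} = 0 := by
  have h := hf.preimage_zero_mem_codiscrete hx
  have h2 := ae_restrict_le_codiscreteWithin (μ := (volume : Measure ℝ)) MeasurableSet.univ h
  rw [Measure.restrict_univ] at h2
  rw [mem_ae_iff] at h2
  convert h2 using 2
  ext t; simp

/-- Induction on the dimension by Fubini. The function of one variable `t ↦ f (t, tail x)` does not
vanish identically, so for almost every `t` the slice `f (t, ·)` is nonzero at `tail x` and the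
induction hypothesis applies to it. -/
theorem AnalyticOnNhd.volume_zeros_eq_zero_pi : ∀ {m : ℕ} {f : (Fin m → ℝ) → ℝ},
    AnalyticOnNhd ℝ f Set.univ → ∀ {x : Fin m → ℝ}, f x ≠ 0 → volume {t | f t = 0} = 0
  | 0, f, hf, x, hx => by
    have : {t | f t = 0} = ∅ := by
      ext t; simpa [Subsingleton.elim t x] using hx
    simp [this]
  | m + 1, f, hf, x, hx => by
    let e := MeasurableEquiv.piFinSuccAbove (fun _ : Fin (m + 1) => ℝ) 0
    have he : MeasurePreserving e volume volume :=
      volume_preserving_piFinSuccAbove (fun _ : Fin (m + 1) => ℝ) 0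
    have hfc : Continuous f := continuousOn_univ.mp hf.continuousOn
    have hmeas : MeasurableSet {t | f t = 0} := (isClosed_eq hfc continuous_const).measurableSet
    have hcons : ∀ q : ℝ × (Fin m → ℝ), e.symm q = Fin.cons q.1 q.2 := fun q => by
      simp [e, MeasurableEquiv.piFinSuccAbove]; rfl
    have hcons1 : ∀ y : Fin m → ℝ, AnalyticOnNhd ℝ (fun t : ℝ => f (Fin.cons t y)) Set.univ := by
      intro y
      refine hf.comp (g := f) (f := fun t : ℝ => (Fin.cons t y : Fin (m+1) → ℝ)) ?_ (fun _ _ => trivial)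
      intro t _
      rw [analyticAt_pi_iff]
      intro i
      refine Fin.cases ?_ (fun j => ?_) i
      · simp only [Fin.cons_zero]; exact analyticAt_id
      · simpa using analyticAt_const
    have hcons2 : ∀ t : ℝ, AnalyticOnNhd ℝ (fun y : Fin m → ℝ => f (Fin.cons t y)) Set.univ := by
      intro t
      refine hf.comp (g := f) (f := fun y : Fin m → ℝ => (Fin.cons t y : Fin (m+1) → ℝ)) ?_ (fun _ _ => trivial)
      intro y _
      rw [analyticAt_pi_iff]
      intro i
      refine Fin.cases ?_ (fun j => ?_) i
      · simpa using analyticAt_const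
      · simp only [Fin.cons_succ]
        exact (ContinuousLinearMap.proj (R := ℝ) (φ := fun _ : Fin m => ℝ) j).analyticAt y
    rw [← he.symm.measure_preimage hmeas.nullMeasurableSet, Measure.volume_eq_prod,
      Measure.measure_prod_null (e.symm.measurable hmeas)]
    have h0 : f (Fin.cons (x 0) (Fin.tail x)) ≠ 0 := by rwa [Fin.cons_self_tail]
    have h1 := (hcons1 (Fin.tail x)).volume_zeros_eq_zero_real h0
    rw [← compl_compl {t | _}, ← mem_ae_iff] at h1
    filter_upwards [h1] with t ht
    have h2 := AnalyticOnNhd.volume_zeros_eq_zero_pi (hcons2 t) (x := Fin.tail x) ht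
    have h3 : Prod.mk t ⁻¹' (e.symm ⁻¹' {t | f t = 0}) = {y | f (Fin.cons t y) = 0} := by
      ext y
      simp [hcons]
    change volume _ = 0
    rw [h3, h2]

theorem AnalyticOnNhd.volume_zeros_eq_zero {E : Type*} [NormedAddCommGroup E]
    [InnerProductSpace ℝ E] [FiniteDimensional ℝ E] [MeasurableSpace E] [BorelSpace E]
    {f : E → ℝ} (hf : AnalyticOnNhd ℝ f Set.univ) {x : E} (hx : f x ≠ 0) :
    volume {t | f t = 0} = 0 := by
  let φ := (stdOrthonormalBasis ℝ E).measurableEquiv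
  have hφ : MeasurePreserving φ.symm := (stdOrthonormalBasis ℝ E).measurePreserving_measurableEquiv.symm
  let ψ := (MeasurableEquiv.toLp 2 (Fin (Module.finrank ℝ E) → ℝ))
  have hψ : MeasurePreserving ψ := (PiLp.volume_preserving_toLp (Fin (Module.finrank ℝ E)))
  have hfc : Continuous f := continuousOn_univ.mp hf.continuousOn
  have hmeas : MeasurableSet {t | f t = 0} := (isClosed_eq hfc continuous_const).measurableSet
  rw [← (hφ.comp hψ).measure_preimage hmeas.nullMeasurableSet]
  let L : (Fin (Module.finrank ℝ E) → ℝ) →L[ℝ] E :=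
    (stdOrthonormalBasis ℝ E).repr.symm.toContinuousLinearEquiv.toContinuousLinearMap ∘L
      (PiLp.continuousLinearEquiv 2 ℝ (fun _ : Fin (Module.finrank ℝ E) => ℝ)).symm.toContinuousLinearMap
  have hL : ∀ y, L y = (φ.symm ∘ ψ) y := fun y => rfl
  have hfa : AnalyticOnNhd ℝ (fun y => f (L y)) Set.univ :=
    hf.comp (fun y _ => L.analyticAt y) (fun _ _ => trivial)
  have := hfa.volume_zeros_eq_zero_pi (x := ψ.symm (φ x)) (by simpa [hL] using hx)
  exact this

/-! ### Surface measure on hyperplanes and Cavalieri's principle. -/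

/-- The hyperplane through `p` with normal `n`. -/
def hyperplaneThrough {d : ℕ} (n p : Eu d) : Set (Eu d) := {x | inner ℝ n (x - p) = 0}

/-- The vectors orthogonal to `n`. -/
noncomputable abbrev normalSpace {d : ℕ} (n : Eu d) : Submodule ℝ (Eu d) := (ℝ ∙ n)ᗮ

section Hyperplane

variable {d : ℕ}

/-- Hausdorff measure is transported by the isometry `h ↦ p + h`, and on the `(d-1)`-dimensional
space `normalSpace n` its Euclidean normalization is Lebesgue measure. Facts about `volume` thereby
become facts about surface measure. -/
theorem surf_restrict_hyperplane {n : Eu d} (hn : ‖n‖ = 1) (p : Eu d) :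
    (SimplexMesh.surf d).restrict (hyperplaneThrough n p) =
      (volume : Measure (normalSpace n)).map (fun h : normalSpace n => p + (h : Eu d)) := by
  have hiso : Isometry (fun h : normalSpace n => p + (h : Eu d)) :=
    (isometry_add_left p).comp isometry_subtype_coe
  have hn0 : n ≠ 0 := by rintro rfl; simp at hn
  have hrank : Module.finrank ℝ (normalSpace n) = d - 1 := by
    have h1 := Submodule.finrank_add_finrank_orthogonal (ℝ ∙ n)
    rw [finrank_span_singleton hn0, finrank_euclideanSpace_fin] at h1
    exact (Nat.sub_eq_of_eq_add' h1.symm).symm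
  have hrange : Set.range (fun h : normalSpace n => p + (h : Eu d)) = hyperplaneThrough n p := by
    ext x
    simp only [Set.mem_range, hyperplaneThrough, Set.mem_ofPred_eq]
    constructor
    · rintro ⟨h, rfl⟩
      simpa using Submodule.mem_orthogonal_singleton_iff_inner_right.1 h.2
    · intro h
      exact ⟨⟨x - p, Submodule.mem_orthogonal_singleton_iff_inner_right.2 h⟩, by simp⟩
  rw [← hrange, SimplexMesh.surf, ← hiso.map_euclideanHausdorffMeasure, ← hrank,
    InnerProductSpace.euclideanHausdorffMeasure_eq_volume]

/-- Cavalieri's principle for a hyperplane and a transversal direction `v`. -/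
theorem volume_eq_map_hyperplane {n : Eu d} (hn : ‖n‖ = 1) (p : Eu d) {v : Eu d}
    (hv : inner ℝ n v ≠ 0) :
    (volume : Measure (Eu d)) = ENNReal.ofReal |inner ℝ n v| •
      (((SimplexMesh.surf d).restrict (hyperplaneThrough n p)).prod (volume : Measure ℝ)).map
        (fun q => q.1 + q.2 • v) := by
  set c : ℝ := inner ℝ n v with hc
  -- With `v = c n + w`, the map `(h, t) ↦ h + t v` scales the normal coordinate by `c` and shears
  -- in direction `w`. The shear preserves measure, so the only factor is `|c|`.
  let w : normalSpace n := ⟨v - c • n, by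
    rw [Submodule.mem_orthogonal_singleton_iff_inner_right, inner_sub_right, inner_smul_right,
      real_inner_self_eq_norm_sq, hn, hc]
    ring⟩
  have hw : c • n + (w : Eu d) = v := by simp [w]
  let ψ : ℝ ≃ₗᵢ[ℝ] (ℝ ∙ n) := LinearIsometryEquiv.toSpanUnitSingleton n hn
  have hψ : MeasurePreserving ψ := ψ.measurePreserving
  have h0 : MeasurePreserving (fun q : ℝ × normalSpace n =>
      p + ((q.2 : Eu d) + q.1 • n)) (volume.prod volume) volume := by
    have h1 := ((ℝ ∙ n).measurePreserving_measurableEquivProd p).symm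
    rw [InnerProductSpace.euclideanHausdorffMeasure_eq_volume] at h1
    have h2 := h1.comp (hψ.prod (MeasurePreserving.id (volume : Measure (normalSpace n))))
    have h3 : (fun q : ℝ × normalSpace n => p + ((q.2 : Eu d) + q.1 • n)) =
        ((ℝ ∙ n).measurableEquivProd p).symm ∘ Prod.map ψ id := by
      ext1 q
      simp only [Function.comp_apply, Submodule.measurableEquivProd_symm_apply, Prod.map_fst,
        Prod.map_snd, id, vadd_eq_add, ψ, LinearIsometryEquiv.toSpanUnitSingleton_apply]
      abel
    rw [h3]
    exact h2
  have hmul : MeasurePreserving (fun t : ℝ => c * t) volume (ENNReal.ofReal |c⁻¹| • volume) :=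
    ⟨by fun_prop, Real.map_volume_mul_left hv⟩
  have hsk := hmul.skew_product (μc := (volume : Measure (normalSpace n)))
    (μd := volume) (g := fun t h => h + t • w) (by fun_prop)
    (Filter.Eventually.of_forall fun t => (measurePreserving_add_right volume (t • w)).map_eq)
  have hmap : ((volume : Measure (normalSpace n)).prod (volume : Measure ℝ)).map
      (fun q => (p + (q.1 : Eu d)) + q.2 • v) = ENNReal.ofReal |c⁻¹| • volume := by
    rw [← Measure.prod_swap, Measure.map_map (by fun_prop) (by fun_prop), ← h0.map_eq,
      ← Measure.map_smul, ← Measure.prod_smul_left, ← hsk.map_eq,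
      Measure.map_map (by fun_prop) (by fun_prop)]
    congr 1
    ext1 q
    simp only [Function.comp_apply, Prod.fst_swap, Prod.snd_swap, Submodule.coe_add,
      Submodule.coe_smul, ← hw]
    module
  rw [surf_restrict_hyperplane hn]
  have hprod := Measure.map_prod_map (volume : Measure (normalSpace n))
    (volume : Measure ℝ) (f := fun h : normalSpace n => p + (h : Eu d)) (g := id) (by fun_prop) measurable_id
  rw [Measure.map_id] at hprod
  rw [hprod, Measure.map_map (by fun_prop) (by fun_prop)]
  have : ((fun q : Eu d × ℝ => q.1 + q.2 • v) ∘
      Prod.map (fun h : normalSpace n => p + (h : Eu d)) id) =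
      (fun q => (p + (q.1 : Eu d)) + q.2 • v) := rfl
  rw [this, hmap, smul_smul, ← ENNReal.ofReal_mul (abs_nonneg _), ← abs_mul, mul_inv_cancel₀ hv]
  simp

/-- The source of null sets on faces. It is applied to barycentric coordinates (edges of faces are
null, overlapping faces are coplanar) and to polynomials (traces are determined almost everywhere).
-/
theorem surf_zeros_eq_zero {n : Eu d} (hn : ‖n‖ = 1) (p : Eu d) {f : Eu d → ℝ}
    (hf : AnalyticOnNhd ℝ f Set.univ) {x : Eu d} (hx : x ∈ hyperplaneThrough n p) (hfx : f x ≠ 0) :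
    SimplexMesh.surf d (hyperplaneThrough n p ∩ {y | f y = 0}) = 0 := by
  have hfc : Continuous f := continuousOn_univ.mp hf.continuousOn
  have hmeas : MeasurableSet {t | f t = 0} := (isClosed_eq hfc continuous_const).measurableSet
  rw [Set.inter_comm, ← Measure.restrict_apply hmeas, surf_restrict_hyperplane hn,
    Measure.map_apply (by fun_prop) hmeas]
  have hfa : AnalyticOnNhd ℝ (fun y : normalSpace n => f (p + (y : Eu d))) Set.univ := by
    refine hf.comp (f := fun y : normalSpace n => p + (y : Eu d)) (fun y _ => ?_) (fun _ _ => trivial)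
    exact analyticAt_const.add ((normalSpace n).subtypeL.analyticAt y)
  exact hfa.volume_zeros_eq_zero
    (x := ⟨x - p, Submodule.mem_orthogonal_singleton_iff_inner_right.2 hx⟩) (by simpa using hfx)

theorem surf_lt_top_of_isCompact {n : Eu d} (hn : ‖n‖ = 1) (p : Eu d) {s : Set (Eu d)}
    (hs : IsCompact s) (hsub : s ⊆ hyperplaneThrough n p) : SimplexMesh.surf d s < ⊤ := by
  rw [← Set.inter_eq_left.2 hsub, ← Measure.restrict_apply hs.measurableSet,
    surf_restrict_hyperplane hn, Measure.map_apply (by fun_prop) hs.measurableSet]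
  refine IsCompact.measure_lt_top ?_
  refine Topology.IsClosedEmbedding.isCompact_preimage ?_ hs
  exact (Homeomorph.addLeft p).isClosedEmbedding.comp
    (Submodule.closed_of_finiteDimensional _).isClosedEmbedding_subtypeVal

end Hyperplane

theorem Continuous.memLp_top_restrict {d : ℕ} {f : Eu d → ℝ} (hf : Continuous f)
    {μ : Measure (Eu d)} {s : Set (Eu d)} (hs : IsCompact s) : MemLp f ⊤ (μ.restrict s) := by
  obtain ⟨C, hC⟩ := hs.exists_bound_of_continuousOn hf.continuousOn
  refine memLp_top_of_bound hf.aestronglyMeasurable C ?_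
  filter_upwards [ae_restrict_mem hs.measurableSet] with x hx using hC x hx

/-! ### Barycentric coordinates and the divergence theorem on a simplex. -/

namespace Affine.Simplex

theorem exists_weights {d : ℕ} (s : Affine.Simplex ℝ (Eu d) d) (x : Eu d) : ∃ w : Fin (d + 1) → ℝ, ∑ j, w j = 1 ∧
    Finset.univ.affineCombination ℝ s.points w = x ∧ ∑ j, w j • s.points j = x := by
  have htop : affineSpan ℝ (Set.range s.points) = ⊤ :=
    s.independent.affineSpan_eq_top_iff_card_eq_finrank_add_one.2 (by simp)
  obtain ⟨w, hw, hx⟩ := eq_affineCombination_of_mem_affineSpan_of_fintype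
    (htop ▸ AffineSubspace.mem_top ℝ _ x)
  refine ⟨w, hw, hx.symm, ?_⟩
  rw [hx, Finset.affineCombination_eq_linear_combination _ _ _ hw]

variable {d : ℕ} [NeZero d] (s : Affine.Simplex ℝ (Eu d) d)

/-- The outward unit normal of the face opposite to the `i`-th vertex. -/
noncomputable def outerNormal (i : Fin (d + 1)) : Eu d :=
  (s.height i)⁻¹ • (s.altitudeFoot i - s.points i)

/-- The `i`-th barycentric coordinate. -/
noncomputable def bary (i : Fin (d + 1)) (x : Eu d) : ℝ :=
  -(s.height i)⁻¹ * inner ℝ (s.outerNormal i) (x - s.altitudeFoot i)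

theorem norm_outerNormal (i : Fin (d + 1)) : ‖s.outerNormal i‖ = 1 := by
  have h := s.height_pos i
  rw [outerNormal, norm_smul, norm_inv, Real.norm_of_nonneg h.le, ← dist_eq_norm,
    dist_comm, ← height, inv_mul_cancel₀ h.ne']

theorem bary_add_smul (i : Fin (d + 1)) (x v : Eu d) (t : ℝ) :
    s.bary i (x + t • v) = s.bary i x - t * ((s.height i)⁻¹ * inner ℝ (s.outerNormal i) v) := by
  simp only [bary, inner_sub_right, inner_add_right, inner_smul_right]
  ring

theorem bary_points (i j : Fin (d + 1)) : s.bary i (s.points j) = if i = j then 1 else 0 := by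
  have h := s.height_pos i
  split_ifs with hij
  · subst hij
    rw [bary, outerNormal, ← neg_sub (s.points i), smul_neg, inner_neg_left, real_inner_smul_left,
      real_inner_self_eq_norm_sq, ← dist_eq_norm, ← height]
    field_simp
  · have h2 := s.inner_vsub_altitudeFoot_vsub_altitudeFoot_eq_zero (i := i) (j := j) hij
    simp only [vsub_eq_sub] at h2
    rw [bary, outerNormal, ← neg_sub (s.points i), smul_neg, inner_neg_left, real_inner_smul_left,
      real_inner_comm, h2]
    simp

/-- `bary i` is affine and is the Kronecker delta on the vertices, so it returns the weight of an
affine combination. Membership in the simplex, its interior and its faces thus becomes a sign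
condition on these functions. -/
theorem bary_sum {w : Fin (d + 1) → ℝ} (hw : ∑ j, w j = 1) (i : Fin (d + 1)) :
    s.bary i (∑ j, w j • s.points j) = w i := by
  have h1 : s.bary i (∑ j, w j • s.points j) = ∑ j, w j * s.bary i (s.points j) := by
    simp only [bary, inner_sub_right, inner_sum, inner_smul_right]
    rw [mul_sub, ← one_mul (inner ℝ _ (s.altitudeFoot i)), ← hw, Finset.sum_mul, Finset.mul_sum,
      Finset.mul_sum, ← Finset.sum_sub_distrib]
    exact Finset.sum_congr rfl fun _ _ => by rw [← Finset.sum_mul, hw]; ring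
  rw [h1]
  simp [bary_points]

theorem mem_closedInterior_iff {x : Eu d} : x ∈ s.closedInterior ↔ ∀ i, 0 ≤ s.bary i x := by
  obtain ⟨w, hw, h1, h2⟩ := s.exists_weights x
  have h3 : ∀ i, s.bary i x = w i := fun i => h2 ▸ s.bary_sum hw i
  rw [← h1, s.affineCombination_mem_closedInterior_iff hw, h1]
  simp only [h3]
  refine ⟨fun h i => (h i).1, fun h i => ⟨h i, ?_⟩⟩
  rw [← hw]
  exact Finset.single_le_sum (fun j _ => h j) (Finset.mem_univ i)

theorem mem_interior_iff {x : Eu d} : x ∈ s.interior ↔ ∀ i, 0 < s.bary i x := by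
  obtain ⟨w, hw, h1, h2⟩ := s.exists_weights x
  have h3 : ∀ i, s.bary i x = w i := fun i => h2 ▸ s.bary_sum hw i
  rw [← h1, s.affineCombination_mem_interior_iff hw, h1]
  simp only [h3]
  refine ⟨fun h i => (h i).1, fun h i => ⟨h i, ?_⟩⟩
  rw [← hw]
  -- The strict bound `w i < 1` needs a second vertex, which exists because `d ≠ 0`.
  obtain ⟨j, hj⟩ : ∃ j : Fin (d + 1), j ≠ i := exists_ne i
  exact Finset.single_lt_sum hj (Finset.mem_univ i) (Finset.mem_univ j) (h j) fun k _ _ => (h k).le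

theorem mem_closedInterior_faceOpposite_iff {i : Fin (d + 1)} {x : Eu d} :
    x ∈ (s.faceOpposite i).closedInterior ↔ s.bary i x = 0 ∧ ∀ j, 0 ≤ s.bary j x := by
  obtain ⟨w, hw, h1, h2⟩ := s.exists_weights x
  have h3 : ∀ i, s.bary i x = w i := fun i => h2 ▸ s.bary_sum hw i
  rw [← h1, faceOpposite, s.affineCombination_mem_closedInterior_face_iff_nonneg _ hw, h1]
  simp only [h3, Finset.mem_compl, Finset.mem_singleton, not_not, forall_eq]
  refine ⟨fun h => ⟨h.2, fun j => ?_⟩, fun h => ⟨fun j _ => h.2 j, h.1⟩⟩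
  by_cases hj : j = i
  · rw [hj, h.2]
  · exact h.1 j hj

theorem analyticOnNhd_bary (i : Fin (d + 1)) : AnalyticOnNhd ℝ (s.bary i) Set.univ := by
  intro x _
  have h1 : AnalyticAt ℝ (fun x : Eu d => x - s.altitudeFoot i) x := analyticAt_id.sub analyticAt_const
  exact analyticAt_const.mul (((innerSL ℝ (s.outerNormal i)).analyticAt _).comp h1)

theorem continuous_bary (i : Fin (d + 1)) : Continuous (s.bary i) :=
  continuousOn_univ.mp (s.analyticOnNhd_bary i).continuousOn

theorem bary_eq_zero_iff {i : Fin (d + 1)} {x : Eu d} :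
    s.bary i x = 0 ↔ x ∈ hyperplaneThrough (s.outerNormal i) (s.altitudeFoot i) := by
  have h := s.height_pos i
  simp [bary, hyperplaneThrough, h.ne']

theorem faceOpposite_subset_hyperplane (i : Fin (d + 1)) : (s.faceOpposite i).closedInterior ⊆
    hyperplaneThrough (s.outerNormal i) (s.altitudeFoot i) := fun _ hx =>
  s.bary_eq_zero_iff.1 (s.mem_closedInterior_faceOpposite_iff.1 hx).1

/-- An edge is parallel to every face containing both its endpoints. The direction from vertex `j`
to vertex `i` points into the simplex at face `i` and out of it at face `j`, so only these two faces
contribute to the divergence theorem in this direction. -/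
theorem inner_outerNormal_sub_points (i j k : Fin (d + 1)) :
    inner ℝ (s.outerNormal k) (s.points i - s.points j) =
      s.height k * ((if k = j then 1 else 0) - if k = i then 1 else 0) := by
  have h := s.height_pos k
  have h1 := s.bary_add_smul k (s.points j) (s.points i - s.points j) 1
  rw [one_smul, add_sub_cancel, s.bary_points, s.bary_points] at h1
  field_simp at h1 ⊢
  linarith

theorem bary_add_smul_edge (i j k : Fin (d + 1)) (x : Eu d) (t : ℝ) :
    s.bary k (x + t • (s.points i - s.points j)) =
      s.bary k x - t * ((if k = j then 1 else 0) - if k = i then 1 else 0) := by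
  have h := s.height_pos k
  rw [bary_add_smul, inner_outerNormal_sub_points]
  field_simp

/-- Cavalieri's principle for the hyperplane of a face and an edge that leaves it. -/
theorem volume_eq_map_edge {i j : Fin (d + 1)} (hij : i ≠ j) {k : Fin (d + 1)}
    (hk : k = i ∨ k = j) : (volume : Measure (Eu d)) = ENNReal.ofReal (s.height k) •
      (((SimplexMesh.surf d).restrict {x | s.bary k x = 0}).prod (volume : Measure ℝ)).map
        (fun q => q.1 + q.2 • (s.points i - s.points j)) := by
  have h := s.height_pos k
  have habs : |inner ℝ (s.outerNormal k) (s.points i - s.points j)| = s.height k := by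
    rw [inner_outerNormal_sub_points]
    rcases hk with rfl | rfl
    · simp [hij, abs_of_pos h]
    · simp [hij.symm, abs_of_pos h]
  have hne : inner ℝ (s.outerNormal k) (s.points i - s.points j) ≠ 0 := by
    rw [← abs_pos, habs]; exact h
  have := volume_eq_map_hyperplane (s.norm_outerNormal k) (s.altitudeFoot k) hne
  rw [habs] at this
  convert this using 5
  ext x
  exact s.bary_eq_zero_iff

theorem measurableSet_bary_eq_zero (k : Fin (d + 1)) : MeasurableSet {x | s.bary k x = 0} :=
  (isClosed_eq (s.continuous_bary k) continuous_const).measurableSet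

instance sigmaFinite_surf_restrict (k : Fin (d + 1)) :
    SigmaFinite ((SimplexMesh.surf d).restrict {x | s.bary k x = 0}) := by
  have h1 : {x | s.bary k x = 0} = hyperplaneThrough (s.outerNormal k) (s.altitudeFoot k) :=
    Set.ext fun x => s.bary_eq_zero_iff
  rw [h1, surf_restrict_hyperplane (s.norm_outerNormal k)]
  have hemb : MeasurableEmbedding
      (fun h : normalSpace (s.outerNormal k) => s.altitudeFoot k + (h : Eu d)) :=
    (measurableEmbedding_addLeft _).comp (MeasurableEmbedding.subtype_coe
      (Submodule.closed_of_finiteDimensional _).measurableSet)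
  exact hemb.sigmaFinite_map

/-- The hyperplanes of two faces, with surface measure scaled by the normal components of the edge
that joins them, correspond under the projection along this edge. -/
theorem smul_surf_eq_map_projection {i j : Fin (d + 1)} (hij : i ≠ j) :
    ENNReal.ofReal (s.height j) • (SimplexMesh.surf d).restrict {x | s.bary j x = 0} =
      ENNReal.ofReal (s.height i) • ((SimplexMesh.surf d).restrict {x | s.bary i x = 0}).map
        (fun y => y + s.bary j y • (s.points i - s.points j)) := by
  have hvol := fun k => s.volume_eq_map_edge hij (k := k)
  have hb : ∀ k x t, s.bary k (x + t • (s.points i - s.points j)) = _ :=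
    s.bary_add_smul_edge i j
  set v := s.points i - s.points j with hv
  have hbj := s.continuous_bary j
  ext S hS
  -- `W` is a slab over `S`: points whose projection along `v` to the hyperplane of face `j` lies in
  -- `S` and whose coordinate `bary j` lies in a unit interval. Each line in direction `v` meets `W`
  -- in a parameter interval of length one or not at all. Cavalieri's principle based on either
  -- hyperplane therefore yields both sides of the claim as `volume W`.
  let W : Set (Eu d) := {x | x + s.bary j x • v ∈ S ∧ s.bary j x ∈ Set.Icc (-1) 0}
  have hW : MeasurableSet W :=
    (MeasurableSet.preimage hS (by fun_prop)).inter (measurableSet_Icc.preimage hbj.measurable)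
  have key : ∀ k, k = i ∨ k = j → volume W = ENNReal.ofReal (s.height k) *
      ∫⁻ y in {x | s.bary k x = 0}, volume {t : ℝ | y + t • v ∈ W} ∂(SimplexMesh.surf d) := by
    intro k hk
    conv_lhs => rw [hvol k hk]
    rw [Measure.smul_apply, smul_eq_mul, Measure.map_apply (by fun_prop) hW,
      Measure.prod_apply (hW.preimage (by fun_prop))]
    rfl
  have hmemW : ∀ y t, y + t • v ∈ W ↔ y + s.bary j y • v ∈ S ∧ s.bary j y - t ∈ Set.Icc (-1) 0 := by
    intro y t
    have h1 : s.bary j (y + t • v) = s.bary j y - t := by rw [hb]; simp [hij.symm]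
    simp only [W, Set.mem_ofPred_eq, h1]
    rw [show y + t • v + (s.bary j y - t) • v = y + s.bary j y • v by module]
  have hvolt : ∀ y, volume {t : ℝ | y + t • v ∈ W} =
      Set.indicator {y | y + s.bary j y • v ∈ S} 1 y := by
    intro y
    by_cases hy : y + s.bary j y • v ∈ S
    · have : {t : ℝ | y + t • v ∈ W} = Set.Icc (s.bary j y) (s.bary j y + 1) := by
        ext t
        simp only [Set.mem_ofPred_eq, hmemW, hy, true_and, Set.mem_Icc]
        constructor <;> intro h <;> constructor <;> linarith [h.1, h.2]
      rw [this, Real.volume_Icc, Set.indicator_of_mem (by exact hy)]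
      simp
    · have : {t : ℝ | y + t • v ∈ W} = ∅ := by
        ext t
        simp [hmemW, hy]
      rw [this, Set.indicator_of_notMem (by exact hy)]
      simp
  have hpre : MeasurableSet {y | y + s.bary j y • v ∈ S} := MeasurableSet.preimage hS (by fun_prop)
  simp only [hvolt] at key
  simp only [lintegral_indicator_one hpre] at key
  have h1 := (key j (Or.inr rfl)).symm.trans (key i (Or.inl rfl))
  rw [Measure.smul_apply, Measure.smul_apply, Measure.map_apply (by fun_prop) hS, smul_eq_mul,
    smul_eq_mul]
  refine Eq.trans ?_ h1
  congr 1
  rw [Measure.restrict_apply hS, Measure.restrict_apply hpre]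
  congr 1
  ext y
  simp only [Set.mem_inter_iff, Set.mem_ofPred_eq]
  refine and_congr_left fun h => ?_
  rw [h, zero_smul, add_zero]

theorem add_smul_edge_mem_faceOpposite_iff {i j : Fin (d + 1)} (hij : i ≠ j) {y : Eu d}
    (hy : s.bary i y = 0) :
    y + s.bary j y • (s.points i - s.points j) ∈ (s.faceOpposite j).closedInterior ↔
      y ∈ (s.faceOpposite i).closedInterior := by
  simp only [mem_closedInterior_faceOpposite_iff, bary_add_smul_edge, hy]
  simp only [if_true, hij.symm, if_false, sub_zero, mul_one, sub_self, true_and]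
  refine ⟨fun h k => ?_, fun h k => ?_⟩
  · by_cases hki : k = i
    · rw [hki, hy]
    · by_cases hkj : k = j
      · have := h i
        simp only [hij, if_false, if_true, hy] at this
        rw [hkj]; linarith
      · have := h k
        simpa [hki, hkj] using this
  · by_cases hki : k = i
    · simp [hki, hy, hij, h j]
    · by_cases hkj : k = j
      · simp [hkj, hij.symm]
      · simp [hki, hkj, h k]

theorem integral_face_projection {i j : Fin (d + 1)} (hij : i ≠ j) {φ : Eu d → ℝ}
    (hφ : Continuous φ) :
    s.height j * ∫ x in (s.faceOpposite j).closedInterior, φ x ∂(SimplexMesh.surf d) =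
      s.height i * ∫ y in (s.faceOpposite i).closedInterior,
        φ (y + s.bary j y • (s.points i - s.points j)) ∂(SimplexMesh.surf d) := by
  have hF : ∀ k, MeasurableSet (s.faceOpposite k).closedInterior := fun k =>
    (s.faceOpposite k).isClosed_closedInterior.measurableSet
  have hbj := s.continuous_bary j
  have hres : ∀ (k : Fin (d + 1)) (ψ : Eu d → ℝ),
      ∫ x in (s.faceOpposite k).closedInterior, ψ x ∂(SimplexMesh.surf d) =
      ∫ x in {x | s.bary k x = 0}, (s.faceOpposite k).closedInterior.indicator ψ x
        ∂(SimplexMesh.surf d) := by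
    intro k ψ
    rw [integral_indicator (hF k), Measure.restrict_restrict (hF k), Set.inter_eq_left.2]
    exact fun x hx => (s.mem_closedInterior_faceOpposite_iff.1 hx).1
  have h1 := congrArg (fun μ : Measure (Eu d) =>
    ∫ x, (s.faceOpposite j).closedInterior.indicator φ x ∂μ) (s.smul_surf_eq_map_projection hij)
  simp only [integral_smul_measure, smul_eq_mul, ENNReal.toReal_ofReal (s.height_pos _).le] at h1
  rw [hres j, h1, hres i, integral_map (by fun_prop)
    (hφ.aestronglyMeasurable.indicator (hF j))]
  congr 1
  refine setIntegral_congr_fun (s.measurableSet_bary_eq_zero i) fun y hy => ?_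
  have h2 := s.add_smul_edge_mem_faceOpposite_iff hij hy
  by_cases hyF : y ∈ (s.faceOpposite i).closedInterior
  · simp only [Set.indicator_of_mem hyF, Set.indicator_of_mem (h2.2 hyF)]
  · simp only [Set.indicator_of_notMem hyF, Set.indicator_of_notMem (mt h2.1 hyF)]

/-- Along the edge direction only `bary i` and `bary j` change, at rates `1` and `-1`. A chord that
starts on face `i` therefore ends on face `j` at parameter `bary j y`. -/
theorem add_smul_edge_mem_closedInterior_iff {i j : Fin (d + 1)} (hij : i ≠ j) {y : Eu d}
    (hy : s.bary i y = 0) (t : ℝ) :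
    y + t • (s.points i - s.points j) ∈ s.closedInterior ↔
      y ∈ (s.faceOpposite i).closedInterior ∧ t ∈ Set.Icc 0 (s.bary j y) := by
  simp only [mem_closedInterior_faceOpposite_iff, mem_closedInterior_iff, bary_add_smul_edge, hy,
    true_and, Set.mem_Icc]
  constructor
  · intro h
    have hi := h i
    have hj := h j
    simp only [hij, hij.symm, if_true, if_false, hy] at hi hj
    refine ⟨fun k => ?_, by linarith, by linarith⟩
    by_cases hki : k = i
    · rw [hki, hy]
    · by_cases hkj : k = j
      · rw [hkj]; linarith
      · simpa [hki, hkj] using h k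
  · rintro ⟨h, h0, h1⟩ k
    by_cases hki : k = i
    · simp [hki, hy, hij, h0]
    · by_cases hkj : k = j
      · simp [hkj, hij.symm, h1]
      · simp [hki, hkj, h k]

theorem surf_face_lt_top (i : Fin (d + 1)) :
    SimplexMesh.surf d (s.faceOpposite i).closedInterior < ⊤ :=
  surf_lt_top_of_isCompact (s.norm_outerNormal i) _ (s.faceOpposite i).isCompact_closedInterior
    (s.faceOpposite_subset_hyperplane i)

theorem integrableOn_face (i : Fin (d + 1)) {ψ : Eu d → ℝ} (hψ : Continuous ψ) :
    IntegrableOn ψ (s.faceOpposite i).closedInterior (SimplexMesh.surf d) := by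
  have : IsFiniteMeasure ((SimplexMesh.surf d).restrict (s.faceOpposite i).closedInterior) :=
    ⟨by simpa using s.surf_face_lt_top i⟩
  exact (hψ.memLp_top_restrict (s.faceOpposite i).isCompact_closedInterior).integrable le_top

/-- Fubini along the edge and the fundamental theorem of calculus on each chord leave the difference
of `φ` at the two ends. The projection along the edge turns the values at the far ends into an
integral over face `j`; the heights that appear are, up to sign, the normal components of the edge.
-/
theorem integral_edgeDeriv {i j : Fin (d + 1)} (hij : i ≠ j) {φ : Eu d → ℝ} (hφ : ContDiff ℝ 1 φ) :
    ∫ x in s.closedInterior, fderiv ℝ φ x (s.points i - s.points j) =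
      ∑ k, ∫ x in (s.faceOpposite k).closedInterior,
        inner ℝ (s.outerNormal k) (s.points i - s.points j) * φ x ∂(SimplexMesh.surf d) := by
  have hFc : IsCompact (s.faceOpposite i).closedInterior := (s.faceOpposite i).isCompact_closedInterior
  have hKm : MeasurableSet s.closedInterior := s.isClosed_closedInterior.measurableSet
  have hvol := s.volume_eq_map_edge hij (Or.inl rfl)
  have hproj := s.integral_face_projection hij hφ.continuous
  have hbj := s.continuous_bary j
  rw [Fintype.sum_eq_add i j hij]
  swap
  · rintro k ⟨hki, hkj⟩
    simp [inner_outerNormal_sub_points, hki, hkj]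
  have hmem := fun y hy t => s.add_smul_edge_mem_closedInterior_iff hij (y := y) hy t
  simp only [inner_outerNormal_sub_points, hij, hij.symm, if_true, if_false, integral_const_mul]
  set v := s.points i - s.points j with hv
  have hg : Continuous (fun x => fderiv ℝ φ x v) :=
    (hφ.continuous_fderiv_apply one_ne_zero).comp (continuous_id.prodMk continuous_const)
  have hint : Integrable (s.closedInterior.indicator (fun x => fderiv ℝ φ x v)) :=
    (integrable_indicator_iff hKm).2
      (hg.continuousOn.integrableOn_compact s.isCompact_closedInterior)
  have hmeas : Measurable (fun q : Eu d × ℝ => q.1 + q.2 • v) := by fun_prop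
  have hpos := s.height_pos i
  rw [hvol] at hint
  have hint2 := (integrable_smul_measure (by simp [hpos]) (by simp)).1 hint
  have hint3 := (integrable_map_measure hint2.1 hmeas.aemeasurable).1 hint2
  have hIV : ∫ x in s.closedInterior, fderiv ℝ φ x v = s.height i *
      ∫ y in (s.faceOpposite i).closedInterior, (φ (y + s.bary j y • v) - φ y)
        ∂(SimplexMesh.surf d) := by
    rw [← integral_indicator hKm]
    conv_lhs => rw [hvol]
    rw [integral_smul_measure, ENNReal.toReal_ofReal hpos.le, smul_eq_mul,
      integral_map hmeas.aemeasurable hint2.1]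
    refine (congrArg (s.height i * ·) (integral_prod _ hint3)).trans ?_
    simp only [Function.comp_apply]
    congr 1
    have hFsub : (s.faceOpposite i).closedInterior ⊆ {x | s.bary i x = 0} := fun x hx =>
      (s.mem_closedInterior_faceOpposite_iff.1 hx).1
    rw [← Set.inter_eq_left.2 hFsub, ← Measure.restrict_restrict hFc.measurableSet,
      ← integral_indicator hFc.measurableSet]
    refine setIntegral_congr_fun (s.measurableSet_bary_eq_zero i) fun y hy => ?_
    by_cases hyF : y ∈ (s.faceOpposite i).closedInterior
    · rw [Set.indicator_of_mem hyF]
      have h1 : ∀ t, s.closedInterior.indicator (fun x => fderiv ℝ φ x v) (y + t • v) =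
          (Set.Icc 0 (s.bary j y)).indicator (fun t => fderiv ℝ φ (y + t • v) v) t := by
        intro t
        by_cases ht : t ∈ Set.Icc 0 (s.bary j y)
        · rw [Set.indicator_of_mem ht, Set.indicator_of_mem ((hmem y hy t).2 ⟨hyF, ht⟩)]
        · rw [Set.indicator_of_notMem ht,
            Set.indicator_of_notMem (mt (fun h => ((hmem y hy t).1 h).2) ht)]
      simp only [h1]
      rw [integral_indicator measurableSet_Icc, integral_Icc_eq_integral_Ioc,
        ← intervalIntegral.integral_of_le ((s.mem_closedInterior_faceOpposite_iff.1 hyF).2 j)]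
      rw [intervalIntegral.integral_eq_sub_of_hasDerivAt (f := fun t => φ (y + t • v))]
      · simp
      · intro t _
        have h2 : HasDerivAt (fun t : ℝ => y + t • v) v t := by
          simpa using ((hasDerivAt_id t).smul_const v).const_add y
        exact ((hφ.differentiable one_ne_zero _).hasFDerivAt).comp_hasDerivAt t h2
      · exact (hg.comp (by fun_prop)).intervalIntegrable _ _
    · rw [Set.indicator_of_notMem hyF]
      have h1 : ∀ t, s.closedInterior.indicator (fun x => fderiv ℝ φ x v) (y + t • v) = 0 :=
        fun t => Set.indicator_of_notMem (mt (fun h => ((hmem y hy t).1 h).1) hyF) _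
      simp [h1]
  have hφi : ∀ ψ : Eu d → ℝ, Continuous ψ →
      IntegrableOn ψ (s.faceOpposite i).closedInterior (SimplexMesh.surf d) := fun ψ hψ =>
    s.integrableOn_face i hψ
  rw [hIV, integral_sub (hφi (fun y => φ (y + s.bary j y • v)) (hφ.continuous.comp (by fun_prop))) (hφi _ hφ.continuous), mul_sub,
    ← hproj]
  ring

/-- The divergence theorem on a simplex. -/
theorem integral_fderiv_eq (v : Eu d) {φ : Eu d → ℝ} (hφ : ContDiff ℝ 1 φ) :
    ∫ x in s.closedInterior, fderiv ℝ φ x v =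
      ∑ k, ∫ x in (s.faceOpposite k).closedInterior,
        inner ℝ (s.outerNormal k) v * φ x ∂(SimplexMesh.surf d) := by
  have hint : ∀ v, IntegrableOn (fun x => fderiv ℝ φ x v) s.closedInterior := fun v =>
    ((hφ.continuous_fderiv_apply one_ne_zero).comp
      (continuous_id.prodMk continuous_const)).continuousOn.integrableOn_compact s.isCompact_closedInterior
  -- Both sides are linear in `v`, and the edges of a full-dimensional simplex span the space.
  have hspan : Submodule.span ℝ (Set.range s.points -ᵥ Set.range s.points) = ⊤ := by
    have htop : affineSpan ℝ (Set.range s.points) = ⊤ :=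
      s.independent.affineSpan_eq_top_iff_card_eq_finrank_add_one.2 (by simp)
    rw [← vectorSpan_def, ← direction_affineSpan, htop, AffineSubspace.direction_top]
  have hv : v ∈ Submodule.span ℝ (Set.range s.points -ᵥ Set.range s.points) := hspan ▸ trivial
  induction hv using Submodule.span_induction with
  | mem v hv =>
    obtain ⟨_, ⟨i, rfl⟩, _, ⟨j, rfl⟩, rfl⟩ := hv
    by_cases hij : i = j
    · simp [hij]
    · exact s.integral_edgeDeriv hij hφ
  | zero => simp
  | add v w _ _ hv hw =>
    simp only [map_add]
    rw [integral_add (hint v) (hint w), hv, hw, ← Finset.sum_add_distrib]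
    refine Finset.sum_congr rfl fun k _ => ?_
    simp only [integral_const_mul, inner_add_right]
    ring
  | smul c v _ hv =>
    simp only [map_smul, smul_eq_mul]
    rw [integral_const_mul, hv, Finset.mul_sum]
    refine Finset.sum_congr rfl fun k _ => ?_
    simp only [integral_const_mul, inner_smul_right]
    ring

end Affine.Simplex

/-! ### Overlapping faces of simplices. -/

namespace Affine.Simplex

variable {d : ℕ} [NeZero d] (s s' : Affine.Simplex ℝ (Eu d) d)

/-- The exceptional points lie in lower-dimensional faces. These are null because `bary j` is not
identically zero on the hyperplane of face `i`: it equals `1` at vertex `j`. -/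
theorem ae_face_bary_pos (i : Fin (d + 1)) :
    ∀ᵐ x ∂((SimplexMesh.surf d).restrict (s.faceOpposite i).closedInterior),
      ∀ j, j ≠ i → 0 < s.bary j x := by
  have hm := (s.faceOpposite i).isClosed_closedInterior.measurableSet
  rw [ae_all_iff]
  intro j
  by_cases hj : j = i
  · simp [hj]
  have h0 : SimplexMesh.surf d (hyperplaneThrough (s.outerNormal i) (s.altitudeFoot i) ∩
      {y | s.bary j y = 0}) = 0 := by
    refine surf_zeros_eq_zero (s.norm_outerNormal i) _ (s.analyticOnNhd_bary j)
      (x := s.points j) ?_ ?_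
    · rw [← s.bary_eq_zero_iff, s.bary_points, if_neg (Ne.symm hj)]
    · simp [s.bary_points]
  rw [ae_restrict_iff' hm]
  have h1 : ∀ᵐ x ∂(SimplexMesh.surf d), x ∉ (hyperplaneThrough (s.outerNormal i) (s.altitudeFoot i) ∩
      {y | s.bary j y = 0}) := measure_eq_zero_iff_ae_notMem.1 h0
  filter_upwards [h1] with x hx hxF _
  have h2 := s.mem_closedInterior_faceOpposite_iff.1 hxF
  exact lt_of_le_of_ne (h2.2 j) fun h => hx ⟨s.bary_eq_zero_iff.1 h2.1, h.symm⟩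

theorem isOpen_interior : IsOpen s.interior := by
  have : s.interior = ⋂ i, {x | 0 < s.bary i x} := by
    ext x; simp [s.mem_interior_iff]
  rw [this]
  exact isOpen_iInter_of_finite fun i => isOpen_lt continuous_const (s.continuous_bary i)

/-- Points on the segment towards the barycentre have positive coordinates, since all coordinates of
the barycentre are `1 / (d + 1)`. -/
theorem closedInterior_subset_closure_interior : s.closedInterior ⊆ closure s.interior := by
  intro x hx
  rw [mem_closedInterior_iff] at hx
  let c : Eu d := ∑ j, (1 / ((d : ℝ) + 1)) • s.points j
  have hc : ∀ i, 0 < s.bary i c := by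
    intro i
    rw [s.bary_sum (w := fun _ => 1 / ((d : ℝ) + 1))]
    · positivity
    · simp; field_simp
  have hlim : Filter.Tendsto (fun t : ℝ => x + t • (c - x)) (nhdsWithin 0 (Set.Ioo 0 1)) (nhds x) := by
    have : Filter.Tendsto (fun t : ℝ => x + t • (c - x)) (nhds 0) (nhds (x + (0 : ℝ) • (c - x))) :=
      Continuous.tendsto (by fun_prop) 0
    rw [zero_smul, add_zero] at this
    exact this.mono_left nhdsWithin_le_nhds
  have : (nhdsWithin (0 : ℝ) (Set.Ioo 0 1)).NeBot := by
    rw [← mem_closure_iff_nhdsWithin_neBot, closure_Ioo zero_ne_one]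
    simp
  refine mem_closure_of_tendsto hlim ?_
  filter_upwards [self_mem_nhdsWithin] with t ht
  rw [mem_interior_iff]
  intro i
  have h1 := s.bary_add_smul i x (c - x) t
  have h2 := s.bary_add_smul i x (c - x) 1
  rw [one_smul, add_sub_cancel] at h2
  have h3 : s.bary i (x + t • (c - x)) = (1 - t) * s.bary i x + t * s.bary i c := by
    rw [h1, h2]; ring
  rw [h3]
  have := mul_nonneg (sub_nonneg.2 ht.2.le) (hx i)
  have := mul_pos ht.1 (hc i)
  linarith

theorem eventually_mem_interior_of_mem_face {i : Fin (d + 1)} {x : Eu d} (hi : s.bary i x = 0)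
    (hpos : ∀ j, j ≠ i → 0 < s.bary j x) :
    ∀ᶠ t : ℝ in nhdsWithin 0 (Set.Ioi 0), x + t • (-s.outerNormal i) ∈ s.interior := by
  simp only [mem_interior_iff, Filter.eventually_all]
  intro j
  by_cases hj : j = i
  · subst hj
    filter_upwards [self_mem_nhdsWithin] with t ht
    rw [bary_add_smul, hi, inner_neg_right, real_inner_self_eq_norm_sq, norm_outerNormal]
    have := s.height_pos j
    have : 0 < t * (s.height j)⁻¹ := mul_pos ht (by positivity)
    linarith
  · refine nhdsWithin_le_nhds ?_
    have hc : Continuous fun t : ℝ => s.bary j (x + t • (-s.outerNormal i)) :=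
      (s.continuous_bary j).comp (by fun_prop)
    exact hc.continuousAt.eventually (lt_mem_nhds (by simpa using hpos j hj))

theorem notMem_closedInterior_of_mem_face {i : Fin (d + 1)} {x : Eu d} (hi : s.bary i x = 0)
    {t : ℝ} (ht : 0 < t) : x + t • s.outerNormal i ∉ s.closedInterior := by
  rw [mem_closedInterior_iff]
  intro h
  have h1 := h i
  rw [bary_add_smul, hi, real_inner_self_eq_norm_sq, norm_outerNormal] at h1
  have := s.height_pos i
  have : 0 < t * (s.height i)⁻¹ := mul_pos ht (by positivity)
  linarith

theorem bary_eq_of_bary_eq_zero {i : Fin (d + 1)} {x : Eu d} (hi : s.bary i x = 0) (y : Eu d) :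
    s.bary i y = -(s.height i)⁻¹ * inner ℝ (s.outerNormal i) (y - x) := by
  have h := s.bary_add_smul i x (y - x) 1
  rw [one_smul, add_sub_cancel, hi] at h
  rw [h]; ring

variable {s s'} {i i' : Fin (d + 1)}

/-- A coordinate that vanishes on a subset of positive measure of a hyperplane vanishes on the whole
hyperplane. Faces with an overlap of positive measure are therefore coplanar. -/
theorem bary_eq_zero_of_surf_inter_ne_zero
    (h : SimplexMesh.surf d ((s.faceOpposite i).closedInterior ∩ (s'.faceOpposite i').closedInterior)
      ≠ 0) {x : Eu d} (hx : s.bary i x = 0) : s'.bary i' x = 0 := by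
  by_contra hne
  refine h (measure_mono_null (Set.inter_subset_inter (s.faceOpposite_subset_hyperplane i)
    (fun y hy => (s'.mem_closedInterior_faceOpposite_iff.1 hy).1)) ?_)
  exact surf_zeros_eq_zero (s.norm_outerNormal i) _ (s'.analyticOnNhd_bary i')
    (s.bary_eq_zero_iff.1 hx) hne

theorem eq_of_surf_inter_ne_zero
    (h : SimplexMesh.surf d ((s.faceOpposite i).closedInterior ∩ (s.faceOpposite i').closedInterior)
      ≠ 0) : i = i' := by
  by_contra hne
  have h1 := bary_eq_zero_of_surf_inter_ne_zero h (x := s.points i') (by simp [bary_points, hne])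
  simp [bary_points] at h1

theorem outerNormal_eq_or_eq_neg
    (h : SimplexMesh.surf d ((s.faceOpposite i).closedInterior ∩ (s'.faceOpposite i').closedInterior)
      ≠ 0) : s'.outerNormal i' = s.outerNormal i ∨ s'.outerNormal i' = -s.outerNormal i := by
  set ν := s.outerNormal i with hν
  set ν' := s'.outerNormal i' with hν'
  have hn : ‖ν‖ = 1 := s.norm_outerNormal i
  have hn' : ‖ν'‖ = 1 := s'.norm_outerNormal i'
  have hνν : inner ℝ ν ν = 1 := by rw [real_inner_self_eq_norm_sq, hn]; norm_num
  set c : ℝ := inner ℝ ν ν' with hc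
  have h0 : s.bary i (s.altitudeFoot i) = 0 := by simp [bary]
  have hw : inner ℝ ν (ν' - c • ν) = 0 := by
    rw [inner_sub_right, inner_smul_right, hνν, ← hc]; ring
  -- Moving by the tangential part `ν' - c ν` stays in the first hyperplane, hence in the second.
  -- This vector is then orthogonal to both `ν` and `ν'`, so to itself.
  have h1 : s.bary i (s.altitudeFoot i + (1 : ℝ) • (ν' - c • ν)) = 0 := by
    rw [bary_add_smul, h0, ← hν, hw]; ring
  have h2 := bary_eq_zero_of_surf_inter_ne_zero h h1
  rw [bary_add_smul, bary_eq_zero_of_surf_inter_ne_zero h h0] at h2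
  have hw' : inner ℝ ν' (ν' - c • ν) = 0 := by
    have := s'.height_pos i'
    simpa [this.ne'] using h2
  have h3 : inner ℝ (ν' - c • ν) (ν' - c • ν) = 0 := by
    conv_lhs => rw [inner_sub_left, inner_smul_left, hw, hw']
    simp
  have h4 : ν' = c • ν := sub_eq_zero.1 (inner_self_eq_zero.1 h3)
  have h5 : |c| = 1 := by
    have := congrArg norm h4
    rw [norm_smul, hn, hn', mul_one, Real.norm_eq_abs] at this
    exact this.symm
  rcases (abs_eq one_pos.le).1 h5 with h | h
  · left; rw [h4, h, one_smul]
  · right; rw [h4, h, neg_one_smul]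

/-- Two simplices with disjoint interiors whose faces overlap lie on opposite sides. -/
theorem outerNormal_eq_neg (hdisj : Disjoint s.interior s'.interior)
    (h : SimplexMesh.surf d ((s.faceOpposite i).closedInterior ∩ (s'.faceOpposite i').closedInterior)
      ≠ 0) : s'.outerNormal i' = -s.outerNormal i ∧
      ∀ᵐ x ∂((SimplexMesh.surf d).restrict
        ((s.faceOpposite i).closedInterior ∩ (s'.faceOpposite i').closedInterior)),
        x ∈ interior (s.closedInterior ∪ s'.closedInterior) := by
  have hm := (s.faceOpposite i).isClosed_closedInterior.measurableSet
  have hm' := (s'.faceOpposite i').isClosed_closedInterior.measurableSet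
  have hae : ∀ᵐ x ∂((SimplexMesh.surf d).restrict
        ((s.faceOpposite i).closedInterior ∩ (s'.faceOpposite i').closedInterior)),
      (s.bary i x = 0 ∧ ∀ j, j ≠ i → 0 < s.bary j x) ∧
      (s'.bary i' x = 0 ∧ ∀ j, j ≠ i' → 0 < s'.bary j x) := by
    filter_upwards [ae_restrict_of_ae_restrict_of_subset Set.inter_subset_left (s.ae_face_bary_pos i),
      ae_restrict_of_ae_restrict_of_subset Set.inter_subset_right (s'.ae_face_bary_pos i'),
      ae_restrict_mem (hm.inter hm')] with x h1 h2 h3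
    exact ⟨⟨(s.mem_closedInterior_faceOpposite_iff.1 h3.1).1, h1⟩,
      (s'.mem_closedInterior_faceOpposite_iff.1 h3.2).1, h2⟩
  have hneg : s'.outerNormal i' = -s.outerNormal i := by
    -- If the normals were equal, a short step inwards from a common relative interior point would
    -- enter both open simplices, which are disjoint.
    refine (outerNormal_eq_or_eq_neg h).resolve_left fun heq => ?_
    have : (ae ((SimplexMesh.surf d).restrict ((s.faceOpposite i).closedInterior ∩
        (s'.faceOpposite i').closedInterior))).NeBot := by
      rw [ae_neBot]
      simpa using h
    obtain ⟨x, hx, hx'⟩ := hae.exists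
    have h1 := s.eventually_mem_interior_of_mem_face hx.1 hx.2
    have h2 := s'.eventually_mem_interior_of_mem_face hx'.1 hx'.2
    rw [heq] at h2
    obtain ⟨t, ht1, ht2⟩ := (h1.and h2).exists
    exact Set.disjoint_left.1 hdisj ht1 ht2
  refine ⟨hneg, ?_⟩
  filter_upwards [hae] with x hx
  obtain ⟨⟨hxi, hx⟩, hxi', hx'⟩ := hx
  rw [mem_interior_iff_mem_nhds]
  have h1 : ∀ᶠ y in nhds x, ∀ j, j ≠ i → 0 < s.bary j y := by
    rw [Filter.eventually_all]
    intro j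
    by_cases hj : j = i
    · simp [hj]
    · filter_upwards [(s.continuous_bary j).continuousAt.eventually (lt_mem_nhds (hx j hj))]
        with y hy _ using hy
  have h2 : ∀ᶠ y in nhds x, ∀ j, j ≠ i' → 0 < s'.bary j y := by
    rw [Filter.eventually_all]
    intro j
    by_cases hj : j = i'
    · simp [hj]
    · filter_upwards [(s'.continuous_bary j).continuousAt.eventually (lt_mem_nhds (hx' j hj))]
        with y hy _ using hy
  filter_upwards [h1, h2] with y hy hy'
  have hs := s.bary_eq_of_bary_eq_zero hxi y
  have hs' := s'.bary_eq_of_bary_eq_zero hxi' y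
  rw [hneg, inner_neg_left] at hs'
  have hp := inv_pos.2 (s.height_pos i)
  have hp' := inv_pos.2 (s'.height_pos i')
  -- Near `x` the two simplices coincide with the two closed half-spaces of their common hyperplane,
  -- so their union is a neighbourhood of `x`.
  rcases le_total (inner ℝ (s.outerNormal i) (y - x)) 0 with hle | hle
  · left
    rw [mem_closedInterior_iff]
    intro j
    by_cases hj : j = i
    · rw [hj, hs]
      nlinarith
    · exact (hy j hj).le
  · right
    rw [mem_closedInterior_iff]
    intro j
    by_cases hj : j = i'
    · rw [hj, hs']
      nlinarith
    · exact (hy' j hj).le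

theorem volume_closedInterior_sdiff_interior (s : Affine.Simplex ℝ (Eu d) d) :
    volume (s.closedInterior \ s.interior) = 0 := by
  rw [s.closedInterior_sdiff_interior, measure_iUnion_null_iff]
  intro i
  refine measure_mono_null (fun y hy => (s.mem_closedInterior_faceOpposite_iff.1 hy).1)
    ((s.analyticOnNhd_bary i).volume_zeros_eq_zero (x := s.points i) ?_)
  simp [bary_points]

end Affine.Simplex

/-! ### Mortars of a simplicial mesh with hanging nodes. -/

/-- If `x` avoided all the other closed sets, so would a neighbourhood of `x`. Points `x + t v` with
small `t > 0` would then lie in no set of the cover. -/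
theorem exists_mem_of_isClosed_cover {d : ℕ} {ι : Type*} [Finite ι] {C : ι → Set (Eu d)}
    (hC : ∀ k, IsClosed (C k)) {U : Set (Eu d)} (hU : IsOpen U) (hcover : U ⊆ ⋃ k, C k)
    {x v : Eu d} (hx : x ∈ U) {k : ι} (hv : ∀ t : ℝ, 0 < t → x + t • v ∉ C k) :
    ∃ l, l ≠ k ∧ x ∈ C l := by
  by_contra! hno
  have hopen : IsOpen (⋃ l : {l // l ≠ k}, C l.1)ᶜ :=
    (isClosed_iUnion_of_finite fun l : {l // l ≠ k} => hC l.1).isOpen_compl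
  have hnhds : ∀ᶠ y in nhds x, y ∈ U ∩ (⋃ l : {l // l ≠ k}, C l.1)ᶜ := by
    refine (hU.inter hopen).mem_nhds ⟨hx, fun hmem => ?_⟩
    obtain ⟨l, hl⟩ := Set.mem_iUnion.1 hmem
    exact hno l.1 l.2 hl
  have hlim : Filter.Tendsto (fun t : ℝ => x + t • v) (nhdsWithin 0 (Set.Ioi 0)) (nhds x) := by
    have : Filter.Tendsto (fun t : ℝ => x + t • v) (nhds 0) (nhds (x + (0 : ℝ) • v)) :=
      Continuous.tendsto (by fun_prop) 0
    rw [zero_smul, add_zero] at this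
    exact this.mono_left nhdsWithin_le_nhds
  obtain ⟨t, ht, ht0⟩ := ((hlim.eventually hnhds).and self_mem_nhdsWithin).exists
  obtain ⟨l, hl⟩ := Set.mem_iUnion.1 (hcover ht.1)
  by_cases hlk : l = k
  · exact hv t ht0 (hlk ▸ hl)
  · exact ht.2 (Set.mem_iUnion.2 ⟨⟨l, hlk⟩, hl⟩)

namespace SimplexMesh

variable {d : ℕ} {Ω : Set (Eu d)} {ι : Type*} (M : SimplexMesh d Ω ι)

theorem isCompact_elem (K : ι) : IsCompact (M.elem K) := (M.simplex K).isCompact_closedInterior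

theorem elem_subset_closure (K : ι) : M.elem K ⊆ closure Ω :=
  M.cover ▸ Set.subset_iUnion (fun K => (M.simplex K).closedInterior) K

variable [NeZero d]

theorem isCompact_face (K : ι) (i : Fin (d + 1)) : IsCompact (M.face K i) :=
  ((M.simplex K).faceOpposite i).isCompact_closedInterior

theorem face_subset_elem (K : ι) (i : Fin (d + 1)) : M.face K i ⊆ M.elem K :=
  (M.simplex K).closedInterior_faceOpposite_subset_closedInterior i

/-- Elements are given only as subsets of `closure Ω`. Their interiors are open, hence inside `Ω` by
regularity of the domain, and what remains of each element is null. Bounds that hold almost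
everywhere in `Ω` therefore pass to the elements. -/
theorem restrict_elem_le (hΩreg : interior (closure Ω) = Ω) (K : ι) :
    volume.restrict (M.elem K) ≤ volume.restrict Ω := by
  refine Measure.restrict_mono' ?_ le_rfl
  have h1 : (M.simplex K).interior ⊆ Ω := by
    exact (interior_maximal ((M.simplex K).interior_subset_closedInterior.trans
      (M.elem_subset_closure K)) (M.simplex K).isOpen_interior).trans hΩreg.le
  have h2 := measure_eq_zero_iff_ae_notMem.1 (M.simplex K).volume_closedInterior_sdiff_interior
  filter_upwards [h2] with x hx hxK
  by_contra hxΩ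
  exact hx ⟨hxK, fun h => hxΩ (h1 h)⟩

/-- Two different element sides that overlap belong to elements on opposite sides, and almost all
common points lie inside the domain. -/
theorem overlapping_sides (hΩreg : interior (closure Ω) = Ω) {q r : ι × Fin (d + 1)} (hqr : q ≠ r)
    (h : surf d (M.face q.1 q.2 ∩ M.face r.1 r.2) ≠ 0) :
    q.1 ≠ r.1 ∧ M.normal r.1 r.2 = -M.normal q.1 q.2 ∧
      ∀ᵐ x ∂((surf d).restrict (M.face q.1 q.2 ∩ M.face r.1 r.2)), x ∈ Ω := by
  have hK : q.1 ≠ r.1 := by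
    intro hK
    refine hqr (Prod.ext hK ?_)
    rw [hK] at h
    exact Affine.Simplex.eq_of_surf_inter_ne_zero h
  have h2 := Affine.Simplex.outerNormal_eq_neg (M.disjoint hK) h
  refine ⟨hK, h2.1, ?_⟩
  filter_upwards [h2.2] with x hx
  rw [← hΩreg]
  exact interior_mono (Set.union_subset (M.elem_subset_closure _) (M.elem_subset_closure _)) hx

theorem normal_ne_zero (K : ι) (i : Fin (d + 1)) : M.normal K i ≠ 0 := by
  have : ‖M.normal K i‖ = 1 := (M.simplex K).norm_outerNormal i
  rw [← norm_ne_zero_iff, this]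
  exact one_ne_zero

/-- Two different overlapping sides meet almost everywhere inside `Ω`, which, being open, misses its
frontier. A boundary mortar thus has a single side. -/
theorem eq_of_surf_inter_frontier (hΩ : IsOpen Ω) (hΩreg : interior (closure Ω) = Ω)
    {q r : ι × Fin (d + 1)} {e : Set (Eu d)} (he : surf d e ≠ 0) (hq : e ⊆ M.face q.1 q.2)
    (hr : e ⊆ M.face r.1 r.2) (hf : e ⊆ frontier Ω) : q = r := by
  by_contra hqr
  have hsub := Set.subset_inter hq hr
  have h1 := (M.overlapping_sides hΩreg hqr (fun h => he (measure_mono_null hsub h))).2.2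
  have hm : MeasurableSet (M.face q.1 q.2 ∩ M.face r.1 r.2) :=
    ((M.isCompact_face _ _).inter (M.isCompact_face _ _)).measurableSet
  rw [ae_restrict_iff' hm] at h1
  refine he (measure_eq_zero_iff_ae_notMem.2 ?_)
  filter_upwards [h1] with x hx hxe
  have := hf hxe
  rw [hΩ.frontier_eq] at this
  exact this.2 (hx (hsub hxe))

/-- If three element sides overlap then two of them are equal. -/
theorem three_sides (hΩreg : interior (closure Ω) = Ω) {q r t : ι × Fin (d + 1)} {e : Set (Eu d)}
    (he : surf d e ≠ 0) (hq : e ⊆ M.face q.1 q.2) (hr : e ⊆ M.face r.1 r.2)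
    (ht : e ⊆ M.face t.1 t.2) (hqr : q ≠ r) : t = q ∨ t = r := by
  by_contra! hne
  have hsub : ∀ {q r : ι × Fin (d + 1)}, e ⊆ M.face q.1 q.2 → e ⊆ M.face r.1 r.2 →
      surf d (M.face q.1 q.2 ∩ M.face r.1 r.2) ≠ 0 := fun hq hr h =>
    he (measure_mono_null (Set.subset_inter hq hr) h)
  have h1 := (M.overlapping_sides hΩreg hqr (hsub hq hr)).2.1
  have h2 := (M.overlapping_sides hΩreg hne.1 (hsub ht hq)).2.1
  have h3 := (M.overlapping_sides hΩreg hne.2 (hsub ht hr)).2.1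
  -- Three pairwise opposite normals would give `n = -n`.
  have h4 : M.normal q.1 q.2 = -M.normal q.1 q.2 := by
    conv_lhs => rw [h2, ← h3, h1]
  have h5 : (2 : ℝ) • M.normal q.1 q.2 = 0 := by
    rw [two_smul]
    nth_rw 2 [h4]
    exact add_neg_cancel _
  exact M.normal_ne_zero q.1 q.2 (by simpa using h5)

variable [Fintype ι]

theorem mem_sides {e : Set (Eu d)} {q : ι × Fin (d + 1)} :
    q ∈ M.sides e ↔ e ⊆ M.face q.1 q.2 := by
  simp [sides]

theorem mem_interiorMortars {e : Set (Eu d)} : e ∈ M.interiorMortars ↔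
    ∃ q r : ι × Fin (d + 1), q.1 ≠ r.1 ∧ surf d e ≠ 0 ∧ e = M.face q.1 q.2 ∩ M.face r.1 r.2 := by
  simp only [interiorMortars, Finset.mem_image, Finset.mem_filter, Finset.mem_univ, true_and]
  constructor
  · rintro ⟨q, ⟨h1, h2⟩, rfl⟩
    exact ⟨q.1, q.2, h1, h2.ne', rfl⟩
  · rintro ⟨q, r, h1, h2, rfl⟩
    exact ⟨(q, r), ⟨h1, pos_iff_ne_zero.2 h2⟩, rfl⟩

theorem mem_boundaryMortars {e : Set (Eu d)} : e ∈ M.boundaryMortars ↔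
    ∃ q : ι × Fin (d + 1), surf d e ≠ 0 ∧ e = M.face q.1 q.2 ∩ frontier Ω := by
  simp only [boundaryMortars, Finset.mem_image, Finset.mem_filter, Finset.mem_univ, true_and]
  constructor
  · rintro ⟨q, h2, rfl⟩
    exact ⟨q, h2.ne', rfl⟩
  · rintro ⟨q, h2, rfl⟩
    exact ⟨q, pos_iff_ne_zero.2 h2, rfl⟩

theorem mem_skeleton {e : Set (Eu d)} :
    e ∈ M.skeleton ↔ e ∈ M.interiorMortars ∨ e ∈ M.boundaryMortars := by
  simp [skeleton]

theorem surf_ne_zero_of_mem_skeleton {e : Set (Eu d)} (he : e ∈ M.skeleton) : surf d e ≠ 0 := by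
  rcases M.mem_skeleton.1 he with he | he
  · obtain ⟨q, r, -, h, -⟩ := M.mem_interiorMortars.1 he
    exact h
  · obtain ⟨q, h, -⟩ := M.mem_boundaryMortars.1 he
    exact h

theorem isCompact_of_mem_skeleton {e : Set (Eu d)} (he : e ∈ M.skeleton) : IsCompact e := by
  rcases M.mem_skeleton.1 he with he | he
  · obtain ⟨q, r, -, -, rfl⟩ := M.mem_interiorMortars.1 he
    exact (M.isCompact_face _ _).inter (M.isCompact_face _ _)
  · obtain ⟨q, -, rfl⟩ := M.mem_boundaryMortars.1 he
    exact (M.isCompact_face _ _).inter_right isClosed_frontier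

theorem exists_mem_sides {e : Set (Eu d)} (he : e ∈ M.skeleton) : ∃ q, q ∈ M.sides e := by
  simp only [mem_sides]
  rcases M.mem_skeleton.1 he with he | he
  · obtain ⟨q, r, -, -, rfl⟩ := M.mem_interiorMortars.1 he
    exact ⟨q, Set.inter_subset_left⟩
  · obtain ⟨q, -, rfl⟩ := M.mem_boundaryMortars.1 he
    exact ⟨q, Set.inter_subset_left⟩

theorem sides_interiorMortar (hΩreg : interior (closure Ω) = Ω) {q r : ι × Fin (d + 1)}
    (hqr : q.1 ≠ r.1) (h : surf d (M.face q.1 q.2 ∩ M.face r.1 r.2) ≠ 0) {t : ι × Fin (d + 1)} :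
    t ∈ M.sides (M.face q.1 q.2 ∩ M.face r.1 r.2) ↔ t = q ∨ t = r := by
  rw [mem_sides]
  constructor
  · intro ht
    exact M.three_sides hΩreg h Set.inter_subset_left Set.inter_subset_right ht
      (fun h => hqr (congrArg Prod.fst h))
  · rintro (rfl | rfl)
    exacts [Set.inter_subset_left, Set.inter_subset_right]

theorem sum_normal_eq_zero (hΩreg : interior (closure Ω) = Ω) {e : Set (Eu d)}
    (he : e ∈ M.interiorMortars) : ∑ s ∈ M.sides e, M.normal s.1 s.2 = 0 := by
  classical
  obtain ⟨q, r, hqr, h, rfl⟩ := M.mem_interiorMortars.1 he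
  have hne : q ≠ r := fun h => hqr (congrArg Prod.fst h)
  have : M.sides (M.face q.1 q.2 ∩ M.face r.1 r.2) = {q, r} := by
    ext t
    rw [M.sides_interiorMortar hΩreg hqr h]
    simp
  rw [this, Finset.sum_pair hne, (M.overlapping_sides hΩreg hne h).2.1, add_neg_cancel]

/-- A mortar on the face `F` is either `F ∩ ∂Ω` or `F ∩ F'` with another side `F'`. If two different
mortars overlapped in positive measure, the overlap would lie on three different sides, or on two
sides and the frontier, and both are excluded. -/
theorem surf_inter_mortars (hΩ : IsOpen Ω) (hΩreg : interior (closure Ω) = Ω)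
    {q : ι × Fin (d + 1)} {e e' : Set (Eu d)} (he : e ∈ M.skeleton) (he' : e' ∈ M.skeleton)
    (hq : e ⊆ M.face q.1 q.2) (hq' : e' ⊆ M.face q.1 q.2) (hne : e ≠ e') :
    surf d (e ∩ e') = 0 := by
  by_contra h
  have key : ∀ {e}, e ∈ M.skeleton → e ⊆ M.face q.1 q.2 → e = M.face q.1 q.2 ∩ frontier Ω ∨
      ∃ r, r ≠ q ∧ e = M.face q.1 q.2 ∩ M.face r.1 r.2 := by
    intro e he heq
    rcases M.mem_skeleton.1 he with he | he
    · right
      obtain ⟨r, t, hrt, h, rfl⟩ := M.mem_interiorMortars.1 he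
      have hrt' : r ≠ t := fun h => hrt (congrArg Prod.fst h)
      rcases (M.sides_interiorMortar hΩreg hrt h).1 (M.mem_sides.2 heq) with rfl | rfl
      · exact ⟨t, hrt'.symm, rfl⟩
      · exact ⟨r, hrt', Set.inter_comm _ _⟩
    · left
      obtain ⟨r, h, rfl⟩ := M.mem_boundaryMortars.1 he
      rw [M.eq_of_surf_inter_frontier hΩ hΩreg h heq Set.inter_subset_left Set.inter_subset_right]
  have hl : e ∩ e' ⊆ e := Set.inter_subset_left
  have hr : e ∩ e' ⊆ e' := Set.inter_subset_right
  rcases key he hq with h1 | ⟨r, hrq, h1⟩ <;> rcases key he' hq' with h2 | ⟨t, htq, h2⟩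
  · exact hne (h1.trans h2.symm)
  · exact htq (M.eq_of_surf_inter_frontier hΩ hΩreg h (hr.trans (h2.trans_le Set.inter_subset_right))
      (hl.trans hq) (hl.trans (h1.trans_le Set.inter_subset_right)))
  · exact hrq (M.eq_of_surf_inter_frontier hΩ hΩreg h (hl.trans (h1.trans_le Set.inter_subset_right))
      (hl.trans hq) (hr.trans (h2.trans_le Set.inter_subset_right)))
  · rcases M.three_sides hΩreg h (hl.trans hq) (hl.trans (h1.trans_le Set.inter_subset_right))
      (hr.trans (h2.trans_le Set.inter_subset_right)) hrq.symm with h3 | h3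
    · exact htq h3
    · exact hne (h1.trans (h3 ▸ h2.symm))

/-- A point of the domain in the relative interior of a face lies on a face of another element. -/
theorem exists_other_face (hΩ : IsOpen Ω) {K : ι} {i : Fin (d + 1)} {x : Eu d}
    (hxF : x ∈ M.face K i) (hxΩ : x ∈ Ω) : ∃ r : ι × Fin (d + 1), r.1 ≠ K ∧ x ∈ M.face r.1 r.2 := by
  have hν : ∀ t : ℝ, 0 < t → x + t • M.normal K i ∉ M.elem K := fun t ht =>
    (M.simplex K).notMem_closedInterior_of_mem_face
      ((M.simplex K).mem_closedInterior_faceOpposite_iff.1 hxF).1 ht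
  obtain ⟨K', hK', hxK'⟩ := exists_mem_of_isClosed_cover (fun K => (M.isCompact_elem K).isClosed)
    hΩ (subset_closure.trans M.cover.ge) hxΩ hν
  -- Interior points of `K` accumulate at `x`, so `x` cannot be interior to a different element.
  have hxI : x ∉ (M.simplex K').interior := by
    intro hxI
    have h5 := (M.simplex K).closedInterior_subset_closure_interior (M.face_subset_elem K i hxF)
    obtain ⟨y, hy1, hy2⟩ := mem_closure_iff.1 h5 _ (M.simplex K').isOpen_interior hxI
    exact Set.disjoint_left.1 (M.disjoint hK') hy1 hy2
  have h6 : x ∈ (M.simplex K').closedInterior := hxK'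
  rw [Affine.Simplex.closedInterior_eq_interior_union] at h6
  obtain ⟨i', hi'⟩ := Set.mem_iUnion.1 (h6.resolve_left hxI)
  exact ⟨(K', i'), hK', hi'⟩

/-- The mortars on a face cover it up to a null set. -/
theorem ae_mem_mortar (hΩ : IsOpen Ω) (K : ι) (i : Fin (d + 1)) :
    ∀ᵐ x ∂((surf d).restrict (M.face K i)), ∃ e ∈ M.skeleton, e ⊆ M.face K i ∧ x ∈ e := by
  have hm : MeasurableSet (M.face K i) := (M.isCompact_face K i).measurableSet
  have h0 : ∀ A : Set (Eu d), ∀ᵐ x ∂((surf d).restrict (M.face K i)),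
      x ∈ A → surf d (M.face K i ∩ A) ≠ 0 := by
    intro A
    by_cases h : surf d (M.face K i ∩ A) = 0
    · rw [ae_restrict_iff' hm]
      filter_upwards [measure_eq_zero_iff_ae_notMem.1 h] with x hx hxF hxr
      exact absurd ⟨hxF, hxr⟩ hx
    · exact Filter.Eventually.of_forall fun _ _ => h
  have h1 : ∀ᵐ x ∂((surf d).restrict (M.face K i)), ∀ r : ι × Fin (d + 1),
      x ∈ M.face r.1 r.2 → surf d (M.face K i ∩ M.face r.1 r.2) ≠ 0 :=
    ae_all_iff.2 fun r => h0 _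
  filter_upwards [h1, h0 (frontier Ω), ae_restrict_mem hm] with x h1 h2 hxF
  by_cases hxf : x ∈ frontier Ω
  · exact ⟨_, M.mem_skeleton.2 (Or.inr (M.mem_boundaryMortars.2 ⟨(K, i), h2 hxf, rfl⟩)),
      Set.inter_subset_left, hxF, hxf⟩
  have hxΩ : x ∈ Ω := by
    have h3 := M.elem_subset_closure K (M.face_subset_elem K i hxF)
    by_contra h
    exact hxf (hΩ.frontier_eq ▸ ⟨h3, h⟩)
  obtain ⟨r, hrK, hxr⟩ := M.exists_other_face hΩ hxF hxΩ
  exact ⟨_, M.mem_skeleton.2 (Or.inl (M.mem_interiorMortars.2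
    ⟨(K, i), r, hrK.symm, h1 r hxr, rfl⟩)), Set.inter_subset_left, hxF, hxr⟩

theorem mem_mortarsOn {K : ι} {i : Fin (d + 1)} {e : {e // e ∈ M.skeleton}} :
    e ∈ M.mortarsOn K i ↔ e.1 ⊆ M.face K i := by
  simp [mortarsOn]

/-- The mortars on a face cover it up to a null set and overlap only in null sets. This turns the
face integrals of the divergence theorem into the mortar sums of the method. -/
theorem integral_face_eq_sum (hΩ : IsOpen Ω) (hΩreg : interior (closure Ω) = Ω) (K : ι)
    (i : Fin (d + 1)) {φ : Eu d → ℝ} (hφ : IntegrableOn φ (M.face K i) (surf d)) :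
    ∫ x in M.face K i, φ x ∂(surf d) = ∑ e ∈ M.mortarsOn K i, ∫ x in e.1, φ x ∂(surf d) := by
  have hsub : ∀ e : {e // e ∈ M.mortarsOn K i}, e.1.1 ⊆ M.face K i := fun e =>
    M.mem_mortarsOn.1 e.2
  have hae : M.face K i =ᵐ[surf d] ⋃ e : {e // e ∈ M.mortarsOn K i}, e.1.1 := by
    refine Filter.EventuallyLE.antisymm ?_ (LE.le.eventuallyLE (Set.iUnion_subset hsub))
    have h1 := M.ae_mem_mortar hΩ K i
    rw [ae_restrict_iff' (M.isCompact_face K i).measurableSet] at h1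
    filter_upwards [h1] with x hx hxF
    obtain ⟨e, he, heF, hxe⟩ := hx hxF
    exact Set.mem_iUnion.2 ⟨⟨⟨e, he⟩, M.mem_mortarsOn.2 heF⟩, hxe⟩
  have hdisj : Pairwise (Function.onFun (AEDisjoint (surf d))
      fun e : {e // e ∈ M.mortarsOn K i} => e.1.1) := fun e e' hne =>
    M.surf_inter_mortars hΩ hΩreg e.1.2 e'.1.2 (q := (K, i)) (hsub e) (hsub e')
      fun h => hne (Subtype.ext (Subtype.ext h))
  rw [setIntegral_congr_set hae, integral_iUnion_ae
    (fun e => (M.isCompact_of_mem_skeleton e.1.2).measurableSet.nullMeasurableSet) hdisj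
    (hφ.mono_set (Set.iUnion_subset hsub)), tsum_fintype,
    Finset.sum_coe_sort (M.mortarsOn K i) (fun e => ∫ x in e.1, φ x ∂(surf d))]

/-- Sums over the mortars in the faces of the elements, sorted by mortars. -/
theorem sum_mortarsOn_eq_sum_sides (f : {e // e ∈ M.skeleton} → ι → Fin (d + 1) → ℝ) :
    ∑ K, ∑ i, ∑ e ∈ M.mortarsOn K i, f e K i = ∑ e, ∑ s ∈ M.sides e.1, f e s.1 s.2 := by
  classical
  rw [← Fintype.sum_prod_type' (f := fun K i => ∑ e ∈ M.mortarsOn K i, f e K i)]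
  refine Finset.sum_comm' ?_
  intro q e
  simp [mem_mortarsOn, mem_sides]

theorem isFiniteMeasure_surf_restrict {e : Set (Eu d)} (he : e ∈ M.skeleton) :
    IsFiniteMeasure ((surf d).restrict e) := by
  obtain ⟨q, hq⟩ := M.exists_mem_sides he
  refine ⟨?_⟩
  rw [Measure.restrict_apply_univ]
  exact (measure_mono (M.mem_sides.1 hq)).trans_lt ((M.simplex q.1).surf_face_lt_top q.2)

end SimplexMesh

/-! ### Absolute value of the normal matrix, upwind reduction and admissibility. -/

/-- A nonzero eigenvalue satisfies `t² = b t + 1`. Hence `(t² + 1)² = (t² - 1)² + 4t² = (b² + 4)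
t²`, so `√(b² + 4) |t| = t² + 1 = 2t² - b t`. The last expression is also correct at `t = 0`. On the
spectrum the absolute value is therefore a quadratic polynomial. -/
theorem absMatrix_eq_of_cubic {m : Type*} [Fintype m] [DecidableEq m] {A : Matrix m m ℝ}
    (hA : A.IsHermitian) {b : ℝ} (h : A * A * A = b • (A * A) + A) :
    absMatrix A = (Real.sqrt (b ^ 2 + 4))⁻¹ • ((2 : ℝ) • (A * A) - b • A) := by
  set ψ := Unitary.conjStarAlgAut ℝ (Matrix m m ℝ) hA.eigenvectorUnitary with hψ
  set l := hA.eigenvalues with hl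
  have hspec : A = ψ (diagonal l) := hA.spectral_theorem
  have hs : 0 < Real.sqrt (b ^ 2 + 4) := Real.sqrt_pos.2 (by positivity)
  have hs2 : Real.sqrt (b ^ 2 + 4) ^ 2 = b ^ 2 + 4 := Real.sq_sqrt (by positivity)
  have hcub : ∀ i, l i * l i * l i = b * (l i * l i) + l i := by
    rw [hspec, ← map_mul, ← map_mul, ← map_smul, ← map_add] at h
    have h2 := ψ.injective h
    intro i
    have h3 := congrFun (congrFun h2 i) i
    simpa using h3
  rw [absMatrix, dif_pos hA, IsHermitian.cfc, ← hψ]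
  conv_rhs => rw [hspec]
  rw [← map_mul, ← map_smul, ← map_smul, ← map_sub, ← map_smul]
  congr 1
  ext i j
  by_cases hij : i = j
  · subst hij
    simp only [diagonal_apply_eq, Function.comp_apply, diagonal_mul_diagonal, Matrix.smul_apply,
      Matrix.sub_apply, smul_eq_mul]
    set s := Real.sqrt (b ^ 2 + 4) with hsdef
    set t := l i with ht
    change |t| = s⁻¹ * (2 * (t * t) - b * t)
    rw [eq_inv_mul_iff_mul_eq₀ hs.ne']
    by_cases ht0 : t = 0
    · simp [ht0]
    have hq : t * t = b * t + 1 := by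
      have := hcub i
      rw [← ht] at this
      exact mul_left_cancel₀ ht0 (by linarith)
    have hsq : (s * t) ^ 2 = (t * t + 1) ^ 2 := by
      rw [mul_pow, hs2]
      have hb : b * t = t * t - 1 := by linarith
      nlinarith
    have h3 : s * |t| = t * t + 1 := by
      rw [← abs_of_pos hs, ← abs_mul, ← abs_of_nonneg (show 0 ≤ t * t + 1 by nlinarith)]
      exact (sq_eq_sq_iff_abs_eq_abs _ _).1 hsq
    rw [h3]; linarith
  · simp [hij]

theorem fromBlocks_sub_fromBlocks {l m n o : Type*} (A A' : Matrix n l ℝ) (B B' : Matrix n m ℝ)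
    (C C' : Matrix o l ℝ) (D D' : Matrix o m ℝ) : fromBlocks A B C D - fromBlocks A' B' C' D' =
      fromBlocks (A - A') (B - B') (C - C') (D - D') := by
  simp only [sub_eq_add_neg, fromBlocks_neg, fromBlocks_add]

/-- The normal matrix `[[0, n], [nᵀ, b]]` of convection–diffusion. -/
noncomputable def convDiffNormal {d : ℕ} (n : Eu d) (b : ℝ) :
    Matrix (Fin d ⊕ Fin 1) (Fin d ⊕ Fin 1) ℝ :=
  fromBlocks 0 (replicateCol (Fin 1) n) (replicateRow (Fin 1) n) (b • 1)

namespace ConvDiff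

variable {d : ℕ}

theorem replicateRow_mul_replicateCol {n : Eu d} (hn : ‖n‖ = 1) :
    replicateRow (Fin 1) n * replicateCol (Fin 1) n = (1 : Matrix (Fin 1) (Fin 1) ℝ) := by
  ext i j
  have h := EuclideanSpace.norm_sq_eq n
  rw [hn] at h
  simp only [Real.norm_eq_abs, sq_abs] at h
  rw [Subsingleton.elim j i]
  simp [mul_apply, ← sq, ← h]

theorem convDiffNormal_sq {n : Eu d} (hn : ‖n‖ = 1) (b : ℝ) :
    convDiffNormal n b * convDiffNormal n b =
      fromBlocks (replicateCol (Fin 1) n * replicateRow (Fin 1) n) (b • replicateCol (Fin 1) n)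
        (b • replicateRow (Fin 1) n) ((1 + b ^ 2) • 1) := by
  rw [convDiffNormal, fromBlocks_multiply, replicateRow_mul_replicateCol hn]
  congr 1
  · simp
  · simp
  · simp
  · simp [smul_smul, add_smul, sq]

theorem convDiffNormal_cube {n : Eu d} (hn : ‖n‖ = 1) (b : ℝ) :
    convDiffNormal n b * convDiffNormal n b * convDiffNormal n b =
      b • (convDiffNormal n b * convDiffNormal n b) + convDiffNormal n b := by
  rw [convDiffNormal_sq hn, convDiffNormal, fromBlocks_multiply, fromBlocks_smul, fromBlocks_add]
  congr 1
  · simp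
  · rw [Matrix.mul_assoc, replicateRow_mul_replicateCol hn]
    simp only [Matrix.mul_one, Matrix.mul_smul, smul_smul]
    module
  · simp only [Matrix.mul_zero, Matrix.smul_mul, Matrix.one_mul, zero_add]
    module
  · rw [Matrix.smul_mul, replicateRow_mul_replicateCol hn]
    simp only [Matrix.smul_mul, Matrix.mul_smul, Matrix.one_mul]
    module

theorem isHermitian_convDiffNormal (n : Eu d) (b : ℝ) : (convDiffNormal n b).IsHermitian := by
  rw [convDiffNormal, isHermitian_fromBlocks_iff]
  refine ⟨by simp, ?_, ?_, ?_⟩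
  · ext i j; simp
  · ext i j; simp
  · ext i j; simp [Subsingleton.elim i j]

theorem absMatrix_convDiffNormal {n : Eu d} (hn : ‖n‖ = 1) (b : ℝ) :
    absMatrix (convDiffNormal n b) = fromBlocks
      ((2 / Real.sqrt (b ^ 2 + 4)) • (replicateCol (Fin 1) n * replicateRow (Fin 1) n))
      ((b / Real.sqrt (b ^ 2 + 4)) • replicateCol (Fin 1) n)
      ((b / Real.sqrt (b ^ 2 + 4)) • replicateRow (Fin 1) n)
      (((b ^ 2 + 2) / Real.sqrt (b ^ 2 + 4)) • 1) := by
  rw [absMatrix_eq_of_cubic (isHermitian_convDiffNormal n b) (convDiffNormal_cube hn b),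
    convDiffNormal_sq hn, convDiffNormal, fromBlocks_smul, fromBlocks_smul, fromBlocks_sub_fromBlocks,
    fromBlocks_smul]
  congr 1
  · rw [smul_zero, sub_zero, smul_smul]; congr 1; ring
  · rw [smul_smul, ← sub_smul, smul_smul]; congr 1; ring
  · rw [smul_smul, ← sub_smul, smul_smul]; congr 1; ring
  · rw [smul_smul, smul_smul, ← sub_smul, smul_smul]; congr 1; ring

theorem system_B (κ : Eu d → Matrix (Fin d) (Fin d) ℝ) (β : Eu d → Eu d) (k : Fin d) (x : Eu d) :
    (system κ β).B k x = replicateCol (Fin 1) (Pi.single k 1) := by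
  simp [system, TwoFieldSystem.B]

theorem upwindReduction (hd : 2 ≤ d) (κ : Eu d → Matrix (Fin d) (Fin d) ℝ) (β : Eu d → Eu d)
    (x : Eu d) {n : Eu d} (hn : ‖n‖ = 1) {b : ℝ} (hb : b ≠ 0) :
    ∃ Φ Ψ : Matrix (Fin 1) (Fin 1) ℝ,
      UpwindReduction (fun k => (system κ β).B k x) (convDiffNormal n b) Φ Ψ ∧
      upwindStabilization (convDiffNormal n b) Φ Ψ =
        Matrix.of fun _ _ => (1 / 2) * (Real.sqrt (|b| ^ 2 + 4) - b) := by
  have hs : 0 < Real.sqrt (b ^ 2 + 4) := Real.sqrt_pos.2 (by positivity)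
  have hs2 : Real.sqrt (b ^ 2 + 4) ^ 2 = b ^ 2 + 4 := Real.sq_sqrt (by positivity)
  have hcol : ∀ (k : Fin d) (v : Fin 1 → ℝ) (i : Fin d),
      (replicateCol (Fin 1) (Pi.single k 1 : Fin d → ℝ) *ᵥ v) i = if i = k then v 0 else 0 := by
    intro k v i
    simp [mulVec, dotProduct, Pi.single_apply]
  -- With `s = √(b² + 4)`, the blocks of `|A|` are `(2/s) n nᵀ`, `(b/s) n` and `(b/s) nᵀ`. Comparing
  -- them with `B Φ (b/s) nᵀ` and `B Ψ`, where `B = n`, gives `Φ = 2/b` and `Ψ = b/s`.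
  refine ⟨(2 / b) • 1, (b / Real.sqrt (b ^ 2 + 4)) • 1, ⟨?_, ?_, ?_, ?_, ?_⟩, ?_⟩
  · exact (isUnit_one).smul (Units.mk0 (2 / b) (by positivity)) 
  · rw [absMatrix_convDiffNormal hn, convDiffNormal]
    simp only [toBlocks_fromBlocks₁₂, toBlocks_fromBlocks₂₁, toBlocks_fromBlocks₁₁,
      Matrix.mul_smul, Matrix.mul_one, Matrix.smul_mul, smul_smul]
    congr 1
    field_simp
  · rw [absMatrix_convDiffNormal hn, convDiffNormal]
    simp only [toBlocks_fromBlocks₁₂, Matrix.mul_smul, Matrix.mul_one]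
  · rw [eq_bot_iff]
    intro v hv
    simp only [system_B, Submodule.mem_iInf, LinearMap.mem_range, mulVecLin_apply] at hv
    rw [Submodule.mem_bot]
    ext i
    -- The range of `B_k` is the line spanned by `e_k`, so component `i` is seen to vanish by using
    -- some `k ≠ i`. This is where `d ≥ 2` enters.
    have : Nontrivial (Fin d) := Fin.nontrivial_iff_two_le.2 hd
    obtain ⟨k, hk⟩ := exists_ne i
    obtain ⟨w, rfl⟩ := hv k
    rw [hcol, if_neg hk.symm]
    rfl
  · intro k
    rw [eq_bot_iff]
    intro v hv
    simp only [system_B, LinearMap.mem_ker, mulVecLin_apply] at hv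
    rw [Submodule.mem_bot]
    ext i
    have := congrFun hv k
    rw [hcol, if_pos rfl] at this
    rw [Subsingleton.elim i 0, this]
    rfl
  · have htr : (replicateCol (Fin 1) n)ᵀ = replicateRow (Fin 1) n := by ext; rfl
    rw [upwindStabilization, absMatrix_convDiffNormal hn, convDiffNormal]
    simp only [toBlocks_fromBlocks₁₂, toBlocks_fromBlocks₂₂, htr, transpose_smul, transpose_one,
      Matrix.smul_mul, Matrix.one_mul, Matrix.mul_smul, Matrix.mul_one,
      replicateRow_mul_replicateCol hn, smul_smul]
    have hinv : ((2 / b * (2 / b)) • (1 : Matrix (Fin 1) (Fin 1) ℝ))⁻¹ = (b ^ 2 / 4) • 1 := by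
      refine Matrix.inv_eq_left_inv ?_
      rw [Matrix.smul_mul, Matrix.mul_smul, Matrix.one_mul, smul_smul]
      rw [show b ^ 2 / 4 * (2 / b * (2 / b)) = 1 by field_simp; norm_num, one_smul]
    rw [hinv]
    ext i j
    rw [Subsingleton.elim j i]
    simp only [Matrix.smul_mul, Matrix.one_mul, Matrix.add_apply, Matrix.neg_apply, Matrix.smul_apply, one_apply_eq,
      of_apply, smul_eq_mul, sq_abs]
    field_simp
    linear_combination (-4) * hs2

theorem half_add_stab_posDef (b : ℝ) :
    ((1 / 2 : ℝ) • (b • (1 : Matrix (Fin 1) (Fin 1) ℝ)) +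
      Matrix.of fun _ _ => (1 / 2) * (Real.sqrt (|b| ^ 2 + 4) - b)).PosDef := by
  have hs : 0 < Real.sqrt (|b| ^ 2 + 4) := Real.sqrt_pos.2 (by positivity)
  have : ((1 / 2 : ℝ) • (b • (1 : Matrix (Fin 1) (Fin 1) ℝ)) +
      Matrix.of fun _ _ => (1 / 2) * (Real.sqrt (|b| ^ 2 + 4) - b)) =
      diagonal fun _ => (1 / 2) * Real.sqrt (|b| ^ 2 + 4) := by
    ext i j
    rw [Subsingleton.elim j i]
    simp
    ring
  rw [this]
  exact PosDef.diagonal fun _ => by positivity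

theorem admissible (n : Eu d) (hn : ‖n‖ = 1) (b α ϱ : ℝ) (hα : α = 1 ∨ α = -1)
    (hϱ : 0 ≤ 2 * ϱ + b) :
    AdmissibleBoundaryOperator (convDiffNormal n b) (boundaryOperator (convDiffNormal n b) α ϱ) := by
  have hnn : (n : Fin d → ℝ) ⬝ᵥ n = 1 := by
    have h := EuclideanSpace.norm_sq_eq n
    rw [hn] at h
    simp only [Real.norm_eq_abs, sq_abs] at h
    simp [dotProduct, ← sq, ← h]
  have hrow : ∀ (w : Fin d → ℝ), replicateRow (Fin 1) (n : Fin d → ℝ) *ᵥ w = fun _ => n ⬝ᵥ w := by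
    intro w; ext i; simp [mulVec]
  have hcol : ∀ (w : Fin 1 → ℝ), replicateCol (Fin 1) (n : Fin d → ℝ) *ᵥ w = w 0 • (n : Fin d → ℝ) := by
    intro w; ext i; simp [mulVec, dotProduct, mul_comm]
  have htr : (replicateCol (Fin 1) n)ᵀ = replicateRow (Fin 1) n := by ext; rfl
  have hM : boundaryOperator (convDiffNormal n b) α ϱ = fromBlocks 0 (-(α • replicateCol (Fin 1) n))
      (α • replicateRow (Fin 1) n) ((2 * ϱ + b) • 1) := by
    rw [boundaryOperator, convDiffNormal]
    simp only [toBlocks_fromBlocks₁₂, toBlocks_fromBlocks₂₂, htr, add_smul]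
  rw [AdmissibleBoundaryOperator, hM]
  constructor
  · intro v
    rw [fromBlocks_mulVec]
    simp only [zero_mulVec, dotProduct_zero, neg_mulVec, smul_mulVec, hcol, hrow, one_mulVec, zero_add]
    simp only [dotProduct, Fintype.sum_sum_type, Sum.elim_inl, Sum.elim_inr]
    simp only [Pi.neg_apply, Pi.smul_apply, Pi.add_apply, smul_eq_mul, Fin.sum_univ_one,
      Function.comp_apply]
    -- The off-diagonal blocks are skew, so their contributions cancel and only `(2ϱ + b) t²`
    -- remains.
    have h1 : ∑ x, v (Sum.inl x) * -(α * (v (Sum.inr 0) * n x)) =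
        -(v (Sum.inr 0) * (α * ∑ x, n x * v (Sum.inl x))) := by
      rw [Finset.mul_sum, Finset.mul_sum, ← Finset.sum_neg_distrib]
      exact Finset.sum_congr rfl fun _ _ => by ring
    rw [h1]
    nlinarith [mul_nonneg hϱ (mul_self_nonneg (v (Sum.inr 0)))]
  · rw [eq_top_iff]
    intro v _
    have hsub : convDiffNormal n b - fromBlocks 0 (-(α • replicateCol (Fin 1) n))
        (α • replicateRow (Fin 1) n) ((2 * ϱ + b) • 1) = fromBlocks 0
        ((1 + α) • replicateCol (Fin 1) n) ((1 - α) • replicateRow (Fin 1) n) ((-2 * ϱ) • 1) := by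
      rw [convDiffNormal, fromBlocks_sub_fromBlocks]
      congr 1
      · simp
      · module
      · module
      · module
    have hadd : convDiffNormal n b + fromBlocks 0 (-(α • replicateCol (Fin 1) n))
        (α • replicateRow (Fin 1) n) ((2 * ϱ + b) • 1) = fromBlocks 0
        ((1 - α) • replicateCol (Fin 1) n) ((1 + α) • replicateRow (Fin 1) n)
        ((2 * ϱ + 2 * b) • 1) := by
      rw [convDiffNormal, fromBlocks_add]
      congr 1
      · simp
      · module
      · module
      · module
    rw [hsub, hadd]
    set V := v ∘ Sum.inl with hV
    set t : ℝ := v (Sum.inr 0) with ht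
    -- One summand has no scalar component. The other carries all of `t`, together with a multiple
    -- `t c` of `n` chosen to solve the scalar equation of its kernel: `c = -(ϱ + b)` for `α = 1`,
    -- and `c = ϱ` for `α = -1`.
    have hv : ∀ c : ℝ, v = Sum.elim (V - (t * c) • (n : Fin d → ℝ)) (fun _ => 0) +
        Sum.elim ((t * c) • (n : Fin d → ℝ)) (fun _ => t) := by
      intro c
      ext i
      rcases i with i | i
      · simp [hV]
      · simp [ht, Subsingleton.elim i 0]
    have hker : ∀ (p q r : ℝ) (W : Fin d → ℝ) (s : ℝ), p * s = 0 → q * (n ⬝ᵥ W) + r * s = 0 →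
        Sum.elim W (fun _ : Fin 1 => s) ∈ LinearMap.ker (fromBlocks 0
          (p • replicateCol (Fin 1) n) (q • replicateRow (Fin 1) n)
          (r • 1) : Matrix (Fin d ⊕ Fin 1) (Fin d ⊕ Fin 1) ℝ).mulVecLin := by
      intro p q r W s h1 h2
      rw [LinearMap.mem_ker, mulVecLin_apply, fromBlocks_mulVec]
      simp only [zero_mulVec, smul_mulVec, hcol, hrow, one_mulVec, zero_add, Sum.elim_comp_inl,
        Sum.elim_comp_inr, smul_smul, h1, zero_smul]
      ext i
      rcases i with i | i
      · simp
      · simpa using h2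
    rcases hα with rfl | rfl
    · refine Submodule.mem_sup.2 ⟨_, hker _ _ _ (V - (t * (-(ϱ + b))) • (n : Fin d → ℝ)) 0
        (mul_zero _) (by ring), _, hker _ _ _ ((t * (-(ϱ + b))) • (n : Fin d → ℝ)) t (by ring) ?_,
        (hv _).symm⟩
      rw [dotProduct_smul, hnn, smul_eq_mul]; ring
    · refine Submodule.mem_sup.2 ⟨_, hker _ _ _ ((t * ϱ) • (n : Fin d → ℝ)) t (by ring) ?_, _,
        hker _ _ _ (V - (t * ϱ) • (n : Fin d → ℝ)) 0 (mul_zero _) (by ring),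
        (add_comm _ _).trans (hv _).symm⟩
      rw [dotProduct_smul, hnn, smul_eq_mul]; ring

theorem two_rho_add_nonneg {ι : Type*} (b : ι → Eu d → ℝ) (K : ι) (i : Fin (d + 1)) (x : Eu d) :
    0 ≤ 2 * rho b K i x + b K x := by
  unfold rho
  split_ifs with h1 h2
  · linarith
  · simp [h2]
  · linarith [not_lt.1 h1]

theorem normalMatrix_eq [NeZero d] {Ω : Set (Eu d)} {ι : Type*} (M : SimplexMesh d Ω ι)
    (b : ι → Eu d → ℝ) (K : ι) (i : Fin (d + 1)) (x : Eu d) :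
    normalMatrix M b K i x = convDiffNormal (M.normal K i) (b K x) := by
  rw [normalMatrix, convDiffNormal]
  congr 1
  ext i j
  simp [Subsingleton.elim i j]

end ConvDiff

/-! ### Bounds for the inverse diffusivity and partial coercivity. -/

section Coercive

variable {m : Type*} [Fintype m] [DecidableEq m] {A : Matrix m m ℝ} {c : ℝ}

theorem QuadLE.mul_dotProduct_le (h : QuadLE (c • 1) A) (w : m → ℝ) :
    c * (w ⬝ᵥ w) ≤ w ⬝ᵥ (A *ᵥ w) := by
  have := h w
  rwa [smul_mulVec, one_mulVec, dotProduct_smul, smul_eq_mul] at this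

theorem QuadLE.isUnit_det (hc : 0 < c) (h : QuadLE (c • 1) A) : IsUnit A.det := by
  rw [← Matrix.isUnit_iff_isUnit_det, ← Matrix.mulVec_injective_iff_isUnit]
  intro v w hvw
  have h0 : A *ᵥ (v - w) = 0 := by rw [mulVec_sub]; exact sub_eq_zero.2 hvw
  have h1 := h.mul_dotProduct_le (v - w)
  rw [h0, dotProduct_zero] at h1
  have h2 : (v - w) ⬝ᵥ (v - w) = 0 :=
    le_antisymm (by nlinarith) (Finset.sum_nonneg fun i _ => mul_self_nonneg _)
  exact sub_eq_zero.1 (dotProduct_self_eq_zero.1 h2)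

omit [DecidableEq m] in
theorem sq_le_dotProduct_self (w : m → ℝ) (i : m) : w i ^ 2 ≤ w ⬝ᵥ w := by
  rw [sq]
  exact Finset.single_le_sum (f := fun i => w i * w i) (fun i _ => mul_self_nonneg _) (Finset.mem_univ i)

/-- For column `w` number `j` of the inverse, coercivity reads `c |w|² ≤ w j`. Hence `c w j ≤ 1`,
and then `(c w i)² ≤ c w j ≤ 1`. -/
theorem QuadLE.abs_inv_apply_le (hc : 0 < c) (h : QuadLE (c • 1) A) (i j : m) :
    |A⁻¹ i j| ≤ 1 / c := by
  set w := A⁻¹ *ᵥ Pi.single j 1 with hw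
  have hAw : A *ᵥ w = Pi.single j 1 := by
    rw [hw, mulVec_mulVec, Matrix.mul_nonsing_inv _ (h.isUnit_det hc), one_mulVec]
  have hwi : ∀ i, w i = A⁻¹ i j := fun i => by simp [hw]
  have h1 := h.mul_dotProduct_le w
  rw [hAw, dotProduct_single, mul_one] at h1
  have h2 := sq_le_dotProduct_self w j
  have h3 := sq_le_dotProduct_self w i
  rw [← hwi]
  have h4 : c * w j ≤ 1 := by
    by_contra! hlt
    have : 0 < w j := by
      by_contra! hle
      nlinarith
    nlinarith
  have h5 : (c * w i) ^ 2 ≤ 1 := by nlinarith [mul_le_mul_of_nonneg_left h3 hc.le]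
  have h6 : |c * w i| ≤ 1 := by
    rw [← sq_abs] at h5
    nlinarith [abs_nonneg (c * w i)]
  rw [abs_mul, abs_of_pos hc] at h6
  rw [le_div_iff₀ hc]
  linarith

/-- Write `v = A w`. Coercivity bounds `v · A⁻¹ v = w · A w` below by `c |w|²`, and the entry bound
gives `|v|² ≤ N |w|²` with `N = m² C²`, where `m` is the number of indices. The `+ 1` keeps the
denominator positive when `N = 0`. -/
theorem QuadLE.inv (hc : 0 < c) (h : QuadLE (c • 1) A) {C : ℝ} (hC : ∀ i j, |A i j| ≤ C) :
    QuadLE ((c / ((Fintype.card m : ℝ) * (Fintype.card m * C ^ 2) + 1)) • 1) A⁻¹ := by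
  intro v
  rw [smul_mulVec, one_mulVec, dotProduct_smul, smul_eq_mul]
  set w := A⁻¹ *ᵥ v with hw
  have hAw : A *ᵥ w = v := by
    rw [hw, mulVec_mulVec, Matrix.mul_nonsing_inv _ (h.isUnit_det hc), one_mulVec]
  have h1 := h.mul_dotProduct_le w
  rw [hAw, dotProduct_comm w v] at h1
  have hww : 0 ≤ w ⬝ᵥ w := Finset.sum_nonneg fun i _ => mul_self_nonneg _
  have h2 : ∀ i, v i * v i ≤ (Fintype.card m * C ^ 2) * (w ⬝ᵥ w) := by
    intro i
    have h3 : v i = ∑ j, A i j * w j := by rw [← hAw]; rfl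
    have h4 := Finset.sum_mul_sq_le_sq_mul_sq Finset.univ (fun j => A i j) w
    rw [← h3] at h4
    have h5 : ∑ j, A i j ^ 2 ≤ Fintype.card m * C ^ 2 := by
      rw [← nsmul_eq_mul, ← Finset.card_univ]
      exact Finset.sum_le_card_nsmul _ _ _ fun j _ => sq_le_sq.2 ((hC i j).trans (le_abs_self _))
    have h6 : ∑ j, w j ^ 2 = w ⬝ᵥ w := Finset.sum_congr rfl fun j _ => sq _
    rw [h6] at h4
    nlinarith [mul_le_mul_of_nonneg_right h5 hww]
  have h7 : v ⬝ᵥ v ≤ (Fintype.card m : ℝ) * ((Fintype.card m * C ^ 2) * (w ⬝ᵥ w)) := by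
    rw [← nsmul_eq_mul, ← Finset.card_univ (α := m)]
    exact Finset.sum_le_card_nsmul _ _ _ fun i _ => h2 i
  set N : ℝ := (Fintype.card m : ℝ) * (Fintype.card m * C ^ 2) with hN
  have hNn : 0 ≤ N := by positivity
  have h8 : v ⬝ᵥ v ≤ (N + 1) * (w ⬝ᵥ w) := by
    rw [← mul_assoc, ← hN] at h7
    linarith
  rw [div_mul_eq_mul_div, div_le_iff₀ (by positivity)]
  calc c * (v ⬝ᵥ v) ≤ c * ((N + 1) * (w ⬝ᵥ w)) := mul_le_mul_of_nonneg_left h8 hc.le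
    _ = (N + 1) * (c * (w ⬝ᵥ w)) := by ring
    _ ≤ (N + 1) * (v ⬝ᵥ w) := mul_le_mul_of_nonneg_left h1 (by positivity)
    _ = (v ⬝ᵥ w) * (N + 1) := mul_comm _ _

theorem measurable_matrix_inv_apply (i j : m) :
    Measurable fun A : m → m → ℝ => (Matrix.of A)⁻¹ i j := by
  have h1 : Continuous fun A : m → m → ℝ => (Matrix.of A).det := Continuous.matrix_det continuous_id
  have h2 : Continuous fun A : m → m → ℝ => (Matrix.of A).adjugate i j :=
    (Continuous.matrix_adjugate continuous_id).matrix_elem i j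
  have h3 : (fun A : m → m → ℝ => (Matrix.of A)⁻¹ i j) =
      fun A => ((Matrix.of A).det)⁻¹ * (Matrix.of A).adjugate i j := by
    ext A
    rw [Matrix.inv_def, Ring.inverse_eq_inv', Matrix.smul_apply, smul_eq_mul]
  rw [h3]
  exact h1.measurable.inv.mul h2.measurable

end Coercive

theorem memLp_inv_apply {α m : Type*} [MeasurableSpace α] [Fintype m] [DecidableEq m]
    {μ : Measure α} {κ : α → Matrix m m ℝ} (hκ : ∀ i j, MemLp (fun x => κ x i j) ⊤ μ) {κ₀ : ℝ}
    (hκ₀ : 0 < κ₀) (hκpos : ∀ᵐ x ∂μ, QuadLE (κ₀ • 1) (κ x)) (i j : m) :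
    MemLp (fun x => (κ x)⁻¹ i j) ⊤ μ := by
  have hmeas : AEMeasurable (fun x => (fun i j => κ x i j : m → m → ℝ)) μ := by
    refine aemeasurable_pi_iff.2 fun i => aemeasurable_pi_iff.2 fun j => ?_
    exact (hκ i j).1.aemeasurable
  have h1 : AEMeasurable (fun x => (κ x)⁻¹ i j) μ :=
    (measurable_matrix_inv_apply i j).comp_aemeasurable hmeas
  refine memLp_top_of_bound h1.aestronglyMeasurable (1 / κ₀) ?_
  filter_upwards [hκpos] with x hx
  exact hx.abs_inv_apply_le hκ₀ i j

/-- Integration by parts against the constant function `1`. It provides the zero weak divergence of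
the constant entries of the `A_k`. -/
theorem integral_fderiv_const_eq_zero {d : ℕ} {Ω : Set (Eu d)} {φ : Eu d → ℝ} (hφ : ContDiff ℝ ∞ φ)
    (hc : HasCompactSupport φ) (hs : tsupport φ ⊆ Ω) (v : Eu d) :
    ∫ x in Ω, fderiv ℝ φ x v = 0 := by
  have h1 : ∀ x, x ∉ Ω → fderiv ℝ φ x v = 0 := by
    intro x hx
    have : x ∉ tsupport (fderiv ℝ φ) := fun h => hx (hs (tsupport_fderiv_subset ℝ h))
    rw [image_eq_zero_of_notMem_tsupport this]
    rfl
  rw [setIntegral_eq_integral_of_forall_compl_eq_zero h1]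
  have h2 : Continuous fun x => fderiv ℝ φ x v :=
    (hφ.continuous_fderiv (by simp)).clm_apply continuous_const
  have h3 : HasCompactSupport fun x => fderiv ℝ φ x v :=
    (hc.fderiv (𝕜 := ℝ)).comp_left (g := fun L : Eu d →L[ℝ] ℝ => L v) rfl
  have h4 := integral_bilinear_hasFDerivAt_right_eq_neg_left_of_integrable (μ := (volume : Measure (Eu d)))
    (f := fun _ : Eu d => (1 : ℝ)) (f' := fun _ => 0) (g := φ) (g' := fun x => fderiv ℝ φ x)
    (v := v) (B := ContinuousLinearMap.mul ℝ ℝ) (by simp)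
    (by simpa using h2.integrable_of_hasCompactSupport h3)
    (by simpa using hφ.continuous.integrable_of_hasCompactSupport hc)
    (fun x _ => hasFDerivAt_const _ _) (fun x _ => (hφ.differentiable (by simp) x).hasFDerivAt)
  simpa using h4

namespace ConvDiff

variable {d : ℕ} {Ω : Set (Eu d)} {κ : Eu d → Matrix (Fin d) (Fin d) ℝ} {β : Eu d → Eu d}
  {divβ : Eu d → ℝ}

theorem memLp_apply {μ : Measure (Eu d)} (hβ : MemLp β ⊤ μ) (k : Fin d) :
    MemLp (fun x => β x k) ⊤ μ :=
  hβ.of_le ((EuclideanSpace.proj k : Eu d →L[ℝ] ℝ).continuous.comp_aestronglyMeasurable hβ.1)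
    (Filter.Eventually.of_forall fun x => PiLp.norm_apply_le (β x) k)

theorem exists_entry_bound {μ : Measure (Eu d)} (hκ : ∀ i j, MemLp (fun x => κ x i j) ⊤ μ) :
    ∃ C : ℝ, ∀ᵐ x ∂μ, ∀ i j, |κ x i j| ≤ C := by
  have h1 : ∀ i j, ∃ C : ℝ, ∀ᵐ x ∂μ, |κ x i j| ≤ C := by
    intro i j
    refine ⟨(eLpNorm (fun x => κ x i j) ⊤ μ).toReal, ?_⟩
    filter_upwards [ae_le_eLpNormEssSup (f := fun x => κ x i j) (μ := μ)] with x hx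
    rw [← Real.norm_eq_abs, ← toReal_enorm]
    rw [← eLpNorm_exponent_top] at hx
    exact ENNReal.toReal_mono (hκ i j).2.ne hx
  choose C hC using h1
  refine ⟨∑ i, ∑ j, |C i j|, ?_⟩
  have h2 : ∀ᵐ x ∂μ, ∀ i j, |κ x i j| ≤ C i j := by
    rw [ae_all_iff]; intro i
    rw [ae_all_iff]; exact hC i
  filter_upwards [h2] with x hx i j
  calc |κ x i j| ≤ |C i j| := (hx i j).trans (le_abs_self _)
    _ ≤ ∑ j, |C i j| := Finset.single_le_sum (f := fun j => |C i j|) (fun _ _ => abs_nonneg _) (Finset.mem_univ j)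
    _ ≤ ∑ i, ∑ j, |C i j| := Finset.single_le_sum (f := fun i => ∑ j, |C i j|)
      (fun _ _ => Finset.sum_nonneg fun _ _ => abs_nonneg _) (Finset.mem_univ i)

theorem isPartiallyCoercive (hκ : ∀ i j, MemLp (fun x => κ x i j) ∞ (volume.restrict Ω))
    (hκsymm : ∀ᵐ x ∂(volume.restrict Ω), (κ x)ᵀ = κ x) {κ₀ : ℝ} (hκ₀ : 0 < κ₀)
    (hκpos : ∀ᵐ x ∂(volume.restrict Ω), QuadLE (κ₀ • (1 : Matrix (Fin d) (Fin d) ℝ)) (κ x))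
    (hβ : MemLp β ∞ (volume.restrict Ω)) (hdivβ : MemLp divβ ∞ (volume.restrict Ω))
    (hdiv : HasWeakDivergence Ω β divβ)
    (hcoer : ∀ᵐ x ∂(volume.restrict Ω), 0 ≤ (1 / 2) * divβ x) :
    (system κ β).IsPartiallyCoercive Ω := by
  have hconst : ∀ c : ℝ, MemLp (fun _ : Eu d => c) ∞ (volume.restrict Ω) := fun c =>
    memLp_top_const c
  obtain ⟨C, hC⟩ := exists_entry_bound hκ
  set k₀ : ℝ := κ₀ / ((Fintype.card (Fin d) : ℝ) * (Fintype.card (Fin d) * C ^ 2) + 1) with hk₀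
  have hk₀pos : 0 < k₀ := by positivity
  have hinv : ∀ᵐ x ∂(volume.restrict Ω), QuadLE (k₀ • (1 : Matrix (Fin d) (Fin d) ℝ)) (κ x)⁻¹ := by
    filter_upwards [hκpos, hC] with x hx hCx
    exact hx.inv hκ₀ hCx
  have hA : ∀ k x, (system κ β).A k x = fromBlocks 0 (replicateCol (Fin 1) (Pi.single k 1))
      (replicateRow (Fin 1) (Pi.single k 1)) (Matrix.of fun _ _ => β x k) := fun k x => rfl
  refine ⟨?_, ?_, ?_, ?_, ?_, ?_, ?_, k₀, hk₀pos, ?_⟩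
  · rintro (i | i) (j | j)
    · exact memLp_inv_apply hκ hκ₀ hκpos i j
    · exact hconst 0
    · exact hconst 0
    · exact hconst 0
  · rintro k (i | i) (j | j)
    · exact hconst 0
    · exact hconst _
    · exact hconst _
    · exact memLp_apply hβ k
  · intro k
    refine Filter.Eventually.of_forall fun x => ?_
    rw [hA, fromBlocks_transpose]
    congr 1
  -- Only the `uu` entry of `A_k` is variable, so `∑ ∂_k A_k` contains nothing but `∇·β`. By
  -- symmetry of `κ` the `σσ` block of `G + Gᵀ` is `2 κ⁻¹`, which lets `k₀` also serve as `μ₀`.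
  · refine ⟨fun x => fromBlocks 0 0 0 (Matrix.of fun _ _ => divβ x), ?_, ?_, k₀, hk₀pos, ?_⟩
    · rintro (i | i) (j | j)
      · exact hconst 0
      · exact hconst 0
      · exact hconst 0
      · exact hdivβ
    · have hz : ∀ c : Eu d, HasWeakDivergence Ω (fun _ => c) (fun _ => 0) := by
        intro c φ hφ hφc hφs
        rw [integral_fderiv_const_eq_zero hφ hφc hφs]
        simp
      rintro (i | i) (j | j)
      · exact hz (WithLp.toLp 2 fun _ => 0)
      · exact hz (WithLp.toLp 2 fun k => (Pi.single k 1 : Fin d → ℝ) i)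
      · exact hz (WithLp.toLp 2 fun k => (Pi.single k 1 : Fin d → ℝ) j)
      · exact hdiv
    · filter_upwards [hinv, hκsymm, hcoer] with x hx hsym hdx
      intro v
      have hG : (system κ β).G x = fromBlocks (κ x)⁻¹ 0 0 0 := rfl
      rw [hG, fromBlocks_transpose, fromBlocks_add, fromBlocks_add, fromBlocks_smul,
        fromBlocks_mulVec, fromBlocks_mulVec, transpose_nonsing_inv, hsym]
      have h1 := hx (v ∘ Sum.inl)
      simp only [dotProduct, Fintype.sum_sum_type, Sum.elim_inl, Sum.elim_inr] at h1 ⊢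
      simp only [add_zero, zero_add, smul_zero, zero_mulVec, transpose_zero, add_mulVec,
        Finset.univ_unique, Finset.sum_singleton, Pi.add_apply, mul_add, Finset.sum_add_distrib,
        smul_mulVec, Pi.smul_apply, smul_eq_mul, Pi.zero_apply, mul_zero, Function.comp_apply,
        one_mulVec] at h1 ⊢
      have h2 : ∑ i, v (Sum.inl i) * (2 * k₀ * v (Sum.inl i)) =
          2 * ∑ i, v (Sum.inl i) * (k₀ * v (Sum.inl i)) := by
        rw [Finset.mul_sum]
        exact Finset.sum_congr rfl fun _ _ => by ring
      rw [h2]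
      have h3 : 0 ≤ v (Sum.inr default) *
          ((Matrix.of fun _ _ => divβ x : Matrix (Fin 1) (Fin 1) ℝ) *ᵥ (v ∘ Sum.inr)) default := by
        simp only [mulVec, dotProduct, of_apply, Finset.univ_unique, Finset.sum_singleton,
          Function.comp_apply]
        have : 0 ≤ divβ x * (v (Sum.inr default) * v (Sum.inr default)) :=
          mul_nonneg (by linarith) (mul_self_nonneg _)
        linarith
      linarith
  · exact Filter.Eventually.of_forall fun x => ⟨by simp [system], by simp [system]⟩
  · intro k
    exact ⟨_, Filter.Eventually.of_forall fun x => system_B κ β k x⟩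
  · intro k
    exact Filter.Eventually.of_forall fun x => by simp [system]
  · filter_upwards [hinv] with x hx
    simpa [system] using hx

end ConvDiff

/-! ### Polynomials as functions on Euclidean space. -/

section PolyFun

variable {d : ℕ}

/-- The polynomial function on Euclidean space defined by a multivariate polynomial. -/
noncomputable def polyFun (q : MvPolynomial (Fin d) ℝ) (x : Eu d) : ℝ :=
  MvPolynomial.eval (fun l => x l) q

theorem polyFun_add (q r : MvPolynomial (Fin d) ℝ) (x : Eu d) :
    polyFun (q + r) x = polyFun q x + polyFun r x := map_add _ _ _

theorem polyFun_mul (q r : MvPolynomial (Fin d) ℝ) (x : Eu d) :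
    polyFun (q * r) x = polyFun q x * polyFun r x := map_mul _ _ _

theorem polyFun_X (k : Fin d) (x : Eu d) : polyFun (MvPolynomial.X k) x = x k :=
  MvPolynomial.eval_X _

theorem polyFun_one (x : Eu d) : polyFun 1 x = 1 := map_one _

theorem polyFun_zero (x : Eu d) : polyFun 0 x = 0 := map_zero _

theorem analyticOnNhd_polyFun (q : MvPolynomial (Fin d) ℝ) :
    AnalyticOnNhd ℝ (polyFun q) Set.univ := by
  have h : AnalyticOnNhd ℝ (fun x : Eu d => MvPolynomial.aeval (fun l => x l) q) Set.univ :=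
    AnalyticOnNhd.aeval_mvPolynomial
      (fun l x _ => (EuclideanSpace.proj l : Eu d →L[ℝ] ℝ).analyticAt x) q
  exact h

theorem contDiff_polyFun {n : WithTop ℕ∞} (q : MvPolynomial (Fin d) ℝ) :
    ContDiff ℝ n (polyFun q) := (analyticOnNhd_polyFun q).contDiff

theorem continuous_polyFun (q : MvPolynomial (Fin d) ℝ) : Continuous (polyFun q) :=
  (contDiff_polyFun (n := 1) q).continuous

theorem hasFDerivAt_polyFun (q : MvPolynomial (Fin d) ℝ) (x : Eu d) :
    HasFDerivAt (polyFun q)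
      (∑ k, polyFun (MvPolynomial.pderiv k q) x • (EuclideanSpace.proj k : Eu d →L[ℝ] ℝ)) x := by
  induction q using MvPolynomial.induction_on with
  | C c =>
    have h : polyFun (d := d) (MvPolynomial.C c) = fun _ => c :=
      funext fun x => MvPolynomial.eval_C c
    rw [h]
    simpa [polyFun_zero] using hasFDerivAt_const c x
  | add q r hq hr =>
    have h : polyFun (q + r) = polyFun q + polyFun r := funext fun x => polyFun_add q r x
    rw [h]
    refine (hq.add hr).congr_fderiv ?_
    rw [← Finset.sum_add_distrib]
    exact Finset.sum_congr rfl fun k _ => by rw [map_add, polyFun_add, add_smul]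
  | mul_X q i hq =>
    have h : polyFun (q * MvPolynomial.X i) = fun x => polyFun q x * x i :=
      funext fun x => by rw [polyFun_mul, polyFun_X]
    rw [h]
    refine (hq.mul ((EuclideanSpace.proj i : Eu d →L[ℝ] ℝ).hasFDerivAt (x := x))).congr_fderiv ?_
    ext v
    simp only [FunLike.coe_sum, Finset.sum_apply, _root_.smul_apply,
      _root_.add_apply, smul_eq_mul, PiLp.proj_apply, Derivation.leibniz,
      MvPolynomial.pderiv_X, polyFun_add, polyFun_mul, polyFun_X]
    simp only [add_mul, Finset.sum_add_distrib, Finset.mul_sum]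
    congr 1
    · rw [Finset.sum_eq_single i]
      · simp [polyFun_one]
      · intro k _ hk
        simp [hk.symm, polyFun_zero]
      · simp
    · exact Finset.sum_congr rfl fun k _ => by ring

theorem fderiv_polyFun (q : MvPolynomial (Fin d) ℝ) (x v : Eu d) :
    fderiv ℝ (polyFun q) x v = ∑ k, polyFun (MvPolynomial.pderiv k q) x * v k := by
  rw [(hasFDerivAt_polyFun q x).fderiv]
  simp

theorem exists_polyFun_ne_zero {q : MvPolynomial (Fin d) ℝ} (hq : q ≠ 0) :
    ∃ x, polyFun q x ≠ 0 := by
  by_contra! h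
  exact hq (MvPolynomial.funext fun y => (h (WithLp.toLp 2 y)).trans (map_zero _).symm)

/-- Makes the gradient of the discrete solution an admissible test function in the first local
equation. -/
theorem pderiv_mem_polySpace {p : ℕ} {q : MvPolynomial (Fin d) ℝ} (hq : q ∈ PolySpace d p)
    (k : Fin d) : MvPolynomial.pderiv k q ∈ PolySpace d p := by
  rw [MvPolynomial.mem_restrictTotalDegree] at hq ⊢
  refine (Finset.sup_le fun s hs => ?_)
  have h : (s + Finsupp.single k 1) ∈ q.support := by
    rw [MvPolynomial.mem_support_iff] at hs ⊢
    intro h0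
    apply hs
    rw [MvPolynomial.coeff_pderiv, h0, zero_mul]
  have h2 := (MvPolynomial.le_totalDegree h).trans hq
  rw [Finsupp.sum_add_index' (fun _ => rfl) (fun _ _ _ => rfl)] at h2
  exact (Nat.le_add_right _ _).trans h2

end PolyFun

/-! ### Integrability of products, linearity of integrals and square linear systems. -/

section MemLp

variable {α a c : Type*} [MeasurableSpace α] [Fintype c] {μ : Measure α} {p : ℝ≥0∞}

theorem MeasureTheory.MemLp.dotProduct {F G : α → c → ℝ} (hF : ∀ j, MemLp (fun x => F x j) p μ)
    (hG : ∀ j, MemLp (fun x => G x j) ⊤ μ) : MemLp (fun x => F x ⬝ᵥ G x) p μ :=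
  memLp_finsetSum _ fun j _ => (hG j).mul' (hF j)

theorem MeasureTheory.MemLp.mulVec {A : α → Matrix a c ℝ} {F : α → c → ℝ}
    (hA : ∀ i j, MemLp (fun x => A x i j) p μ) (hF : ∀ j, MemLp (fun x => F x j) ⊤ μ) (i : a) :
    MemLp (fun x => (A x *ᵥ F x) i) p μ :=
  MemLp.dotProduct (hA i) hF

theorem MeasureTheory.MemLp.integrable_top [IsFiniteMeasure μ] {f : α → ℝ} (hf : MemLp f ⊤ μ) :
    Integrable f μ := hf.integrable le_top

end MemLp

section IsLinearMap

variable {V W : Type*} [AddCommGroup V] [Module ℝ V] [AddCommGroup W] [Module ℝ W] {a c : Type*}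
  [Fintype c]

theorem LinearMap.isLinearMap (L : V →ₗ[ℝ] W) : IsLinearMap ℝ fun v => L v :=
  ⟨L.map_add, L.map_smul⟩

namespace IsLinearMap

theorem zero_fun : IsLinearMap ℝ fun _ : V => (0 : W) :=
  ⟨fun _ _ => (add_zero _).symm, fun _ _ => (smul_zero _).symm⟩

theorem add_fun {f g : V → W} (hf : IsLinearMap ℝ f) (hg : IsLinearMap ℝ g) :
    IsLinearMap ℝ fun v => f v + g v :=
  ((hf.mk' f) + (hg.mk' g)).isLinearMap

theorem sub_fun {f g : V → W} (hf : IsLinearMap ℝ f) (hg : IsLinearMap ℝ g) :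
    IsLinearMap ℝ fun v => f v - g v :=
  ((hf.mk' f) - (hg.mk' g)).isLinearMap

theorem neg_fun {f : V → W} (hf : IsLinearMap ℝ f) : IsLinearMap ℝ fun v => - f v :=
  (-(hf.mk' f)).isLinearMap

theorem sum_fun {β : Type*} (t : Finset β) {f : β → V → W} (hf : ∀ i ∈ t, IsLinearMap ℝ (f i)) :
    IsLinearMap ℝ fun v => ∑ i ∈ t, f i v :=
  ⟨fun x y => by
    rw [← Finset.sum_add_distrib]
    exact Finset.sum_congr rfl fun i hi => (hf i hi).map_add x y,
   fun r x => by
    rw [Finset.smul_sum]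
    exact Finset.sum_congr rfl fun i hi => (hf i hi).map_smul r x⟩

theorem ite_fun {P : Prop} [Decidable P] {f g : V → W} (hf : P → IsLinearMap ℝ f)
    (hg : ¬ P → IsLinearMap ℝ g) : IsLinearMap ℝ fun v => if P then f v else g v := by
  by_cases h : P
  · simpa only [if_pos h] using hf h
  · simpa only [if_neg h] using hg h

/-- The integral is additive only on integrable functions, so every term of the forms below needs
its own integrability lemma before its linearity can be read off. -/
theorem integral {α : Type*} [MeasurableSpace α] {μ : Measure α} {f : V → α → ℝ}
    (hf : ∀ x, IsLinearMap ℝ fun v => f v x) (hi : ∀ v, Integrable (f v) μ) :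
    IsLinearMap ℝ fun v => ∫ x, f v x ∂μ :=
  ⟨fun v w => by
    rw [← integral_add (hi v) (hi w)]
    exact integral_congr_ae (Filter.Eventually.of_forall fun x => (hf x).map_add v w),
   fun r v => by
    rw [smul_eq_mul, ← integral_const_mul]
    exact integral_congr_ae (Filter.Eventually.of_forall fun x => (hf x).map_smul r v)⟩

theorem mulVec {f : V → c → ℝ} (hf : IsLinearMap ℝ f) (A : Matrix a c ℝ) :
    IsLinearMap ℝ fun v => A *ᵥ f v :=
  (A.mulVecLin ∘ₗ hf.mk' f).isLinearMap

theorem dotProduct_left {f : V → c → ℝ} (hf : IsLinearMap ℝ f) (w : c → ℝ) :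
    IsLinearMap ℝ fun v => f v ⬝ᵥ w :=
  ⟨fun x y => by rw [hf.map_add, add_dotProduct],
    fun r x => by rw [hf.map_smul, smul_dotProduct]⟩

theorem dotProduct_right {f : V → c → ℝ} (hf : IsLinearMap ℝ f) (w : c → ℝ) :
    IsLinearMap ℝ fun v => w ⬝ᵥ f v :=
  ⟨fun x y => by rw [hf.map_add, dotProduct_add],
    fun r x => by rw [hf.map_smul, dotProduct_smul]⟩

end IsLinearMap

/-- A square linear system on a finite-dimensional space whose homogeneous version has only the
trivial solution is uniquely solvable. -/
theorem existsUnique_of_bilinear [FiniteDimensional ℝ V] {B : V → V → ℝ} {ℓ : V → ℝ}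
    (hl : ∀ t, IsLinearMap ℝ fun z => B z t) (hr : ∀ z, IsLinearMap ℝ (B z))
    (hℓ : IsLinearMap ℝ ℓ) (h0 : ∀ z, (∀ t, B z t = 0) → z = 0) :
    ∃! z, ∀ t, B z t = ℓ t := by
  let L : V →ₗ[ℝ] Module.Dual ℝ V :=
    { toFun := fun z => (hr z).mk' _
      map_add' := fun x y => LinearMap.ext fun t => (hl t).map_add x y
      map_smul' := fun r x => LinearMap.ext fun t => (hl t).map_smul r x }
  have hinj : Function.Injective L := by
    rw [← LinearMap.ker_eq_bot, LinearMap.ker_eq_bot']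
    exact fun z hz => h0 z fun t => LinearMap.congr_fun hz t
  have hsurj := (LinearMap.injective_iff_surjective_of_finrank_eq_finrank
    (Subspace.dual_finrank_eq (K := ℝ) (V := V)).symm).1 hinj
  obtain ⟨z, hz⟩ := hsurj (hℓ.mk' _)
  refine ⟨z, fun t => LinearMap.congr_fun hz t, fun y hy => hinj ?_⟩
  rw [hz]
  exact LinearMap.ext hy

end IsLinearMap

section Values

variable {d p : ℕ} {c : Type}

theorem isLinearMap_pval (x : Eu d) : IsLinearMap ℝ fun w : c → PolySpace d p => pval w x :=
  ⟨fun _ _ => funext fun _ => map_add _ _ _, fun r w => funext fun j =>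
    MvPolynomial.smul_eval (fun l => x l) (w j).1 r⟩

theorem isLinearMap_pderivVal (k : Fin d) (x : Eu d) :
    IsLinearMap ℝ fun w : c → PolySpace d p => pderivVal k w x :=
  ⟨fun v w => funext fun j => by
    simp only [pderivVal, Pi.add_apply, Submodule.coe_add, map_add],
   fun r w => funext fun j => by
    simp only [pderivVal, Pi.smul_apply, Submodule.coe_smul, Derivation.map_smul,
      MvPolynomial.smul_eval, smul_eq_mul]⟩

theorem memLp_pval {s : Set (Eu d)} (hs : IsCompact s) {μ : Measure (Eu d)}
    (w : c → PolySpace d p) (j : c) : MemLp (fun x => pval w x j) ⊤ (μ.restrict s) :=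
  (continuous_polyFun (w j).1).memLp_top_restrict hs

theorem memLp_pderivVal {s : Set (Eu d)} (hs : IsCompact s) {μ : Measure (Eu d)} (k : Fin d)
    (w : c → PolySpace d p) (j : c) : MemLp (fun x => pderivVal k w x j) ⊤ (μ.restrict s) :=
  (continuous_polyFun (MvPolynomial.pderiv k (w j).1)).memLp_top_restrict hs

theorem TracePoly.exists_polyFun {e : Set (Eu d)} (w : TracePoly d p e) :
    ∃ q : MvPolynomial (Fin d) ℝ, w.1 = e.indicator (polyFun q) := by
  obtain ⟨q, -, hq⟩ := w.2
  exact ⟨q, hq.symm⟩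

theorem memLp_tval {e : Set (Eu d)} (he : IsCompact e) {μ : Measure (Eu d)}
    (w : c → TracePoly d p e) (j : c) : MemLp (fun x => tval w x j) ⊤ (μ.restrict e) := by
  obtain ⟨q, hq⟩ := TracePoly.exists_polyFun (w j)
  refine MemLp.ae_eq ?_ ((continuous_polyFun q).memLp_top_restrict he)
  filter_upwards [ae_restrict_mem he.measurableSet] with x hx
  change _ = (w j).1 x
  rw [hq, Set.indicator_of_mem hx]

instance finiteDimensional_tracePoly (e : Set (Eu d)) :
    FiniteDimensional ℝ (TracePoly d p e) := by
  unfold TracePoly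
  infer_instance

end Values

/-! ### The forms of the method: integrability and linearity. -/

section HDG

variable {d : ℕ} [NeZero d] {Ω : Set (Eu d)} {ι : Type*} [Fintype ι]
  {a u : Type} [Fintype a] [Fintype u]

/-- All coefficients of the `hp`-HDG formulation are bounded. -/
structure HDGBounded (M : SimplexMesh d Ω ι) (S : TwoFieldSystem d a u)
    (An : ι → Fin (d + 1) → Eu d → Matrix (a ⊕ u) (a ⊕ u) ℝ)
    (T : ι → Fin (d + 1) → Eu d → Matrix u u ℝ) (ϱ : ι → Fin (d + 1) → Eu d → ℝ) : Prop where
  G : ∀ i j, MemLp (fun x => S.G x i j) ⊤ (volume.restrict Ω)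
  A : ∀ k i j, MemLp (fun x => S.A k x i j) ⊤ (volume.restrict Ω)
  An : ∀ e ∈ M.skeleton, ∀ s ∈ M.sides e, ∀ i j,
    MemLp (fun x => An s.1 s.2 x i j) ⊤ ((SimplexMesh.surf d).restrict e)
  T : ∀ e ∈ M.skeleton, ∀ s ∈ M.sides e, ∀ i j,
    MemLp (fun x => T s.1 s.2 x i j) ⊤ ((SimplexMesh.surf d).restrict e)
  ϱ : ∀ e ∈ M.skeleton, ∀ s ∈ M.sides e,
    MemLp (ϱ s.1 s.2) ⊤ ((SimplexMesh.surf d).restrict e)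

variable (M : SimplexMesh d Ω ι) (p : ι → ℕ) (S : TwoFieldSystem d a u)
  (An : ι → Fin (d + 1) → Eu d → Matrix (a ⊕ u) (a ⊕ u) ℝ)
  (T : ι → Fin (d + 1) → Eu d → Matrix u u ℝ) (ϱ : ι → Fin (d + 1) → Eu d → ℝ)
  (Dir : Set (Set (Eu d)))

/-- The form of the first local equation. -/
noncomputable def auxForm (K : ι)
    (z : (a → PolySpace d (p K)) × (u → PolySpace d (p K)) × TraceSpace M p u)
    (s : a → PolySpace d (p K)) : ℝ :=
  - (∑ k, ∫ x in M.elem K, (S.B k x *ᵥ pval z.2.1 x) ⬝ᵥ pderivVal k s x)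
    + (∫ x in M.elem K, ((S.G x).toBlocks₁₁ *ᵥ pval z.1 x + (S.G x).toBlocks₁₂ *ᵥ pval z.2.1 x)
        ⬝ᵥ pval s x)
    + (∑ i, ∑ e ∈ M.mortarsOn K i, ∫ x in e.1,
        ((An K i x).toBlocks₁₂ *ᵥ tval (z.2.2 e) x) ⬝ᵥ pval s x ∂(SimplexMesh.surf d))

/-- The form of the second local equation. -/
noncomputable def solForm (K : ι)
    (z : (a → PolySpace d (p K)) × (u → PolySpace d (p K)) × TraceSpace M p u)
    (v : u → PolySpace d (p K)) : ℝ :=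
  - (∑ k, ∫ x in M.elem K,
        ((S.B k x)ᵀ *ᵥ pval z.1 x + S.C k x *ᵥ pval z.2.1 x) ⬝ᵥ pderivVal k v x)
    + (∫ x in M.elem K, ((S.G x).toBlocks₂₁ *ᵥ pval z.1 x + (S.G x).toBlocks₂₂ *ᵥ pval z.2.1 x)
        ⬝ᵥ pval v x)
    + (∑ i, ∑ e ∈ M.mortarsOn K i, ∫ x in e.1,
        hdgFlux (An K i x) (T K i x) (pval z.1 x) (pval z.2.1 x) (tval (z.2.2 e) x)
          ⬝ᵥ pval v x ∂(SimplexMesh.surf d))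

theorem solvesLocal_iff {fσ : Eu d → a → ℝ} {fw : Eu d → u → ℝ} {wh : TraceSpace M p u} {K : ι}
    {σ : a → PolySpace d (p K)} {w : u → PolySpace d (p K)} :
    SolvesLocal M p S An T fσ fw wh K σ w ↔
      (∀ s, auxForm M p S An K (σ, w, wh) s = ∫ x in M.elem K, fσ x ⬝ᵥ pval s x) ∧
      (∀ v, solForm M p S An T K (σ, w, wh) v = ∫ x in M.elem K, fw x ⬝ᵥ pval v x) := Iff.rfl

open Classical in
/-- The form of the conservation and Neumann/Robin conditions. -/
noncomputable def mortarForm [DecidableEq u]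
    (z : ((K : ι) → a → PolySpace d (p K)) × ((K : ι) → u → PolySpace d (p K)) × TraceSpace M p u)
    (vh : TraceSpace M p u) : ℝ :=
  (∑ e : {e // e ∈ M.skeleton}, if e.1 ∈ Dir then 0 else
      ∫ x in e.1, M.jump (fun K i y =>
        hdgFlux (An K i y) (T K i y) (pval (z.1 K) y) (pval (z.2.1 K) y) (tval (z.2.2 e) y)) e.1 x
          ⬝ᵥ tval (vh e) x ∂(SimplexMesh.surf d))
  - ∑ e : {e // e ∈ M.skeleton}, if e.1 ∈ M.boundaryMortars ∧ e.1 ∉ Dir then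
        (∑ s ∈ M.sides e.1, ∫ x in e.1,
          ((ϱ s.1 s.2 x • (1 : Matrix u u ℝ) + (An s.1 s.2 x).toBlocks₂₂) *ᵥ tval (z.2.2 e) x)
            ⬝ᵥ tval (vh e) x ∂(SimplexMesh.surf d))
      else 0

open Classical in
/-- The form of the Dirichlet condition. -/
noncomputable def dirichletForm (wh vh : TraceSpace M p u) : ℝ :=
  ∑ e : {e // e ∈ M.skeleton}, if e.1 ∈ M.boundaryMortars ∧ e.1 ∈ Dir then
      ∫ x in e.1, tval (wh e) x ⬝ᵥ tval (vh e) x ∂(SimplexMesh.surf d) else 0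

open Classical in
/-- The functional `∑ ⟨g, v̂⟩` over the boundary mortars with the property `P`. -/
noncomputable def boundaryFunctional (P : Set (Set (Eu d))) (g : Eu d → u → ℝ)
    (vh : TraceSpace M p u) : ℝ :=
  ∑ e : {e // e ∈ M.skeleton}, if e.1 ∈ M.boundaryMortars ∧ e.1 ∈ P then
      ∫ x in e.1, g x ⬝ᵥ tval (vh e) x ∂(SimplexMesh.surf d) else 0

/-- The Robin term containing `ŵ` is moved to the left, so that only data remain on the right and
all three equations have the shape "form equals functional". -/
theorem solvesHDG_iff [DecidableEq u] {fσ : Eu d → a → ℝ} {fw g : Eu d → u → ℝ}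
    {σ : (K : ι) → a → PolySpace d (p K)} {w : (K : ι) → u → PolySpace d (p K)}
    {wh : TraceSpace M p u} :
    SolvesHDG M p S An T ϱ Dir fσ fw g σ w wh ↔
      (∀ K, SolvesLocal M p S An T fσ fw wh K (σ K) (w K)) ∧
      (∀ vh, mortarForm M p An T ϱ Dir (σ, w, wh) vh = boundaryFunctional M p Dirᶜ g vh) ∧
      (∀ vh, dirichletForm M p Dir wh vh = boundaryFunctional M p Dir g vh) := by
  unfold SolvesHDG
  refine and_congr_right fun _ => and_congr (forall_congr' fun vh => ?_) Iff.rfl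
  rw [mortarForm, sub_eq_iff_eq_add', boundaryFunctional, ← Finset.sum_add_distrib]
  refine Eq.congr rfl (Finset.sum_congr rfl fun e _ => ?_)
  by_cases h : e.1 ∈ M.boundaryMortars ∧ e.1 ∉ Dir
  · have h' : e.1 ∈ M.boundaryMortars ∧ e.1 ∈ Dirᶜ := h
    rw [if_pos h, if_pos h, if_pos h']
  · have h' : ¬ (e.1 ∈ M.boundaryMortars ∧ e.1 ∈ Dirᶜ) := h
    rw [if_neg h, if_neg h, if_neg h', add_zero]

variable {M S An T ϱ}

theorem SimplexMesh.mem_sides_of_mem_mortarsOn {K : ι} {i : Fin (d + 1)}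
    {e : {e // e ∈ M.skeleton}} (he : e ∈ M.mortarsOn K i) : (K, i) ∈ M.sides e.1 :=
  M.mem_sides.2 (M.mem_mortarsOn.1 he)

omit [NeZero d] [Fintype ι] in
theorem isFiniteMeasure_volume_restrict_elem (K : ι) :
    IsFiniteMeasure (volume.restrict (M.elem K)) :=
  isFiniteMeasure_restrict.2 (M.isCompact_elem K).measure_lt_top.ne

omit [Fintype ι] in
theorem memLp_elem (hΩreg : interior (closure Ω) = Ω) {q : ℝ≥0∞} {f : Eu d → ℝ}
    (hf : MemLp f q (volume.restrict Ω)) (K : ι) : MemLp f q (volume.restrict (M.elem K)) :=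
  hf.mono_measure (M.restrict_elem_le hΩreg K)

theorem memLp_add_apply {α c : Type*} [MeasurableSpace α] {μ : Measure α} {q : ℝ≥0∞}
    {F G : α → c → ℝ} (hF : ∀ j, MemLp (fun x => F x j) q μ)
    (hG : ∀ j, MemLp (fun x => G x j) q μ) (j : c) : MemLp (fun x => (F x + G x) j) q μ :=
  (hF j).add (hG j)

omit [NeZero d] in
theorem memLp_hdgFlux {μ : Measure (Eu d)} {An : Eu d → Matrix (a ⊕ u) (a ⊕ u) ℝ}
    {T : Eu d → Matrix u u ℝ} (hAn : ∀ i j, MemLp (fun x => An x i j) ⊤ μ)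
    (hT : ∀ i j, MemLp (fun x => T x i j) ⊤ μ) {σ : Eu d → a → ℝ} {w wh : Eu d → u → ℝ}
    (hσ : ∀ j, MemLp (fun x => σ x j) ⊤ μ) (hw : ∀ j, MemLp (fun x => w x j) ⊤ μ)
    (hwh : ∀ j, MemLp (fun x => wh x j) ⊤ μ) (j : u) :
    MemLp (fun x => hdgFlux (An x) (T x) (σ x) (w x) (wh x) j) ⊤ μ :=
  memLp_add_apply (memLp_add_apply (MemLp.mulVec (fun _ _ => hAn _ _) hσ)
    (MemLp.mulVec (fun _ _ => hAn _ _) hw))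
    (MemLp.mulVec hT fun j => (hw j).sub (hwh j)) j

variable (hΩreg : interior (closure Ω) = Ω) (hB : HDGBounded M S An T ϱ)

include hΩreg hB

theorem integrable_auxForm_stiff (K : ι) (k : Fin d) (w : u → PolySpace d (p K))
    (s : a → PolySpace d (p K)) :
    Integrable (fun x => (S.B k x *ᵥ pval w x) ⬝ᵥ pderivVal k s x)
      (volume.restrict (M.elem K)) := by
  have := isFiniteMeasure_volume_restrict_elem (M := M) K
  exact (MemLp.dotProduct
    (MemLp.mulVec (fun i j => memLp_elem hΩreg (hB.A k _ _) K) (memLp_pval (M.isCompact_elem K) w))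
    (memLp_pderivVal (M.isCompact_elem K) k s)).integrable_top

theorem integrable_auxForm_mass (K : ι) (σ : a → PolySpace d (p K)) (w : u → PolySpace d (p K))
    (s : a → PolySpace d (p K)) :
    Integrable (fun x => ((S.G x).toBlocks₁₁ *ᵥ pval σ x + (S.G x).toBlocks₁₂ *ᵥ pval w x)
        ⬝ᵥ pval s x) (volume.restrict (M.elem K)) := by
  have := isFiniteMeasure_volume_restrict_elem (M := M) K
  have hp := M.isCompact_elem K
  exact (MemLp.dotProduct (memLp_add_apply
    (MemLp.mulVec (fun i j => memLp_elem hΩreg (hB.G _ _) K) (memLp_pval hp σ))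
    (MemLp.mulVec (fun i j => memLp_elem hΩreg (hB.G _ _) K) (memLp_pval hp w)))
    (memLp_pval hp s)).integrable_top

theorem integrable_solForm_stiff (K : ι) (k : Fin d) (σ : a → PolySpace d (p K))
    (w : u → PolySpace d (p K)) (v : u → PolySpace d (p K)) :
    Integrable (fun x => ((S.B k x)ᵀ *ᵥ pval σ x + S.C k x *ᵥ pval w x) ⬝ᵥ pderivVal k v x)
      (volume.restrict (M.elem K)) := by
  have := isFiniteMeasure_volume_restrict_elem (M := M) K
  have hp := M.isCompact_elem K
  exact (MemLp.dotProduct (memLp_add_apply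
    (MemLp.mulVec (fun i j => memLp_elem hΩreg (hB.A k _ _) K) (memLp_pval hp σ))
    (MemLp.mulVec (fun i j => memLp_elem hΩreg (hB.A k _ _) K) (memLp_pval hp w)))
    (memLp_pderivVal hp k v)).integrable_top

theorem integrable_solForm_mass (K : ι) (σ : a → PolySpace d (p K)) (w : u → PolySpace d (p K))
    (v : u → PolySpace d (p K)) :
    Integrable (fun x => ((S.G x).toBlocks₂₁ *ᵥ pval σ x + (S.G x).toBlocks₂₂ *ᵥ pval w x)
        ⬝ᵥ pval v x) (volume.restrict (M.elem K)) := by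
  have := isFiniteMeasure_volume_restrict_elem (M := M) K
  have hp := M.isCompact_elem K
  exact (MemLp.dotProduct (memLp_add_apply
    (MemLp.mulVec (fun i j => memLp_elem hΩreg (hB.G _ _) K) (memLp_pval hp σ))
    (MemLp.mulVec (fun i j => memLp_elem hΩreg (hB.G _ _) K) (memLp_pval hp w)))
    (memLp_pval hp v)).integrable_top

omit hΩreg

theorem integrable_auxForm_mortar {K : ι} {i : Fin (d + 1)} {e : {e // e ∈ M.skeleton}}
    (he : e ∈ M.mortarsOn K i) (wh : TraceSpace M p u) (s : a → PolySpace d (p K)) :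
    Integrable (fun x => ((An K i x).toBlocks₁₂ *ᵥ tval (wh e) x) ⬝ᵥ pval s x)
      ((SimplexMesh.surf d).restrict e.1) := by
  have := M.isFiniteMeasure_surf_restrict e.2
  have hc := M.isCompact_of_mem_skeleton e.2
  exact (MemLp.dotProduct (MemLp.mulVec
    (fun _ _ => hB.An e.1 e.2 _ (SimplexMesh.mem_sides_of_mem_mortarsOn he) _ _)
    (memLp_tval hc (wh e))) (memLp_pval hc s)).integrable_top

theorem integrable_solForm_mortar {K : ι} {i : Fin (d + 1)} {e : {e // e ∈ M.skeleton}}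
    (he : e ∈ M.mortarsOn K i) (σ : a → PolySpace d (p K)) (w : u → PolySpace d (p K))
    (wh : TraceSpace M p u) (v : u → PolySpace d (p K)) :
    Integrable (fun x => hdgFlux (An K i x) (T K i x) (pval σ x) (pval w x) (tval (wh e) x)
      ⬝ᵥ pval v x) ((SimplexMesh.surf d).restrict e.1) := by
  have := M.isFiniteMeasure_surf_restrict e.2
  have hc := M.isCompact_of_mem_skeleton e.2
  have hs := SimplexMesh.mem_sides_of_mem_mortarsOn he
  exact (MemLp.dotProduct (memLp_hdgFlux (hB.An e.1 e.2 _ hs) (hB.T e.1 e.2 _ hs)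
    (memLp_pval hc σ) (memLp_pval hc w) (memLp_tval hc (wh e))) (memLp_pval hc v)).integrable_top

theorem integrable_mortarForm_flux (e : {e // e ∈ M.skeleton})
    (σ : (K : ι) → a → PolySpace d (p K)) (w : (K : ι) → u → PolySpace d (p K))
    (wh vh : TraceSpace M p u) :
    Integrable (fun x => M.jump (fun K i y =>
        hdgFlux (An K i y) (T K i y) (pval (σ K) y) (pval (w K) y) (tval (wh e) y)) e.1 x
          ⬝ᵥ tval (vh e) x) ((SimplexMesh.surf d).restrict e.1) := by
  have := M.isFiniteMeasure_surf_restrict e.2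
  have hc := M.isCompact_of_mem_skeleton e.2
  refine (MemLp.dotProduct (fun j => ?_) (memLp_tval hc (vh e))).integrable_top
  simp only [SimplexMesh.jump, Finset.sum_apply]
  exact memLp_finsetSum _ fun s hs => memLp_hdgFlux (hB.An e.1 e.2 _ hs) (hB.T e.1 e.2 _ hs)
    (memLp_pval hc _) (memLp_pval hc _) (memLp_tval hc (wh e)) j

omit [Fintype a] in
theorem integrable_mortarForm_robin [DecidableEq u] (e : {e // e ∈ M.skeleton}) {s : ι × Fin (d + 1)}
    (hs : s ∈ M.sides e.1) (wh vh : TraceSpace M p u) :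
    Integrable (fun x =>
      ((ϱ s.1 s.2 x • (1 : Matrix u u ℝ) + (An s.1 s.2 x).toBlocks₂₂) *ᵥ tval (wh e) x)
            ⬝ᵥ tval (vh e) x) ((SimplexMesh.surf d).restrict e.1) := by
  have := M.isFiniteMeasure_surf_restrict e.2
  have hc := M.isCompact_of_mem_skeleton e.2
  refine (MemLp.dotProduct (MemLp.mulVec (fun i j => ?_) (memLp_tval hc (wh e)))
    (memLp_tval hc (vh e))).integrable_top
  exact ((hB.ϱ e.1 e.2 s hs).mul_const _).add (hB.An e.1 e.2 s hs _ _)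

omit hB

theorem integrable_dirichletForm (e : {e // e ∈ M.skeleton}) (wh vh : TraceSpace M p u) :
    Integrable (fun x => tval (wh e) x ⬝ᵥ tval (vh e) x)
      ((SimplexMesh.surf d).restrict e.1) := by
  have := M.isFiniteMeasure_surf_restrict e.2
  have hc := M.isCompact_of_mem_skeleton e.2
  exact (MemLp.dotProduct (memLp_tval hc (wh e)) (memLp_tval hc (vh e))).integrable_top

theorem isLinearMap_hdgFlux {V : Type*} [AddCommGroup V] [Module ℝ V]
    (An : Matrix (a ⊕ u) (a ⊕ u) ℝ) (T : Matrix u u ℝ) {σ : V → a → ℝ} {w wh : V → u → ℝ}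
    (hσ : IsLinearMap ℝ σ) (hw : IsLinearMap ℝ w) (hwh : IsLinearMap ℝ wh) :
    IsLinearMap ℝ fun z => hdgFlux An T (σ z) (w z) (wh z) :=
  ((hσ.mulVec _).add_fun (hw.mulVec _)).add_fun ((hw.sub_fun hwh).mulVec _)

include hB

section Local

variable {p}

omit hB [Fintype a] [Fintype u] in
theorem isLinearMap_localVal (K : ι) (x : Eu d) :
    (IsLinearMap ℝ fun z : (a → PolySpace d (p K)) × (u → PolySpace d (p K)) × TraceSpace M p u =>
      pval z.1 x) ∧
    (IsLinearMap ℝ fun z : (a → PolySpace d (p K)) × (u → PolySpace d (p K)) × TraceSpace M p u =>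
      pval z.2.1 x) ∧
    ∀ e, IsLinearMap ℝ
      fun z : (a → PolySpace d (p K)) × (u → PolySpace d (p K)) × TraceSpace M p u =>
        tval (z.2.2 e) x :=
  ⟨⟨fun y z => (isLinearMap_pval x).map_add y.1 z.1,
      fun r z => (isLinearMap_pval x).map_smul r z.1⟩,
    ⟨fun y z => (isLinearMap_pval x).map_add y.2.1 z.2.1,
      fun r z => (isLinearMap_pval x).map_smul r z.2.1⟩,
    fun _ => ⟨fun _ _ => rfl, fun _ _ => rfl⟩⟩

include hΩreg

/-- Linearity holds jointly in `(σ, w, ŵ)`. The same form then serves the local problem, where `ŵ`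
is data, and the global problem, where it is unknown. -/
theorem isLinearMap_auxForm_left (K : ι) (s : a → PolySpace d (p K)) :
    IsLinearMap ℝ fun z => auxForm M p S An K z s := by
  refine .add_fun (.add_fun (.neg_fun (.sum_fun _ fun k _ => .integral (fun x => ?_) fun z =>
    integrable_auxForm_stiff _ hΩreg hB K k z.2.1 s)) (.integral (fun x => ?_) fun z =>
    integrable_auxForm_mass _ hΩreg hB K z.1 z.2.1 s)) (.sum_fun _ fun i _ =>
    .sum_fun _ fun e he => .integral (fun x => ?_) fun z =>
    integrable_auxForm_mortar _ hB he z.2.2 s) <;>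
  obtain ⟨h1, h2, h3⟩ := isLinearMap_localVal (a := a) (u := u) (M := M) (p := p) K x
  · exact (h2.mulVec _).dotProduct_left _
  · exact ((h1.mulVec _).add_fun (h2.mulVec _)).dotProduct_left _
  · exact ((h3 e).mulVec _).dotProduct_left _

theorem isLinearMap_auxForm_right (K : ι)
    (z : (a → PolySpace d (p K)) × (u → PolySpace d (p K)) × TraceSpace M p u) :
    IsLinearMap ℝ (auxForm M p S An K z) :=
  .add_fun (.add_fun (.neg_fun (.sum_fun _ fun k _ => .integral
    (fun x => (isLinearMap_pderivVal k x).dotProduct_right _) fun s =>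
    integrable_auxForm_stiff _ hΩreg hB K k z.2.1 s)) (.integral
    (fun x => (isLinearMap_pval x).dotProduct_right _) fun s =>
    integrable_auxForm_mass _ hΩreg hB K z.1 z.2.1 s)) (.sum_fun _ fun _ _ =>
    .sum_fun _ fun _ he => .integral (fun x => (isLinearMap_pval x).dotProduct_right _) fun s =>
    integrable_auxForm_mortar _ hB he z.2.2 s)

theorem isLinearMap_solForm_left (K : ι) (v : u → PolySpace d (p K)) :
    IsLinearMap ℝ fun z => solForm M p S An T K z v := by
  refine .add_fun (.add_fun (.neg_fun (.sum_fun _ fun k _ => .integral (fun x => ?_) fun z =>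
    integrable_solForm_stiff _ hΩreg hB K k z.1 z.2.1 v)) (.integral (fun x => ?_) fun z =>
    integrable_solForm_mass _ hΩreg hB K z.1 z.2.1 v)) (.sum_fun _ fun i _ =>
    .sum_fun _ fun e he => .integral (fun x => ?_) fun z =>
    integrable_solForm_mortar _ hB he z.1 z.2.1 z.2.2 v) <;>
  obtain ⟨h1, h2, h3⟩ := isLinearMap_localVal (a := a) (u := u) (M := M) (p := p) K x
  · exact ((h1.mulVec _).add_fun (h2.mulVec _)).dotProduct_left _
  · exact ((h1.mulVec _).add_fun (h2.mulVec _)).dotProduct_left _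
  · exact (isLinearMap_hdgFlux _ _ h1 h2 (h3 e)).dotProduct_left _

theorem isLinearMap_solForm_right (K : ι)
    (z : (a → PolySpace d (p K)) × (u → PolySpace d (p K)) × TraceSpace M p u) :
    IsLinearMap ℝ (solForm M p S An T K z) :=
  .add_fun (.add_fun (.neg_fun (.sum_fun _ fun k _ => .integral
    (fun x => (isLinearMap_pderivVal k x).dotProduct_right _) fun v =>
    integrable_solForm_stiff _ hΩreg hB K k z.1 z.2.1 v)) (.integral
    (fun x => (isLinearMap_pval x).dotProduct_right _) fun v =>
    integrable_solForm_mass _ hΩreg hB K z.1 z.2.1 v)) (.sum_fun _ fun _ _ =>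
    .sum_fun _ fun _ he => .integral (fun x => (isLinearMap_pval x).dotProduct_right _) fun v =>
    integrable_solForm_mortar _ hB he z.1 z.2.1 z.2.2 v)

end Local

open Classical in
theorem isLinearMap_mortarForm_left [DecidableEq u] (vh : TraceSpace M p u) :
    IsLinearMap ℝ fun z => mortarForm M p An T ϱ Dir z vh := by
  refine .sub_fun (.sum_fun _ fun e _ => .ite_fun (fun _ => .zero_fun) fun _ =>
    .integral (fun x => .dotProduct_left ?_ _) fun z =>
      integrable_mortarForm_flux _ hB e z.1 z.2.1 z.2.2 vh)
    (.sum_fun _ fun e _ => .ite_fun (fun _ => .sum_fun _ fun s hs => .integral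
      (fun x => .dotProduct_left (.mulVec ?_ _) _) fun z =>
        integrable_mortarForm_robin _ hB e hs z.2.2 vh) fun _ => .zero_fun)
  · refine .sum_fun _ fun s _ => isLinearMap_hdgFlux _ _ ?_ ?_ ?_
    · exact ⟨fun y z => (isLinearMap_pval x).map_add (y.1 s.1) (z.1 s.1),
        fun r z => (isLinearMap_pval x).map_smul r (z.1 s.1)⟩
    · exact ⟨fun y z => (isLinearMap_pval x).map_add (y.2.1 s.1) (z.2.1 s.1),
        fun r z => (isLinearMap_pval x).map_smul r (z.2.1 s.1)⟩
    · exact ⟨fun _ _ => rfl, fun _ _ => rfl⟩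
  · exact ⟨fun _ _ => rfl, fun _ _ => rfl⟩

omit hB [Fintype u] in
theorem isLinearMap_tval_apply (e : {e // e ∈ M.skeleton}) (x : Eu d) :
    IsLinearMap ℝ fun vh : TraceSpace M p u => tval (vh e) x :=
  ⟨fun _ _ => rfl, fun _ _ => rfl⟩

open Classical in
theorem isLinearMap_mortarForm_right [DecidableEq u]
    (z : ((K : ι) → a → PolySpace d (p K)) × ((K : ι) → u → PolySpace d (p K)) × TraceSpace M p u) :
    IsLinearMap ℝ (mortarForm M p An T ϱ Dir z) :=
  .sub_fun (.sum_fun _ fun e _ => .ite_fun (fun _ => .zero_fun) fun _ =>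
    .integral (fun x => .dotProduct_right (isLinearMap_tval_apply p e x) _) fun vh =>
      integrable_mortarForm_flux _ hB e z.1 z.2.1 z.2.2 vh)
    (.sum_fun _ fun e _ => .ite_fun (fun _ => .sum_fun _ fun _ hs => .integral
      (fun x => .dotProduct_right (isLinearMap_tval_apply p e x) _) fun vh =>
        integrable_mortarForm_robin _ hB e hs z.2.2 vh) fun _ => .zero_fun)

omit hB

open Classical in
theorem isLinearMap_dirichletForm_left (vh : TraceSpace M p u) :
    IsLinearMap ℝ fun wh => dirichletForm M p Dir wh vh :=
  .sum_fun _ fun e _ => .ite_fun (fun _ => .integral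
    (fun x => .dotProduct_left (isLinearMap_tval_apply p e x) _) fun wh =>
      integrable_dirichletForm p e wh vh) fun _ => .zero_fun

open Classical in
theorem isLinearMap_dirichletForm_right (wh : TraceSpace M p u) :
    IsLinearMap ℝ (dirichletForm M p Dir wh) :=
  .sum_fun _ fun e _ => .ite_fun (fun _ => .integral
    (fun x => .dotProduct_right (isLinearMap_tval_apply p e x) _) fun vh =>
      integrable_dirichletForm p e wh vh) fun _ => .zero_fun

open Classical in
theorem isLinearMap_boundaryFunctional (P : Set (Set (Eu d))) {g : Eu d → u → ℝ}
    (hg : ∀ j, MemLp (fun x => g x j) 2 ((SimplexMesh.surf d).restrict (frontier Ω))) :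
    IsLinearMap ℝ (boundaryFunctional M p P g) := by
  refine .sum_fun _ fun e _ => .ite_fun (fun he => .integral
    (fun x => .dotProduct_right (isLinearMap_tval_apply p e x) _) fun vh => ?_)
      fun _ => .zero_fun
  have := M.isFiniteMeasure_surf_restrict e.2
  have hsub : e.1 ⊆ frontier Ω := by
    obtain ⟨q, -, hq⟩ := M.mem_boundaryMortars.1 he.1
    rw [hq]
    exact Set.inter_subset_right
  exact (MemLp.dotProduct (fun j => (hg j).mono_measure (Measure.restrict_mono hsub le_rfl))
    (memLp_tval (M.isCompact_of_mem_skeleton e.2) (vh e))).integrable one_le_two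

omit [Fintype ι] in
theorem isLinearMap_load (hΩreg : interior (closure Ω) = Ω) {c : Type} [Fintype c] (K : ι)
    {f : Eu d → c → ℝ} (hf : ∀ j, MemLp (fun x => f x j) 2 (volume.restrict Ω)) :
    IsLinearMap ℝ fun s : c → PolySpace d (p K) => ∫ x in M.elem K, f x ⬝ᵥ pval s x := by
  have := isFiniteMeasure_volume_restrict_elem (M := M) K
  exact .integral (fun x => .dotProduct_right (isLinearMap_pval x) _) fun s =>
    (MemLp.dotProduct (fun j => memLp_elem hΩreg (hf j) K)
      (memLp_pval (M.isCompact_elem K) s)).integrable one_le_two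

end HDG

/-! ### Reduction of well-posedness to uniqueness for zero data. -/

section WellPosed

variable {d : ℕ} [NeZero d] {Ω : Set (Eu d)} {ι : Type*} [Fintype ι]
  {a u : Type} [Fintype a] [Fintype u]
  {M : SimplexMesh d Ω ι} {p : ι → ℕ} {S : TwoFieldSystem d a u}
  {An : ι → Fin (d + 1) → Eu d → Matrix (a ⊕ u) (a ⊕ u) ℝ}
  {T : ι → Fin (d + 1) → Eu d → Matrix u u ℝ} {ϱ : ι → Fin (d + 1) → Eu d → ℝ}
  {Dir : Set (Set (Eu d))}

/-- By linearity the contribution of the trace goes to the right-hand side. The sum of the two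
equations is a square system for `(σ, w)`, and test pairs `(s, 0)` and `(0, v)` separate the
equations again. -/
theorem locallyWellPosed_of_unique (hΩreg : interior (closure Ω) = Ω)
    (hB : HDGBounded M S An T ϱ)
    (h0 : ∀ K σ w, SolvesLocal M p S An T 0 0 0 K σ w → σ = 0 ∧ w = 0) :
    LocallyWellPosed M p S An T := by
  intro fσ fw hfσ hfw wh K
  have hzero : ∀ z : (a → PolySpace d (p K)) × (u → PolySpace d (p K)),
      ((z.1, z.2, wh) : _ × _ × TraceSpace M p u) = (z.1, z.2, 0) + (0, 0, wh) := fun z => by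
    ext <;> simp
  have hal := isLinearMap_auxForm_left (p := p) hΩreg hB K
  have har := isLinearMap_auxForm_right (p := p) hΩreg hB K
  have hsl := isLinearMap_solForm_left (p := p) hΩreg hB K
  have hsr := isLinearMap_solForm_right (p := p) hΩreg hB K
  have hfa := isLinearMap_load (M := M) p hΩreg K hfσ
  have hfs := isLinearMap_load (M := M) p hΩreg K hfw
  have key := existsUnique_of_bilinear
    (B := fun z t : (a → PolySpace d (p K)) × (u → PolySpace d (p K)) =>
      auxForm M p S An K (z.1, z.2, 0) t.1 + solForm M p S An T K (z.1, z.2, 0) t.2)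
    (ℓ := fun t => ((∫ x in M.elem K, fσ x ⬝ᵥ pval t.1 x) - auxForm M p S An K (0, 0, wh) t.1)
      + ((∫ x in M.elem K, fw x ⬝ᵥ pval t.2 x) - solForm M p S An T K (0, 0, wh) t.2))
    (fun t => by
      have e : ∀ y z : (a → PolySpace d (p K)) × (u → PolySpace d (p K)),
          ((y.1 + z.1, y.2 + z.2, 0) : _ × _ × TraceSpace M p u) =
            (y.1, y.2, 0) + (z.1, z.2, 0) := fun y z => by simp
      have e' : ∀ (r : ℝ) (z : (a → PolySpace d (p K)) × (u → PolySpace d (p K))),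
          ((r • z.1, r • z.2, 0) : _ × _ × TraceSpace M p u) = r • (z.1, z.2, 0) :=
        fun r z => by simp
      refine .add_fun ⟨fun y z => ?_, fun r z => ?_⟩ ⟨fun y z => ?_, fun r z => ?_⟩
      · exact (congrArg (fun q => auxForm M p S An K q t.1) (e y z)).trans ((hal t.1).map_add _ _)
      · exact (congrArg (fun q => auxForm M p S An K q t.1) (e' r z)).trans
          ((hal t.1).map_smul _ _)
      · exact (congrArg (fun q => solForm M p S An T K q t.2) (e y z)).trans
          ((hsl t.2).map_add _ _)
      · exact (congrArg (fun q => solForm M p S An T K q t.2) (e' r z)).trans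
          ((hsl t.2).map_smul _ _))
    (fun z => by
      refine .add_fun ?_ ?_
      · exact ⟨fun s t => (har _).map_add s.1 t.1, fun r t => (har _).map_smul r t.1⟩
      · exact ⟨fun s t => (hsr _).map_add s.2 t.2, fun r t => (hsr _).map_smul r t.2⟩)
    (by
      refine .add_fun (.sub_fun ?_ ?_) (.sub_fun ?_ ?_)
      · exact ⟨fun s t => hfa.map_add s.1 t.1, fun r t => hfa.map_smul r t.1⟩
      · exact ⟨fun s t => (har _).map_add s.1 t.1, fun r t => (har _).map_smul r t.1⟩
      · exact ⟨fun s t => hfs.map_add s.2 t.2, fun r t => hfs.map_smul r t.2⟩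
      · exact ⟨fun s t => (hsr _).map_add s.2 t.2, fun r t => (hsr _).map_smul r t.2⟩)
    (fun z hz => by
      have h := h0 K z.1 z.2 ((solvesLocal_iff M p S An T).2 ⟨fun s => ?_, fun v => ?_⟩)
      · exact Prod.ext h.1 h.2
      · have := hz (s, 0)
        simp only [(hsr _).map_zero, add_zero] at this
        simpa using this
      · have := hz (0, v)
        simp only [(har _).map_zero, zero_add] at this
        simpa using this)
  refine (existsUnique_congr fun z => ?_).1 key
  rw [solvesLocal_iff]
  have e1 : ∀ s, auxForm M p S An K (z.1, z.2, wh) s =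
      auxForm M p S An K (z.1, z.2, 0) s + auxForm M p S An K (0, 0, wh) s := fun s => by
    rw [hzero z]; exact (hal s).map_add _ _
  have e2 : ∀ v, solForm M p S An T K (z.1, z.2, wh) v =
      solForm M p S An T K (z.1, z.2, 0) v + solForm M p S An T K (0, 0, wh) v := fun v => by
    rw [hzero z]; exact (hsl v).map_add _ _
  constructor
  · intro h
    refine ⟨fun s => ?_, fun v => ?_⟩
    · have := h (s, 0)
      simp only [(hsr _).map_zero, hfs.map_zero] at this
      rw [e1]; linarith
    · have := h (0, v)
      simp only [(har _).map_zero, hfa.map_zero] at this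
      rw [e2]; linarith
  · rintro ⟨h1, h2⟩ t
    have h1 := h1 t.1
    have h2 := h2 t.2
    rw [e1] at h1
    rw [e2] at h2
    linarith

-- This lemma and the three that follow show that the mortar form sees a test trace only off `Dir`,
-- and the Dirichlet form only on `Dir`. No information is lost when the two trace equations are
-- added.
open Classical in
theorem mortarForm_congr_of_notMem [DecidableEq u]
    (z : ((K : ι) → a → PolySpace d (p K)) × ((K : ι) → u → PolySpace d (p K)) × TraceSpace M p u)
    (vh : TraceSpace M p u) :
    mortarForm M p An T ϱ Dir z (fun e => if e.1 ∈ Dir then 0 else vh e)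
      = mortarForm M p An T ϱ Dir z vh := by
  unfold mortarForm
  congr 1 <;> refine Finset.sum_congr rfl fun e _ => ?_
  · by_cases h : e.1 ∈ Dir
    · rw [if_pos h, if_pos h]
    · rw [if_neg h, if_neg h]
      simp only [if_neg h]
  · by_cases h : e.1 ∈ M.boundaryMortars ∧ e.1 ∉ Dir
    · rw [if_pos h, if_pos h]
      simp only [if_neg h.2]
    · rw [if_neg h, if_neg h]

open Classical in
theorem dirichletForm_congr_of_mem (wh vh : TraceSpace M p u) :
    dirichletForm M p Dir wh (fun e => if e.1 ∈ Dir then vh e else 0)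
      = dirichletForm M p Dir wh vh := by
  refine Finset.sum_congr rfl fun e _ => ?_
  by_cases h : e.1 ∈ M.boundaryMortars ∧ e.1 ∈ Dir
  · rw [if_pos h, if_pos h]
    simp only [if_pos h.2]
  · rw [if_neg h, if_neg h]

open Classical in
theorem mortarForm_eq_zero_of_mem [DecidableEq u]
    (z : ((K : ι) → a → PolySpace d (p K)) × ((K : ι) → u → PolySpace d (p K)) × TraceSpace M p u)
    (vh : TraceSpace M p u) :
    mortarForm M p An T ϱ Dir z (fun e => if e.1 ∈ Dir then vh e else 0) = 0 := by
  have h0 : ∀ x e, tval (0 : u → TracePoly d (M.mortarDegree p e) e) x = 0 := fun _ _ => rfl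
  unfold mortarForm
  rw [sub_eq_zero]
  refine (Finset.sum_eq_zero fun e _ => ?_).trans (Finset.sum_eq_zero fun e _ => ?_).symm
  · by_cases h : e.1 ∈ Dir
    · rw [if_pos h]
    · rw [if_neg h]
      simp only [if_neg h, h0, dotProduct_zero, integral_zero]
  · by_cases h : e.1 ∈ M.boundaryMortars ∧ e.1 ∉ Dir
    · rw [if_pos h]
      simp only [if_neg h.2, h0, dotProduct_zero, integral_zero, Finset.sum_const_zero]
    · rw [if_neg h]

open Classical in
theorem dirichletForm_eq_zero_of_notMem (wh vh : TraceSpace M p u) :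
    dirichletForm M p Dir wh (fun e => if e.1 ∈ Dir then 0 else vh e) = 0 := by
  have h0 : ∀ x e, tval (0 : u → TracePoly d (M.mortarDegree p e) e) x = 0 := fun _ _ => rfl
  refine Finset.sum_eq_zero fun e _ => ?_
  by_cases h : e.1 ∈ M.boundaryMortars ∧ e.1 ∈ Dir
  · rw [if_pos h]
    simp only [if_pos h.2, h0, dotProduct_zero, integral_zero]
  · rw [if_neg h]

theorem boundaryFunctional_congr {P : Set (Set (Eu d))} (g : Eu d → u → ℝ)
    {vh vh' : TraceSpace M p u} (h : ∀ e, e.1 ∈ P → vh e = vh' e) :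
    boundaryFunctional M p P g vh = boundaryFunctional M p P g vh' := by
  refine Finset.sum_congr rfl fun e _ => ?_
  by_cases he : e.1 ∈ M.boundaryMortars ∧ e.1 ∈ P
  · rw [if_pos he, if_pos he, h e he.2]
  · rw [if_neg he, if_neg he]

theorem boundaryFunctional_zero (P : Set (Set (Eu d))) (g : Eu d → u → ℝ) :
    boundaryFunctional M p P g 0 = 0 := by
  have h0 : ∀ x e, tval ((0 : TraceSpace M p u) e) x = 0 := fun _ _ => rfl
  refine Finset.sum_eq_zero fun e _ => ?_
  simp only [h0, dotProduct_zero, integral_zero, ite_self]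

theorem boundaryFunctional_zero_left (P : Set (Set (Eu d))) (vh : TraceSpace M p u) :
    boundaryFunctional M p P 0 vh = 0 := by
  refine Finset.sum_eq_zero fun e _ => ?_
  simp only [Pi.zero_apply, zero_dotProduct, integral_zero, ite_self]

open Classical in
/-- The equations of the formulation are the single variational equation obtained by adding
them. -/
theorem solvesHDG_iff_forall [DecidableEq u] (hΩreg : interior (closure Ω) = Ω)
    (hB : HDGBounded M S An T ϱ) {fσ : Eu d → a → ℝ} {fw g : Eu d → u → ℝ}
    (hfσ : ∀ j, MemLp (fun x => fσ x j) 2 (volume.restrict Ω))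
    (hfw : ∀ j, MemLp (fun x => fw x j) 2 (volume.restrict Ω))
    (z : ((K : ι) → a → PolySpace d (p K)) × ((K : ι) → u → PolySpace d (p K)) ×
      TraceSpace M p u) :
    SolvesHDG M p S An T ϱ Dir fσ fw g z.1 z.2.1 z.2.2 ↔
      ∀ t : ((K : ι) → a → PolySpace d (p K)) × ((K : ι) → u → PolySpace d (p K)) ×
        TraceSpace M p u,
      (∑ K, (auxForm M p S An K (z.1 K, z.2.1 K, z.2.2) (t.1 K)
          + solForm M p S An T K (z.1 K, z.2.1 K, z.2.2) (t.2.1 K)))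
        + (mortarForm M p An T ϱ Dir z t.2.2 + dirichletForm M p Dir z.2.2 t.2.2)
      = (∑ K, ((∫ x in M.elem K, fσ x ⬝ᵥ pval (t.1 K) x)
          + ∫ x in M.elem K, fw x ⬝ᵥ pval (t.2.1 K) x))
        + (boundaryFunctional M p Dirᶜ g t.2.2 + boundaryFunctional M p Dir g t.2.2) := by
  rw [solvesHDG_iff]
  constructor
  · rintro ⟨h1, h2, h3⟩ t
    rw [← h2, ← h3]
    congr 1
    refine Finset.sum_congr rfl fun K _ => ?_
    obtain ⟨h4, h5⟩ := (solvesLocal_iff M p S An T).1 (h1 K)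
    rw [← h4, ← h5]
  · intro h
    have har := fun K z => isLinearMap_auxForm_right (p := p) hΩreg hB K z
    have hsr := fun K z => isLinearMap_solForm_right (p := p) hΩreg hB K z
    have hfa := fun K => isLinearMap_load (M := M) p hΩreg K hfσ
    have hfs := fun K => isLinearMap_load (M := M) p hΩreg K hfw
    have hmr := (isLinearMap_mortarForm_right p Dir hB z).map_zero
    have hdr := (isLinearMap_dirichletForm_right p Dir z.2.2).map_zero
    -- Each equation is recovered with a test triple having one nonzero component: supported on a
    -- single element, or a trace cut off to one side of `Dir`.
    refine ⟨fun K => (solvesLocal_iff M p S An T).2 ⟨fun s => ?_, fun v => ?_⟩, fun vh => ?_,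
      fun vh => ?_⟩
    · have := h (Pi.single K s, 0, 0)
      simp only [Pi.zero_apply, (hsr _ _).map_zero, (hfs _).map_zero, hmr, hdr,
        boundaryFunctional_zero, add_zero] at this
      rw [Finset.sum_eq_single K, Finset.sum_eq_single K, Pi.single_eq_same] at this
      · exact this
      · intro L _ hL
        rw [Pi.single_eq_of_ne hL, (hfa L).map_zero]
      · simp
      · intro L _ hL
        rw [Pi.single_eq_of_ne hL, (har L _).map_zero]
      · simp
    · have := h (0, Pi.single K v, 0)
      simp only [Pi.zero_apply, (har _ _).map_zero, (hfa _).map_zero, hmr, hdr,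
        boundaryFunctional_zero, add_zero, zero_add] at this
      rw [Finset.sum_eq_single K, Finset.sum_eq_single K, Pi.single_eq_same] at this
      · exact this
      · intro L _ hL
        rw [Pi.single_eq_of_ne hL, (hfs L).map_zero]
      · simp
      · intro L _ hL
        rw [Pi.single_eq_of_ne hL, (hsr L _).map_zero]
      · simp
    · have := h (0, 0, fun e => if e.1 ∈ Dir then 0 else vh e)
      simp only [Pi.zero_apply, (har _ _).map_zero, (hfa _).map_zero, (hsr _ _).map_zero,
        (hfs _).map_zero, add_zero, zero_add, Finset.sum_const_zero, mortarForm_congr_of_notMem,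
        dirichletForm_eq_zero_of_notMem] at this
      rw [this, boundaryFunctional_congr (P := Dir) (vh' := 0), boundaryFunctional_zero, add_zero]
      · exact boundaryFunctional_congr g fun e he => if_neg he
      · exact fun e he => if_pos he
    · have := h (0, 0, fun e => if e.1 ∈ Dir then vh e else 0)
      simp only [Pi.zero_apply, (har _ _).map_zero, (hfa _).map_zero, (hsr _ _).map_zero,
        (hfs _).map_zero, add_zero, zero_add, Finset.sum_const_zero, dirichletForm_congr_of_mem,
        mortarForm_eq_zero_of_mem] at this
      rw [this, boundaryFunctional_congr (P := Dirᶜ) (vh' := 0), boundaryFunctional_zero, zero_add]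
      · exact boundaryFunctional_congr g fun e he => if_pos he
      · exact fun e he => if_neg he

/-- After addition of all equations, trial and test triples range over the same finite-dimensional
space, so a trivial kernel gives existence for all data. -/
theorem globallyWellPosed_of_unique [DecidableEq u] (hΩreg : interior (closure Ω) = Ω)
    (hB : HDGBounded M S An T ϱ)
    (h0 : ∀ σ w wh, SolvesHDG M p S An T ϱ Dir 0 0 0 σ w wh → σ = 0 ∧ w = 0 ∧ wh = 0) :
    GloballyWellPosed M p S An T ϱ Dir := by
  intro fσ fw g hfσ hfw hg
  refine (existsUnique_congr fun z => solvesHDG_iff_forall hΩreg hB hfσ hfw z).2 ?_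
  refine existsUnique_of_bilinear (fun t => ?_) (fun z => ?_) ?_ (fun z hz => ?_)
  · refine .add_fun (.sum_fun _ fun K _ => .add_fun ?_ ?_) (.add_fun ?_ ?_)
    · have h := isLinearMap_auxForm_left (p := p) hΩreg hB K (t.1 K)
      exact ⟨fun y z => h.map_add (y.1 K, y.2.1 K, y.2.2) (z.1 K, z.2.1 K, z.2.2),
        fun r z => h.map_smul r (z.1 K, z.2.1 K, z.2.2)⟩
    · have h := isLinearMap_solForm_left (p := p) hΩreg hB K (t.2.1 K)
      exact ⟨fun y z => h.map_add (y.1 K, y.2.1 K, y.2.2) (z.1 K, z.2.1 K, z.2.2),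
        fun r z => h.map_smul r (z.1 K, z.2.1 K, z.2.2)⟩
    · exact isLinearMap_mortarForm_left p Dir hB t.2.2
    · have h := isLinearMap_dirichletForm_left p Dir (M := M) t.2.2
      exact ⟨fun y z => h.map_add y.2.2 z.2.2, fun r z => h.map_smul r z.2.2⟩
  · refine .add_fun (.sum_fun _ fun K _ => .add_fun ?_ ?_) (.add_fun ?_ ?_)
    · have h := isLinearMap_auxForm_right (p := p) hΩreg hB K (z.1 K, z.2.1 K, z.2.2)
      exact ⟨fun s t => h.map_add (s.1 K) (t.1 K), fun r t => h.map_smul r (t.1 K)⟩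
    · have h := isLinearMap_solForm_right (p := p) hΩreg hB K (z.1 K, z.2.1 K, z.2.2)
      exact ⟨fun s t => h.map_add (s.2.1 K) (t.2.1 K), fun r t => h.map_smul r (t.2.1 K)⟩
    · have h := isLinearMap_mortarForm_right p Dir hB z
      exact ⟨fun s t => h.map_add s.2.2 t.2.2, fun r t => h.map_smul r t.2.2⟩
    · have h := isLinearMap_dirichletForm_right p Dir z.2.2
      exact ⟨fun s t => h.map_add s.2.2 t.2.2, fun r t => h.map_smul r t.2.2⟩
  · refine .add_fun (.sum_fun _ fun K _ => .add_fun ?_ ?_) (.add_fun ?_ ?_)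
    · have h := isLinearMap_load (M := M) p hΩreg K hfσ
      exact ⟨fun s t => h.map_add (s.1 K) (t.1 K), fun r t => h.map_smul r (t.1 K)⟩
    · have h := isLinearMap_load (M := M) p hΩreg K hfw
      exact ⟨fun s t => h.map_add (s.2.1 K) (t.2.1 K), fun r t => h.map_smul r (t.2.1 K)⟩
    · have h := isLinearMap_boundaryFunctional p (M := M) Dirᶜ hg
      exact ⟨fun s t => h.map_add s.2.2 t.2.2, fun r t => h.map_smul r t.2.2⟩
    · have h := isLinearMap_boundaryFunctional p (M := M) Dir hg
      exact ⟨fun s t => h.map_add s.2.2 t.2.2, fun r t => h.map_smul r t.2.2⟩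
  · have hm : ∀ c : Type, ∀ j : c, MemLp (fun x : Eu d => (0 : Eu d → c → ℝ) x j) 2
        (volume.restrict Ω) := fun _ _ => MemLp.zero
    have h := h0 z.1 z.2.1 z.2.2 ((solvesHDG_iff_forall hΩreg hB (hm a) (hm u) z).2 fun t => by
      rw [hz t]
      simp [boundaryFunctional_zero_left])
    exact Prod.ext h.1 (Prod.ext h.2.1 h.2.2)

end WellPosed

/-! ### Vanishing criteria for polynomials, and Green's formulas split into mortars. -/

namespace SimplexMesh

variable {d : ℕ} [NeZero d] {Ω : Set (Eu d)} {ι : Type*} (M : SimplexMesh d Ω ι)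

/-- The zeros of a nonzero polynomial form a null set, whereas an element has positive volume
because its interior is nonempty. -/
theorem eq_zero_of_ae_elem {K : ι} {q : MvPolynomial (Fin d) ℝ}
    (h : ∀ᵐ x ∂(volume.restrict (M.elem K)), polyFun q x = 0) : q = 0 := by
  by_contra hq
  obtain ⟨x, hx⟩ := exists_polyFun_ne_zero hq
  have h1 : ∀ᵐ x ∂(volume : Measure (Eu d)), polyFun q x ≠ 0 := by
    rw [ae_iff]
    simpa using (analyticOnNhd_polyFun q).volume_zeros_eq_zero hx
  have h2 : ∀ᵐ x ∂(volume.restrict (M.elem K)), False := by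
    filter_upwards [h, ae_restrict_of_ae h1] with x hx hx' using hx' hx
  have h3 : volume (M.elem K) = 0 := by
    rw [Filter.eventually_false_iff_eq_bot, ae_eq_bot, Measure.restrict_eq_zero] at h2
    exact h2
  have h4 : (M.simplex K).interior.Nonempty := closure_nonempty_iff.1
    ⟨_, (M.simplex K).closedInterior_subset_closure_interior
      ((M.simplex K).point_mem_closedInterior 0)⟩
  exact (((M.simplex K).isOpen_interior.measure_pos volume h4).trans_le
    (measure_mono (M.simplex K).interior_subset_closedInterior)).ne' h3

theorem eq_zero_of_integral_sq_eq_zero {K : ι} {q : MvPolynomial (Fin d) ℝ}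
    (h : ∫ x in M.elem K, polyFun q x * polyFun q x = 0) : q = 0 := by
  refine M.eq_zero_of_ae_elem (K := K) ?_
  have h1 : IntegrableOn (fun x => polyFun q x * polyFun q x) (M.elem K) :=
    ((continuous_polyFun q).mul (continuous_polyFun q)).continuousOn.integrableOn_compact
      (M.isCompact_elem K)
  have h2 := (integral_eq_zero_iff_of_nonneg (fun x => mul_self_nonneg (polyFun q x)) h1).1 h
  filter_upwards [h2] with x hx using mul_self_eq_zero.1 hx

variable [Fintype ι]

/-- The representing polynomial need not be zero: it may vanish on the hyperplane of `e` only, and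
the trace is then zero as a function. If it is nonzero at some point of `e`, its zeros in this
hyperplane are null, contradicting the positive measure of `e`. -/
theorem tracePoly_eq_zero_of_ae {e : Set (Eu d)} (he : e ∈ M.skeleton) {p : ℕ}
    {w : TracePoly d p e} (h : ∀ᵐ x ∂((surf d).restrict e), w.1 x = 0) : w = 0 := by
  obtain ⟨q, hq⟩ := TracePoly.exists_polyFun w
  have hm := (M.isCompact_of_mem_skeleton he).measurableSet
  refine Subtype.ext (funext fun x => ?_)
  rw [hq]
  by_cases hx : x ∈ e
  swap
  · exact Set.indicator_of_notMem hx _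
  rw [Set.indicator_of_mem hx]
  by_contra hqx
  obtain ⟨s, hs⟩ := M.exists_mem_sides he
  have hsub : e ⊆ hyperplaneThrough ((M.simplex s.1).outerNormal s.2)
      ((M.simplex s.1).altitudeFoot s.2) :=
    (M.mem_sides.1 hs).trans ((M.simplex s.1).faceOpposite_subset_hyperplane s.2)
  have h0 := surf_zeros_eq_zero ((M.simplex s.1).norm_outerNormal s.2) _
    (analyticOnNhd_polyFun q) (hsub hx) hqx
  refine M.surf_ne_zero_of_mem_skeleton he (measure_mono_null ?_ (measure_union_null h0
    ((ae_restrict_iff' hm).1 h)))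
  intro y hy
  by_cases hz : polyFun q y = 0
  · exact Or.inl ⟨hsub hy, hz⟩
  · refine Or.inr fun h => hz ?_
    have h1 := h hy
    rwa [hq, Set.indicator_of_mem hy] at h1

/-- The divergence theorem on an element for polynomials, with the boundary integral split into
mortars. -/
theorem integral_pderiv_eq (hΩ : IsOpen Ω) (hΩreg : interior (closure Ω) = Ω) (K : ι) (k : Fin d)
    (q : MvPolynomial (Fin d) ℝ) :
    ∫ x in M.elem K, polyFun (MvPolynomial.pderiv k q) x =
      ∑ i, ∑ e ∈ M.mortarsOn K i, ∫ x in e.1, M.normal K i k * polyFun q x ∂(surf d) := by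
  have h := (M.simplex K).integral_fderiv_eq (EuclideanSpace.single k 1)
    (contDiff_polyFun (n := 1) q)
  have h1 : ∀ x, fderiv ℝ (polyFun q) x (EuclideanSpace.single k 1) =
      polyFun (MvPolynomial.pderiv k q) x := fun x => by
    rw [fderiv_polyFun, Finset.sum_eq_single k]
    · simp
    · intro j _ hj
      simp [hj]
    · simp
  simp only [h1] at h
  refine h.trans (Finset.sum_congr rfl fun i _ => ?_)
  have h2 : inner ℝ ((M.simplex K).outerNormal i) (EuclideanSpace.single k 1) = M.normal K i k := by
    rw [EuclideanSpace.inner_single_right]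
    simp
    rfl
  rw [h2]
  exact M.integral_face_eq_sum hΩ hΩreg K i
    (((M.simplex K).integrableOn_face i (continuous_polyFun q)).const_mul _)

omit [Fintype ι] in
theorem memLp_normalTrace {K : ι} {F : Eu d → Eu d} {g b : Eu d → ℝ}
    (hb : M.IsNormalTrace K F g b) {i : Fin (d + 1)} {e : Set (Eu d)} (he : e ⊆ M.face K i) :
    MemLp b ⊤ ((surf d).restrict e) :=
  (hb.1 i).mono_measure (Measure.restrict_mono he le_rfl)

omit [Fintype ι] in
theorem isFiniteMeasure_surf_face (K : ι) (i : Fin (d + 1)) :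
    IsFiniteMeasure ((surf d).restrict (M.face K i)) :=
  isFiniteMeasure_restrict.2 ((M.simplex K).surf_face_lt_top i).ne

/-- Green's formula with the normal trace, for polynomials and split into mortars. -/
theorem integral_normalTrace_eq (hΩ : IsOpen Ω) (hΩreg : interior (closure Ω) = Ω) {K : ι}
    {F : Eu d → Eu d} {g b : Eu d → ℝ} (hb : M.IsNormalTrace K F g b)
    (q : MvPolynomial (Fin d) ℝ) :
    ∫ x in M.elem K, ((∑ k, polyFun (MvPolynomial.pderiv k q) x * F x k) + g x * polyFun q x) =
      ∑ i, ∑ e ∈ M.mortarsOn K i, ∫ x in e.1, b x * polyFun q x ∂(surf d) := by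
  have h := hb.2 (polyFun q) (contDiff_polyFun q)
  simp only [fderiv_polyFun] at h
  refine h.trans (Finset.sum_congr rfl fun i _ => ?_)
  have := M.isFiniteMeasure_surf_face K i
  exact M.integral_face_eq_sum hΩ hΩreg K i
    (((continuous_polyFun q).memLp_top_restrict (M.isCompact_face K i)).mul' (hb.1 i)).integrable_top

end SimplexMesh

/-! ### The stabilization parameter and the coefficients in scalar form. -/

namespace ConvDiff

variable {d : ℕ}

/-- The stabilization parameter `½ (√(b² + 4) - b)` of the upwind flux. -/
noncomputable def tau (b : ℝ) : ℝ := (1 / 2) * (Real.sqrt (|b| ^ 2 + 4) - b)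

theorem half_add_tau (b : ℝ) : (1 / 2) * b + tau b = (1 / 2) * Real.sqrt (|b| ^ 2 + 4) := by
  unfold tau
  ring

/-- This is the coefficient of the dissipation `(w - ŵ)²` in the energy; its positivity does not
depend on the flow direction. -/
theorem half_add_tau_pos (b : ℝ) : 0 < (1 / 2) * b + tau b := by
  rw [half_add_tau]
  exact mul_pos one_half_pos (Real.sqrt_pos.2 (by positivity))

theorem abs_tau_le (b : ℝ) : |tau b| ≤ |b| + 1 := by
  have h1 : Real.sqrt (|b| ^ 2 + 4) ≤ |b| + 2 := by
    rw [Real.sqrt_le_left (by positivity)]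
    nlinarith [abs_nonneg b]
  have h2 := Real.sqrt_nonneg (|b| ^ 2 + 4)
  unfold tau
  rw [abs_le]
  constructor <;> nlinarith [le_abs_self b, neg_abs_le b]

theorem memLp_tau {α : Type*} [MeasurableSpace α] {μ : Measure α} {f : α → ℝ}
    (hf : MemLp f ⊤ μ) : MemLp (fun x => tau (f x)) ⊤ μ := by
  have hc : Continuous tau := by
    unfold tau
    fun_prop
  refine MemLp.of_le (g := fun x => |f x| + 1) (hf.abs.add (memLp_top_const 1))
    (hc.comp_aestronglyMeasurable hf.1) (Filter.Eventually.of_forall fun x => ?_)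
  rw [Real.norm_eq_abs, Real.norm_eq_abs, abs_of_nonneg (by positivity : 0 ≤ |f x| + 1)]
  exact abs_tau_le _

theorem memLp_rho {ι : Type*} {μ : Measure (Eu d)} {b : ι → Eu d → ℝ} {K : ι}
    (hb : MemLp (b K) ⊤ μ) (i : Fin (d + 1)) : MemLp (rho b K i) ⊤ μ := by
  have hm : Measurable fun t : ℝ => if 0 < t then (1 : ℝ) / 2 else if t = 0 then 0 else -t :=
    Measurable.ite measurableSet_Ioi measurable_const
      (Measurable.ite (measurableSet_singleton 0) measurable_const measurable_neg)
  refine MemLp.of_le (g := fun x => |b K x| + 1) (hb.abs.add (memLp_top_const 1))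
    (hm.comp_aemeasurable hb.1.aemeasurable).aestronglyMeasurable
    (Filter.Eventually.of_forall fun x => ?_)
  rw [Real.norm_eq_abs, Real.norm_eq_abs, abs_of_nonneg (by positivity : 0 ≤ |b K x| + 1)]
  unfold rho
  have := abs_nonneg (b K x)
  split_ifs
  · rw [abs_of_pos one_half_pos]
    linarith
  · rw [abs_zero]
    linarith
  · rw [abs_neg]
    linarith

section Pointwise

variable (κ : Eu d → Matrix (Fin d) (Fin d) ℝ) (β : Eu d → Eu d) (x : Eu d)

theorem system_B_dotProduct (k : Fin d) (f : Fin 1 → ℝ) (g : Fin d → ℝ) :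
    ((system κ β).B k x *ᵥ f) ⬝ᵥ g = f 0 * g k := by
  rw [system_B]
  have : replicateCol (Fin 1) (Pi.single k (1 : ℝ)) *ᵥ f = Pi.single k (f 0) := by
    ext i
    by_cases h : i = k
    · subst h; simp [mulVec, dotProduct]
    · simp [mulVec, dotProduct, h]
  rw [this, single_dotProduct]

theorem system_flux_dotProduct (k : Fin d) (f : Fin d → ℝ) (h g : Fin 1 → ℝ) :
    (((system κ β).B k x)ᵀ *ᵥ f + (system κ β).C k x *ᵥ h) ⬝ᵥ g =
      (f k + β x k * h 0) * g 0 := by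
  rw [system_B]
  simp [system, TwoFieldSystem.C, mulVec, dotProduct, Pi.single_apply]

theorem system_G_dotProduct (f g : Fin d → ℝ) (h : Fin 1 → ℝ) :
    (((system κ β).G x).toBlocks₁₁ *ᵥ f + ((system κ β).G x).toBlocks₁₂ *ᵥ h) ⬝ᵥ g =
      ((κ x)⁻¹ *ᵥ f) ⬝ᵥ g := by
  simp [system]

theorem system_G_dotProduct_eq_zero (f : Fin d → ℝ) (h g : Fin 1 → ℝ) :
    (((system κ β).G x).toBlocks₂₁ *ᵥ f + ((system κ β).G x).toBlocks₂₂ *ᵥ h) ⬝ᵥ g = 0 := by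
  simp [system]

variable [NeZero d] {Ω : Set (Eu d)} {ι : Type*} (M : SimplexMesh d Ω ι) (b : ι → Eu d → ℝ)
  (K : ι) (i : Fin (d + 1))

theorem normalMatrix_dotProduct (f : Fin 1 → ℝ) (g : Fin d → ℝ) :
    ((normalMatrix M b K i x).toBlocks₁₂ *ᵥ f) ⬝ᵥ g = f 0 * ∑ k, M.normal K i k * g k := by
  simp only [normalMatrix, toBlocks_fromBlocks₁₂, dotProduct, mulVec, replicateCol_apply,
    Finset.univ_unique, Finset.sum_singleton, Finset.mul_sum]
  exact Finset.sum_congr rfl fun k _ => by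
    rw [Subsingleton.elim (default : Fin 1) 0]; ring

theorem hdgFlux_apply (f : Fin d → ℝ) (h h' : Fin 1 → ℝ) (j : Fin 1) :
    hdgFlux (normalMatrix M b K i x) (stab b K i x) f h h' j =
      (∑ k, M.normal K i k * f k) + b K x * h 0 + tau (b K x) * (h 0 - h' 0) := by
  simp [hdgFlux, normalMatrix, stab, tau, mulVec, dotProduct]

end Pointwise

section Bounded

variable [NeZero d] {Ω : Set (Eu d)} {ι : Type*} [Fintype ι] {M : SimplexMesh d Ω ι}
  {κ : Eu d → Matrix (Fin d) (Fin d) ℝ} {β : Eu d → Eu d} {divβ : Eu d → ℝ} {b : ι → Eu d → ℝ}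

theorem hdgBounded (hS : (system κ β).IsPartiallyCoercive Ω)
    (hb : ∀ K, M.IsNormalTrace K β divβ (b K)) :
    HDGBounded M (system κ β) (normalMatrix M b) (stab b) (rho b) where
  G := hS.G_bounded
  A := hS.A_bounded
  An := by
    intro e he s hs
    have hbe := M.memLp_normalTrace (hb s.1) (M.mem_sides.1 hs)
    rintro (i | i) (j | j)
    · exact memLp_top_const 0
    · exact memLp_top_const _
    · exact memLp_top_const _
    · exact hbe
  T e he s hs i j := memLp_tau (M.memLp_normalTrace (hb s.1) (M.mem_sides.1 hs))
  ϱ e he s hs := memLp_rho (M.memLp_normalTrace (hb s.1) (M.mem_sides.1 hs)) s.2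

end Bounded

end ConvDiff

/-! ### The element energy identity and consequences of the first local equation. -/

namespace ConvDiff

variable {d : ℕ} [NeZero d] {Ω : Set (Eu d)} {ι : Type*} [Fintype ι] {M : SimplexMesh d Ω ι}
  {p : ι → ℕ} {κ : Eu d → Matrix (Fin d) (Fin d) ℝ} {β : Eu d → Eu d} {divβ : Eu d → ℝ}
  {b : ι → Eu d → ℝ}

theorem auxForm_eq (K : ι) (σ s : Fin d → PolySpace d (p K)) (w : Fin 1 → PolySpace d (p K))
    (wh : TraceSpace M p (Fin 1)) :
    auxForm M p (system κ β) (normalMatrix M b) K (σ, w, wh) s =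
      -(∑ k, ∫ x in M.elem K, polyFun (w 0).1 x * polyFun (MvPolynomial.pderiv k (s k).1) x)
      + (∫ x in M.elem K, ((κ x)⁻¹ *ᵥ pval σ x) ⬝ᵥ pval s x)
      + ∑ i, ∑ e ∈ M.mortarsOn K i, ∫ x in e.1,
        (wh e 0).1 x * ∑ k, M.normal K i k * polyFun (s k).1 x ∂(SimplexMesh.surf d) := by
  simp only [auxForm, system_B_dotProduct, system_G_dotProduct, normalMatrix_dotProduct]
  rfl

theorem solForm_eq (K : ι) (σ : Fin d → PolySpace d (p K)) (w v : Fin 1 → PolySpace d (p K))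
    (wh : TraceSpace M p (Fin 1)) :
    solForm M p (system κ β) (normalMatrix M b) (stab b) K (σ, w, wh) v =
      -(∑ k, ∫ x in M.elem K, (polyFun (σ k).1 x + β x k * polyFun (w 0).1 x)
        * polyFun (MvPolynomial.pderiv k (v 0).1) x)
      + ∑ i, ∑ e ∈ M.mortarsOn K i, ∫ x in e.1,
        ((∑ k, M.normal K i k * polyFun (σ k).1 x) + b K x * polyFun (w 0).1 x
          + tau (b K x) * (polyFun (w 0).1 x - (wh e 0).1 x)) * polyFun (v 0).1 x
        ∂(SimplexMesh.surf d) := by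
  simp only [solForm, system_flux_dotProduct, system_G_dotProduct_eq_zero, integral_zero, add_zero]
  simp only [dotProduct, Finset.univ_unique, Finset.sum_singleton, hdgFlux_apply]
  rfl

theorem memLp_trace (wh : TraceSpace M p (Fin 1)) (e : {e // e ∈ M.skeleton}) :
    MemLp (wh e 0).1 ⊤ ((SimplexMesh.surf d).restrict e.1) :=
  memLp_tval (M.isCompact_of_mem_skeleton e.2) (wh e) 0

theorem memLp_polyFun_mortar (q : MvPolynomial (Fin d) ℝ) (e : {e // e ∈ M.skeleton}) :
    MemLp (polyFun q) ⊤ ((SimplexMesh.surf d).restrict e.1) :=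
  (continuous_polyFun q).memLp_top_restrict (M.isCompact_of_mem_skeleton e.2)

theorem memLp_normalFlux (n : Eu d) {c : ℕ} (σ : Fin d → PolySpace d c)
    (e : {e // e ∈ M.skeleton}) :
    MemLp (fun x => ∑ k, n k * polyFun (σ k).1 x) ⊤ ((SimplexMesh.surf d).restrict e.1) :=
  memLp_finsetSum _ fun k _ => (memLp_polyFun_mortar (σ k).1 e).const_mul _

theorem memLp_flux {e : {e // e ∈ M.skeleton}} {c : Eu d → ℝ}
    (hc : MemLp c ⊤ ((SimplexMesh.surf d).restrict e.1)) (n : Eu d) {m : ℕ}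
    (σ : Fin d → PolySpace d m) (u : MvPolynomial (Fin d) ℝ) (wh : TraceSpace M p (Fin 1)) :
    MemLp (fun x => (∑ k, n k * polyFun (σ k).1 x) + c x * polyFun u x
      + tau (c x) * (polyFun u x - (wh e 0).1 x)) ⊤ ((SimplexMesh.surf d).restrict e.1) :=
  ((memLp_normalFlux n σ e).add ((memLp_polyFun_mortar u e).mul' hc)).add
    (((memLp_polyFun_mortar u e).sub (memLp_trace wh e)).mul' (memLp_tau hc))

/-- The energy identity on an element. -/
theorem energy_elem (hΩ : IsOpen Ω) (hΩreg : interior (closure Ω) = Ω)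
    (hβ : MemLp β ⊤ (volume.restrict Ω)) (hdivβ : MemLp divβ ⊤ (volume.restrict Ω)) {K : ι}
    (hb : M.IsNormalTrace K β divβ (b K)) {σ : Fin d → PolySpace d (p K)}
    {w : Fin 1 → PolySpace d (p K)} {wh : TraceSpace M p (Fin 1)}
    (h1 : auxForm M p (system κ β) (normalMatrix M b) K (σ, w, wh) σ = 0)
    (h2 : solForm M p (system κ β) (normalMatrix M b) (stab b) K (σ, w, wh) w = 0) :
    (∫ x in M.elem K, ((κ x)⁻¹ *ᵥ pval σ x) ⬝ᵥ pval σ x)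
      + (1 / 2) * (∫ x in M.elem K, divβ x * (polyFun (w 0).1 x * polyFun (w 0).1 x))
      + ∑ i, ∑ e ∈ M.mortarsOn K i, ∫ x in e.1,
        ((wh e 0).1 x * (∑ k, M.normal K i k * polyFun (σ k).1 x)
          + (1 / 2) * (b K x * (polyFun (w 0).1 x * polyFun (w 0).1 x))
          + tau (b K x) * (polyFun (w 0).1 x - (wh e 0).1 x) * polyFun (w 0).1 x)
        ∂(SimplexMesh.surf d) = 0 := by
  rw [auxForm_eq] at h1
  rw [solForm_eq] at h2
  set u := (w 0).1
  have hfin := isFiniteMeasure_volume_restrict_elem (M := M) K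
  have hβK : ∀ k, MemLp (fun x => β x k) ⊤ (volume.restrict (M.elem K)) := fun k =>
    memLp_elem hΩreg (memLp_apply hβ k) K
  have hpoly : ∀ q : MvPolynomial (Fin d) ℝ, MemLp (polyFun q) ⊤ (volume.restrict (M.elem K)) :=
    fun q => (continuous_polyFun q).memLp_top_restrict (M.isCompact_elem K)
  have i1 : ∀ k, Integrable (fun x => polyFun u x * polyFun (MvPolynomial.pderiv k (σ k).1) x)
      (volume.restrict (M.elem K)) := fun k =>
    MemLp.integrable_top ((hpoly _).mul' (hpoly _))
  have i2 : ∀ k, Integrable (fun x => polyFun (σ k).1 x * polyFun (MvPolynomial.pderiv k u) x)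
      (volume.restrict (M.elem K)) := fun k =>
    MemLp.integrable_top ((hpoly _).mul' (hpoly _))
  have i3 : ∀ k, Integrable (fun x => β x k * polyFun u x * polyFun (MvPolynomial.pderiv k u) x)
      (volume.restrict (M.elem K)) := fun k =>
    MemLp.integrable_top ((hpoly _).mul' ((hpoly u).mul' (r := ⊤) (hβK k)))
  have i4 : Integrable (fun x => divβ x * (polyFun u x * polyFun u x))
      (volume.restrict (M.elem K)) :=
    (((hpoly u).mul' (r := ⊤) (hpoly u)).mul' (memLp_elem hΩreg hdivβ K)).integrable_top
  have hA2 : ∀ k, ∫ x in M.elem K, (polyFun (σ k).1 x + β x k * polyFun u x)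
        * polyFun (MvPolynomial.pderiv k u) x =
      (∫ x in M.elem K, polyFun (σ k).1 x * polyFun (MvPolynomial.pderiv k u) x) +
      ∫ x in M.elem K, β x k * polyFun u x * polyFun (MvPolynomial.pderiv k u) x := fun k => by
    rw [← integral_add (i2 k) (i3 k)]
    exact integral_congr_ae (Filter.Eventually.of_forall fun x => add_mul _ _ _)
  -- Divergence theorem for `u σ_k`: the terms `(u, ∇·σ)` of the first equation and `(σ, ∇u)` of the
  -- second combine into a boundary integral.
  have hG : ∀ k, (∫ x in M.elem K, polyFun u x * polyFun (MvPolynomial.pderiv k (σ k).1) x) +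
      (∫ x in M.elem K, polyFun (σ k).1 x * polyFun (MvPolynomial.pderiv k u) x) =
      ∑ i, ∑ e ∈ M.mortarsOn K i,
        ∫ x in e.1, M.normal K i k * polyFun (u * (σ k).1) x ∂(SimplexMesh.surf d) := fun k => by
    rw [← M.integral_pderiv_eq hΩ hΩreg, ← integral_add (i1 k) (i2 k)]
    refine integral_congr_ae (Filter.Eventually.of_forall fun x => ?_)
    simp only [Derivation.leibniz, smul_eq_mul, polyFun_add, polyFun_mul]
  -- Green's formula for `u²` with the normal trace: it replaces the convection term by half a
  -- boundary integral minus half the integral of `∇·β u²`.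
  have hT : 2 * (∑ k, ∫ x in M.elem K, β x k * polyFun u x * polyFun (MvPolynomial.pderiv k u) x)
      + (∫ x in M.elem K, divβ x * (polyFun u x * polyFun u x)) =
      ∑ i, ∑ e ∈ M.mortarsOn K i,
        ∫ x in e.1, b K x * polyFun (u * u) x ∂(SimplexMesh.surf d) := by
    rw [← M.integral_normalTrace_eq hΩ hΩreg hb, ← integral_finsetSum _ fun k _ => i3 k,
      ← integral_const_mul,
      ← integral_add ((integrable_finsetSum _ fun k _ => i3 k).const_mul 2) i4]
    refine integral_congr_ae (Filter.Eventually.of_forall fun x => ?_)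
    simp only [Derivation.leibniz, smul_eq_mul, polyFun_add, polyFun_mul]
    congr 1
    rw [Finset.mul_sum]
    exact Finset.sum_congr rfl fun k _ => by ring
  -- The mortar energy collects the boundary terms of the two equations, minus those produced by the
  -- two integrations by parts.
  have hE : ∀ i, ∀ e ∈ M.mortarsOn K i, ∫ x in e.1,
        ((wh e 0).1 x * (∑ k, M.normal K i k * polyFun (σ k).1 x)
          + (1 / 2) * (b K x * (polyFun u x * polyFun u x))
          + tau (b K x) * (polyFun u x - (wh e 0).1 x) * polyFun u x) ∂(SimplexMesh.surf d) =
      (∫ x in e.1, (wh e 0).1 x * ∑ k, M.normal K i k * polyFun (σ k).1 x ∂(SimplexMesh.surf d))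
      + (∫ x in e.1, ((∑ k, M.normal K i k * polyFun (σ k).1 x) + b K x * polyFun u x
          + tau (b K x) * (polyFun u x - (wh e 0).1 x)) * polyFun u x ∂(SimplexMesh.surf d))
      - (∑ k, ∫ x in e.1, M.normal K i k * polyFun (u * (σ k).1) x ∂(SimplexMesh.surf d))
      - (1 / 2) * ∫ x in e.1, b K x * polyFun (u * u) x ∂(SimplexMesh.surf d) := by
    intro i e he
    have hfe := M.isFiniteMeasure_surf_restrict e.2
    have hw := memLp_trace wh e
    have hp : ∀ q, MemLp (polyFun q) ⊤ ((SimplexMesh.surf d).restrict e.1) := fun q =>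
      memLp_polyFun_mortar q e
    have hbe := M.memLp_normalTrace hb (M.mem_mortarsOn.1 he)
    have hn := memLp_normalFlux (M.normal K i) σ e
    have j1 := (hn.mul' hw).integrable_top
    have j2 := ((hp u).mul' (memLp_flux hbe (M.normal K i) σ u wh)).integrable_top
    have j3 : ∀ k, Integrable (fun x => M.normal K i k * polyFun (u * (σ k).1) x)
      ((SimplexMesh.surf d).restrict e.1) := fun k => ((hp _).const_mul _).integrable_top
    have j4 := ((hp (u * u)).mul' hbe).integrable_top
    rw [← integral_finsetSum _ fun k _ => j3 k, ← integral_const_mul]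
    rw [← integral_add' j1 j2, ← integral_sub' (j1.add j2) (integrable_finsetSum _ fun k _ => j3 k),
      ← integral_sub' ((j1.add j2).sub (integrable_finsetSum _ fun k _ => j3 k)) (j4.const_mul _)]
    refine integral_congr_ae (Filter.Eventually.of_forall fun x => ?_)
    have e1 : ∑ k, M.normal K i k * polyFun (u * (σ k).1) x =
        (∑ k, M.normal K i k * polyFun (σ k).1 x) * polyFun u x := by
      rw [Finset.sum_mul]
      exact Finset.sum_congr rfl fun k _ => by rw [polyFun_mul]; ring
    simp only [Pi.add_apply, Pi.sub_apply]
    rw [e1, polyFun_mul]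
    ring
  rw [Finset.sum_congr rfl fun i _ => Finset.sum_congr rfl (hE i)]
  simp only [hA2, Finset.sum_add_distrib] at h2
  have hG' := Finset.sum_congr rfl fun k (_ : k ∈ Finset.univ) => hG k
  rw [Finset.sum_add_distrib, Finset.sum_comm] at hG'
  simp only [Finset.sum_sub_distrib, Finset.sum_add_distrib, ← Finset.mul_sum]
  have hc : ∑ i, ∑ k, ∑ e ∈ M.mortarsOn K i,
        ∫ x in e.1, M.normal K i k * polyFun (u * (σ k).1) x ∂(SimplexMesh.surf d) =
      ∑ i, ∑ e ∈ M.mortarsOn K i, ∑ k,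
        ∫ x in e.1, M.normal K i k * polyFun (u * (σ k).1) x ∂(SimplexMesh.surf d) :=
    Finset.sum_congr rfl fun i _ => Finset.sum_comm
  rw [hc] at hG'
  linarith

/-- If the auxiliary field vanishes and the trace agrees with `w` on `∂K`, then the first local
equation forces `w` to be constant. -/
theorem pderiv_eq_zero (hΩ : IsOpen Ω) (hΩreg : interior (closure Ω) = Ω) {K : ι}
    {w : Fin 1 → PolySpace d (p K)} {wh : TraceSpace M p (Fin 1)}
    (h : ∀ s, auxForm M p (system κ β) (normalMatrix M b) K (0, w, wh) s = 0)
    (hw : ∀ i, ∀ e ∈ M.mortarsOn K i,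
      ∀ᵐ x ∂((SimplexMesh.surf d).restrict e.1), (wh e 0).1 x = polyFun (w 0).1 x) (k : Fin d) :
    MvPolynomial.pderiv k (w 0).1 = 0 := by
  set u := (w 0).1 with hu
  have hfin := isFiniteMeasure_volume_restrict_elem (M := M) K
  have hpoly : ∀ q : MvPolynomial (Fin d) ℝ, MemLp (polyFun q) ⊤ (volume.restrict (M.elem K)) :=
    fun q => (continuous_polyFun q).memLp_top_restrict (M.isCompact_elem K)
  -- The test function is `∇u`. After integration by parts the boundary term cancels against the
  -- trace term, and what remains is `‖∇u‖² = 0`.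
  let s : Fin d → PolySpace d (p K) := fun k => ⟨MvPolynomial.pderiv k u,
    pderiv_mem_polySpace (w 0).2 k⟩
  have hs := h s
  rw [auxForm_eq] at hs
  have h0 : ∀ x, pval (0 : Fin d → PolySpace d (p K)) x = 0 := fun x => funext fun j => map_zero _
  simp only [h0, mulVec_zero, zero_dotProduct, integral_zero, add_zero] at hs
  have hG : ∀ k, (∫ x in M.elem K, polyFun u x * polyFun (MvPolynomial.pderiv k (s k).1) x) +
      (∫ x in M.elem K, polyFun (s k).1 x * polyFun (s k).1 x) =
      ∑ i, ∑ e ∈ M.mortarsOn K i,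
        ∫ x in e.1, M.normal K i k * polyFun (u * (s k).1) x ∂(SimplexMesh.surf d) := fun k => by
    rw [← M.integral_pderiv_eq hΩ hΩreg, ← integral_add (MemLp.integrable_top ((hpoly _).mul' (hpoly _)))
      (MemLp.integrable_top ((hpoly _).mul' (hpoly _)))]
    refine integral_congr_ae (Filter.Eventually.of_forall fun x => ?_)
    simp only [Derivation.leibniz, smul_eq_mul, polyFun_add, polyFun_mul]
    rfl
  have hE : ∀ i, ∀ e ∈ M.mortarsOn K i,
      ∫ x in e.1, (wh e 0).1 x * ∑ k, M.normal K i k * polyFun (s k).1 x ∂(SimplexMesh.surf d) =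
      ∑ k, ∫ x in e.1, M.normal K i k * polyFun (u * (s k).1) x ∂(SimplexMesh.surf d) := by
    intro i e he
    have hfe := M.isFiniteMeasure_surf_restrict e.2
    rw [← integral_finsetSum _ fun k _ =>
      ((memLp_polyFun_mortar (u * (s k).1) e).const_mul _).integrable_top]
    refine integral_congr_ae ?_
    filter_upwards [hw i e he] with x hx
    rw [hx, Finset.mul_sum]
    exact Finset.sum_congr rfl fun k _ => by rw [polyFun_mul]; ring
  rw [Finset.sum_congr rfl fun i _ => Finset.sum_congr rfl (hE i),
    Finset.sum_congr rfl fun i _ => Finset.sum_comm, Finset.sum_comm,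
    ← Finset.sum_congr rfl fun k _ => hG k, Finset.sum_add_distrib, neg_add_cancel_left] at hs
  have hk := (Finset.sum_eq_zero_iff_of_nonneg fun k _ =>
    integral_nonneg fun x => mul_self_nonneg (polyFun (s k).1 x)).1 hs k (Finset.mem_univ k)
  exact M.eq_zero_of_integral_sq_eq_zero hk

/-- For a constant `u`, the norm of `u` on `K` is a boundary integral. -/
theorem integral_sq_eq (hΩ : IsOpen Ω) (hΩreg : interior (closure Ω) = Ω) (K : ι)
    {u : MvPolynomial (Fin d) ℝ} (k : Fin d) (hu : MvPolynomial.pderiv k u = 0) :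
    ∫ x in M.elem K, polyFun u x * polyFun u x = ∑ i, ∑ e ∈ M.mortarsOn K i,
      ∫ x in e.1, M.normal K i k * (x k * (polyFun u x * polyFun u x)) ∂(SimplexMesh.surf d) := by
  -- Divergence theorem for the field `x_k u² e_k`, whose divergence is `u²` because `∂_k u = 0`.
  have h := M.integral_pderiv_eq hΩ hΩreg K k (MvPolynomial.X k * (u * u))
  simp only [Derivation.leibniz, hu, add_zero, zero_add, MvPolynomial.pderiv_X_self,
    smul_eq_mul, mul_one, mul_zero, polyFun_mul, polyFun_X] at h
  exact h

end ConvDiff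

/-! ### Uniqueness for the local and the global problem. -/

namespace ConvDiff

variable {d : ℕ} [NeZero d] {Ω : Set (Eu d)} {ι : Type*} [Fintype ι] {M : SimplexMesh d Ω ι}
  {p : ι → ℕ} {κ : Eu d → Matrix (Fin d) (Fin d) ℝ} {β : Eu d → Eu d} {divβ : Eu d → ℝ}
  {b : ι → Eu d → ℝ}

omit [Fintype ι] in
theorem ae_elem (hΩreg : interior (closure Ω) = Ω) {P : Eu d → Prop}
    (h : ∀ᵐ x ∂(volume.restrict Ω), P x) (K : ι) : ∀ᵐ x ∂(volume.restrict (M.elem K)), P x :=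
  ae_mono (M.restrict_elem_le hΩreg K) h

section Volume

variable (hΩreg : interior (closure Ω) = Ω) {k₀ : ℝ} (hk₀ : 0 < k₀)
  (hinv : ∀ᵐ x ∂(volume.restrict Ω), QuadLE (k₀ • (1 : Matrix (Fin d) (Fin d) ℝ)) (κ x)⁻¹)

include hΩreg hk₀ hinv

omit [Fintype ι] in
theorem ae_diffusion_nonneg {K : ι} (σ : Fin d → PolySpace d (p K)) :
    ∀ᵐ x ∂(volume.restrict (M.elem K)), 0 ≤ ((κ x)⁻¹ *ᵥ pval σ x) ⬝ᵥ pval σ x := by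
  filter_upwards [ae_elem (M := M) hΩreg hinv K] with x hx
  rw [dotProduct_comm]
  exact (mul_nonneg hk₀.le (Finset.sum_nonneg fun i _ => mul_self_nonneg _)).trans
    (hx.mul_dotProduct_le (pval σ x))

omit [Fintype ι] in
theorem aux_eq_zero {K : ι} {σ : Fin d → PolySpace d (p K)}
    (hi : Integrable (fun x => ((κ x)⁻¹ *ᵥ pval σ x) ⬝ᵥ pval σ x) (volume.restrict (M.elem K)))
    (h : ∫ x in M.elem K, ((κ x)⁻¹ *ᵥ pval σ x) ⬝ᵥ pval σ x = 0) : σ = 0 := by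
  have h1 := (integral_eq_zero_iff_of_nonneg_ae
    (ae_diffusion_nonneg (M := M) hΩreg hk₀ hinv σ) hi).1 h
  funext k
  refine Subtype.ext (M.eq_zero_of_ae_elem (K := K) ?_)
  filter_upwards [ae_elem (M := M) hΩreg hinv K, h1] with x hx hx1
  have h2 := hx.mul_dotProduct_le (pval σ x)
  rw [dotProduct_comm (pval σ x) ((κ x)⁻¹ *ᵥ pval σ x), hx1] at h2
  have h3 := sq_le_dotProduct_self (pval σ x) k
  have h4 : pval σ x ⬝ᵥ pval σ x ≤ 0 := by
    by_contra! hlt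
    exact absurd h2 (not_le.2 (mul_pos hk₀ hlt))
  exact pow_eq_zero_iff two_ne_zero |>.1 (le_antisymm (h3.trans h4) (sq_nonneg _))

end Volume

section Unique

variable (hΩ : IsOpen Ω) (hΩreg : interior (closure Ω) = Ω)
  (hS : (system κ β).IsPartiallyCoercive Ω)
  (hβ : MemLp β ⊤ (volume.restrict Ω)) (hdivβ : MemLp divβ ⊤ (volume.restrict Ω))
  (hcoer : ∀ᵐ x ∂(volume.restrict Ω), 0 ≤ (1 / 2) * divβ x)
  (hb : ∀ K, M.IsNormalTrace K β divβ (b K))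

include hΩreg hS hb in
theorem integrable_diffusion {K : ι} (σ : Fin d → PolySpace d (p K)) :
    Integrable (fun x => ((κ x)⁻¹ *ᵥ pval σ x) ⬝ᵥ pval σ x) (volume.restrict (M.elem K)) := by
  have h := integrable_auxForm_mass p hΩreg (hdgBounded hS hb) K σ 0 σ
  simpa only [system_G_dotProduct] using h

omit [Fintype ι] in
include hΩreg hcoer in
theorem reaction_nonneg {K : ι} (u : MvPolynomial (Fin d) ℝ) :
    0 ≤ ∫ x in M.elem K, divβ x * (polyFun u x * polyFun u x) := by
  refine integral_nonneg_of_ae ?_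
  filter_upwards [ae_elem (M := M) hΩreg hcoer K] with x hx
  exact mul_nonneg (by linarith) (mul_self_nonneg _)

include hΩ hΩreg hS hβ hdivβ hcoer hb

/-- For `ŵ = 0` the mortar energy is `(½b + τ) u²`, so all three parts of the energy are nonnegative
and vanish. Hence `σ = 0` and `u = 0` on `∂K`, which agrees with the trace, so `∇u = 0`. The norm of
`u` on `K` is then a boundary integral of zero. -/
theorem local_unique {K : ι} {σ : Fin d → PolySpace d (p K)} {w : Fin 1 → PolySpace d (p K)}
    (h : SolvesLocal M p (system κ β) (normalMatrix M b) (stab b) 0 0 0 K σ w) :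
    σ = 0 ∧ w = 0 := by
  obtain ⟨h1, h2⟩ := (solvesLocal_iff _ _ _ _ _).1 h
  simp only [Pi.zero_apply, zero_dotProduct, integral_zero] at h1 h2
  obtain ⟨k₀, hk₀, hinv⟩ := hS.G_aux_coercive
  have hinv : ∀ᵐ x ∂(volume.restrict Ω), QuadLE (k₀ • (1 : Matrix (Fin d) (Fin d) ℝ)) (κ x)⁻¹ :=
    hinv
  have hE := energy_elem hΩ hΩreg hβ hdivβ (hb K) (h1 σ) (h2 w)
  set u := (w 0).1 with hu
  have hm : ∀ i (e : {e // e ∈ M.skeleton}), ∫ x in e.1,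
        (((0 : TraceSpace M p (Fin 1)) e 0).1 x * (∑ k, M.normal K i k * polyFun (σ k).1 x)
          + (1 / 2) * (b K x * (polyFun u x * polyFun u x))
          + tau (b K x) * (polyFun u x - ((0 : TraceSpace M p (Fin 1)) e 0).1 x) * polyFun u x)
        ∂(SimplexMesh.surf d) =
      ∫ x in e.1, ((1 / 2) * b K x + tau (b K x)) * (polyFun u x * polyFun u x)
        ∂(SimplexMesh.surf d) := fun i e =>
    integral_congr_ae (Filter.Eventually.of_forall fun x => by
      have h0 : ((0 : TraceSpace M p (Fin 1)) e 0).1 x = 0 := rfl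
      simp only [h0]
      ring)
  have hm0 : ∀ e : {e // e ∈ M.skeleton},
      0 ≤ ∫ x in e.1, ((1 / 2) * b K x + tau (b K x)) * (polyFun u x * polyFun u x)
        ∂(SimplexMesh.surf d) := fun e =>
    integral_nonneg fun x => mul_nonneg (half_add_tau_pos _).le (mul_self_nonneg _)
  simp only [hm] at hE
  have hA := integral_nonneg_of_ae (ae_diffusion_nonneg (M := M) hΩreg hk₀ hinv σ)
  have hD := reaction_nonneg (M := M) (K := K) hΩreg hcoer u
  have hsum : ∀ i, 0 ≤ ∑ e ∈ M.mortarsOn K i, ∫ x in e.1,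
      ((1 / 2) * b K x + tau (b K x)) * (polyFun u x * polyFun u x) ∂(SimplexMesh.surf d) :=
    fun i => Finset.sum_nonneg fun e _ => hm0 e
  have hB := Finset.sum_nonneg fun i (_ : i ∈ Finset.univ) => hsum i
  have hσ : σ = 0 := aux_eq_zero (M := M) hΩreg hk₀ hinv
    (integrable_diffusion hΩreg hS hb σ) (by linarith)
  subst hσ
  have hu0 : ∀ i, ∀ e ∈ M.mortarsOn K i,
      ∀ᵐ x ∂((SimplexMesh.surf d).restrict e.1), polyFun u x = 0 := by
    intro i e he
    have hi := (Finset.sum_eq_zero_iff_of_nonneg fun i _ => hsum i).1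
      (by linarith) i (Finset.mem_univ i)
    have hi := (Finset.sum_eq_zero_iff_of_nonneg fun e _ => hm0 e).1 hi e he
    have hfe := M.isFiniteMeasure_surf_restrict e.2
    have hbe := M.memLp_normalTrace (hb K) (M.mem_mortarsOn.1 he)
    have hq := memLp_polyFun_mortar u e
    have hint : Integrable (fun x => ((1 / 2) * b K x + tau (b K x)) *
        (polyFun u x * polyFun u x)) ((SimplexMesh.surf d).restrict e.1) :=
      MemLp.integrable_top ((hq.mul' (r := ⊤) hq).mul' ((hbe.const_mul (1 / 2)).add
        (memLp_tau hbe)))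
    rw [integral_eq_zero_iff_of_nonneg (fun x => mul_nonneg (half_add_tau_pos _).le
      (mul_self_nonneg _)) hint] at hi
    filter_upwards [hi] with x hx
    exact mul_self_eq_zero.1 ((mul_eq_zero.1 hx).resolve_left (half_add_tau_pos _).ne')
  have hpd := pderiv_eq_zero hΩ hΩreg h1 fun i e he => by
    filter_upwards [hu0 i e he] with x hx using hx.symm
  have hsq := integral_sq_eq (M := M) hΩ hΩreg K (0 : Fin d) (hpd 0)
  rw [Finset.sum_eq_zero] at hsq
  · refine ⟨rfl, funext fun j => Subtype.ext ?_⟩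
    rw [Subsingleton.elim j 0]
    exact M.eq_zero_of_integral_sq_eq_zero hsq
  · refine fun i _ => Finset.sum_eq_zero fun e he => ?_
    refine integral_eq_zero_of_ae ?_
    filter_upwards [hu0 i e he] with x hx
    simp [← hu, hx]

omit hΩ hΩreg hS hβ hdivβ hcoer hb

theorem integral_finset_jump {e : {e // e ∈ M.skeleton}} {f : ι × Fin (d + 1) → Eu d → ℝ}
    (hf : ∀ s ∈ M.sides e.1, MemLp (f s) ⊤ ((SimplexMesh.surf d).restrict e.1)) {g : Eu d → ℝ}
    (hg : MemLp g ⊤ ((SimplexMesh.surf d).restrict e.1)) :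
    ∫ x in e.1, (∑ s ∈ M.sides e.1, f s x) * g x ∂(SimplexMesh.surf d) =
      ∑ s ∈ M.sides e.1, ∫ x in e.1, f s x * g x ∂(SimplexMesh.surf d) := by
  have := M.isFiniteMeasure_surf_restrict e.2
  rw [← integral_finsetSum _ fun s hs => MemLp.integrable_top (hg.mul' (hf s hs))]
  exact integral_congr_ae (Filter.Eventually.of_forall fun x => Finset.sum_mul _ _ _)

include hb in
theorem integrable_dissipation {e : {e // e ∈ M.skeleton}} {s : ι × Fin (d + 1)}
    (hs : s ∈ M.sides e.1) (u : MvPolynomial (Fin d) ℝ) (wh : TraceSpace M p (Fin 1)) :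
    Integrable (fun x => ((1 / 2) * b s.1 x + tau (b s.1 x)) *
      ((polyFun u x - (wh e 0).1 x) * (polyFun u x - (wh e 0).1 x)))
      ((SimplexMesh.surf d).restrict e.1) := by
  have hfe := M.isFiniteMeasure_surf_restrict e.2
  have hd := (memLp_polyFun_mortar u e).sub (memLp_trace wh e)
  have hbe := M.memLp_normalTrace (hb s.1) (M.mem_sides.1 hs)
  exact MemLp.integrable_top ((hd.mul' (r := ⊤) hd).mul'
    ((hbe.const_mul (1 / 2)).add (memLp_tau hbe)))

include hb in
theorem integrable_transport {e : {e // e ∈ M.skeleton}} {s : ι × Fin (d + 1)}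
    (hs : s ∈ M.sides e.1) (wh : TraceSpace M p (Fin 1)) :
    Integrable (fun x => b s.1 x * ((wh e 0).1 x * (wh e 0).1 x))
      ((SimplexMesh.surf d).restrict e.1) := by
  have hfe := M.isFiniteMeasure_surf_restrict e.2
  have hw := memLp_trace wh e
  exact MemLp.integrable_top ((hw.mul' (r := ⊤) hw).mul'
    (M.memLp_normalTrace (hb s.1) (M.mem_sides.1 hs)))

include hb in
/-- The mortar contribution to the energy, split into the conservation residual, the dissipation
and the transport of the trace. -/
theorem integral_mortar_energy {e : {e // e ∈ M.skeleton}} {s : ι × Fin (d + 1)}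
    (hs : s ∈ M.sides e.1) {m : ℕ} (σ : Fin d → PolySpace d m) (u : MvPolynomial (Fin d) ℝ)
    (wh : TraceSpace M p (Fin 1)) :
    ∫ x in e.1, ((wh e 0).1 x * (∑ k, M.normal s.1 s.2 k * polyFun (σ k).1 x)
          + (1 / 2) * (b s.1 x * (polyFun u x * polyFun u x))
          + tau (b s.1 x) * (polyFun u x - (wh e 0).1 x) * polyFun u x) ∂(SimplexMesh.surf d) =
      (∫ x in e.1, ((∑ k, M.normal s.1 s.2 k * polyFun (σ k).1 x) + b s.1 x * polyFun u x
          + tau (b s.1 x) * (polyFun u x - (wh e 0).1 x)) * (wh e 0).1 x ∂(SimplexMesh.surf d))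
      + (∫ x in e.1, ((1 / 2) * b s.1 x + tau (b s.1 x)) *
          ((polyFun u x - (wh e 0).1 x) * (polyFun u x - (wh e 0).1 x)) ∂(SimplexMesh.surf d))
      - (1 / 2) * ∫ x in e.1, b s.1 x * ((wh e 0).1 x * (wh e 0).1 x) ∂(SimplexMesh.surf d) := by
  have hfe := M.isFiniteMeasure_surf_restrict e.2
  have hw := memLp_trace wh e
  have hbe := M.memLp_normalTrace (hb s.1) (M.mem_sides.1 hs)
  have j1 := (hw.mul' (memLp_flux hbe (M.normal s.1 s.2) σ u wh)).integrable_top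
  have j2 := integrable_dissipation hb hs u wh
  have j3 := integrable_transport hb hs wh
  rw [← integral_const_mul, ← integral_add' j1 j2, ← integral_sub' (j1.add j2) (j3.const_mul _)]
  refine integral_congr_ae (Filter.Eventually.of_forall fun x => ?_)
  simp only [Pi.add_apply, Pi.sub_apply]
  -- Pointwise, with `q = σ·n`: `ŵ q + ½ b w² + τ (w - ŵ) w = (q + b w + τ (w - ŵ)) ŵ + (½b + τ)(w -
  -- ŵ)² - ½ b ŵ²`.
  ring

include hb in
theorem trace_eq_of_dissipation_eq_zero {e : {e // e ∈ M.skeleton}} {s : ι × Fin (d + 1)}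
    (hs : s ∈ M.sides e.1) {u : MvPolynomial (Fin d) ℝ} {wh : TraceSpace M p (Fin 1)}
    (h : ∫ x in e.1, ((1 / 2) * b s.1 x + tau (b s.1 x)) *
      ((polyFun u x - (wh e 0).1 x) * (polyFun u x - (wh e 0).1 x)) ∂(SimplexMesh.surf d) = 0) :
    ∀ᵐ x ∂((SimplexMesh.surf d).restrict e.1), (wh e 0).1 x = polyFun u x := by
  rw [integral_eq_zero_iff_of_nonneg (fun x => mul_nonneg (half_add_tau_pos _).le
    (mul_self_nonneg _)) (integrable_dissipation hb hs u wh)] at h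
  filter_upwards [h] with x hx
  have := mul_self_eq_zero.1 ((mul_eq_zero.1 hx).resolve_left (half_add_tau_pos _).ne')
  linarith

theorem trace_eq_zero_of_dirichletForm (wh : TraceSpace M p (Fin 1)) {Dir : Set (Set (Eu d))}
    (h : dirichletForm M p Dir wh wh = 0) {e : {e // e ∈ M.skeleton}}
    (he : e.1 ∈ M.boundaryMortars) (heD : e.1 ∈ Dir) :
    ∀ᵐ x ∂((SimplexMesh.surf d).restrict e.1), (wh e 0).1 x = 0 := by
  have hnn : ∀ (e : {e // e ∈ M.skeleton}) x, 0 ≤ tval (wh e) x ⬝ᵥ tval (wh e) x := fun e x =>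
    Finset.sum_nonneg fun _ _ => mul_self_nonneg _
  have h1 := (Finset.sum_eq_zero_iff_of_nonneg fun e _ => by
    split_ifs
    · exact integral_nonneg (hnn e)
    · exact le_rfl).1 h e (Finset.mem_univ e)
  rw [if_pos ⟨he, heD⟩, integral_eq_zero_iff_of_nonneg (hnn e)
    (integrable_dirichletForm p e wh wh)] at h1
  filter_upwards [h1] with x hx
  exact congrFun (dotProduct_self_eq_zero.1 hx) 0

include hb in
open Classical in
theorem mortarForm_self (Dir : Set (Set (Eu d))) (σ : (K : ι) → Fin d → PolySpace d (p K))
    (w : (K : ι) → Fin 1 → PolySpace d (p K)) (wh : TraceSpace M p (Fin 1)) :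
    mortarForm M p (normalMatrix M b) (stab b) (rho b) Dir (σ, w, wh) wh =
      (∑ e : {e // e ∈ M.skeleton}, if e.1 ∈ Dir then 0 else ∑ s ∈ M.sides e.1, ∫ x in e.1,
        ((∑ k, M.normal s.1 s.2 k * polyFun (σ s.1 k).1 x) + b s.1 x * polyFun (w s.1 0).1 x
          + tau (b s.1 x) * (polyFun (w s.1 0).1 x - (wh e 0).1 x)) * (wh e 0).1 x
        ∂(SimplexMesh.surf d)) -
      ∑ e : {e // e ∈ M.skeleton}, if e.1 ∈ M.boundaryMortars ∧ e.1 ∉ Dir then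
        ∑ s ∈ M.sides e.1, ∫ x in e.1, (rho b s.1 s.2 x + b s.1 x) * ((wh e 0).1 x * (wh e 0).1 x)
        ∂(SimplexMesh.surf d) else 0 := by
  rw [mortarForm]
  congr 1
  · refine Finset.sum_congr rfl fun e _ => ?_
    by_cases he : e.1 ∈ Dir
    · rw [if_pos he, if_pos he]
    · rw [if_neg he, if_neg he, ← integral_finset_jump (fun s hs => memLp_flux
        (M.memLp_normalTrace (hb s.1) (M.mem_sides.1 hs)) _ _ _ wh) (memLp_trace wh e)]
      refine integral_congr_ae (Filter.Eventually.of_forall fun x => ?_)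
      simp only [dotProduct, Finset.univ_unique, Finset.sum_singleton, SimplexMesh.jump,
        Finset.sum_apply, hdgFlux_apply]
      rfl
  · refine Finset.sum_congr rfl fun e _ => if_congr Iff.rfl (Finset.sum_congr rfl fun s _ => ?_) rfl
    refine integral_congr_ae (Filter.Eventually.of_forall fun x => ?_)
    simp only [dotProduct, mulVec, Finset.univ_unique, Finset.sum_singleton, Matrix.add_apply,
      Matrix.smul_apply, one_apply_eq, smul_eq_mul, mul_one, normalMatrix, toBlocks_fromBlocks₂₂,
      of_apply]
    exact mul_assoc _ _ _

include hb in
/-- The transport of the trace over an interior mortar cancels. -/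
theorem sum_transport_eq_zero {e : {e // e ∈ M.skeleton}}
    (hj : ∀ᵐ x ∂((SimplexMesh.surf d).restrict e.1), M.jump (fun K _ y => b K y) e.1 x = 0)
    (wh : TraceSpace M p (Fin 1)) :
    ∑ s ∈ M.sides e.1, ∫ x in e.1, b s.1 x * ((wh e 0).1 x * (wh e 0).1 x)
      ∂(SimplexMesh.surf d) = 0 := by
  have hw := memLp_trace wh e
  rw [← integral_finset_jump (fun s hs => M.memLp_normalTrace (hb s.1) (M.mem_sides.1 hs))
    (hw.mul' hw)]
  refine integral_eq_zero_of_ae ?_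
  filter_upwards [hj] with x hx
  rw [SimplexMesh.jump] at hx
  rw [hx, zero_mul, Pi.zero_apply]

include hΩ hΩreg in
/-- Piecewise constants that agree with a single-valued trace vanishing on the boundary vanish. -/
theorem eq_zero_of_piecewise_constant (u : ι → MvPolynomial (Fin d) ℝ)
    (hu : ∀ K k, MvPolynomial.pderiv k (u K) = 0) (wh : TraceSpace M p (Fin 1))
    (htr : ∀ e : {e // e ∈ M.skeleton}, ∀ s ∈ M.sides e.1,
      ∀ᵐ x ∂((SimplexMesh.surf d).restrict e.1), (wh e 0).1 x = polyFun (u s.1) x)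
    (hbd : ∀ e : {e // e ∈ M.skeleton}, e.1 ∈ M.boundaryMortars →
      ∀ᵐ x ∂((SimplexMesh.surf d).restrict e.1), (wh e 0).1 x = 0) (K : ι) : u K = 0 := by
  have h1 : ∀ K, ∫ x in M.elem K, polyFun (u K) x * polyFun (u K) x =
      ∑ i, ∑ e ∈ M.mortarsOn K i, M.normal K i 0 *
        ∫ x in e.1, x 0 * ((wh e 0).1 x * (wh e 0).1 x) ∂(SimplexMesh.surf d) := fun K => by
    rw [integral_sq_eq (M := M) hΩ hΩreg K 0 (hu K 0)]
    refine Finset.sum_congr rfl fun i _ => Finset.sum_congr rfl fun e he => ?_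
    rw [← integral_const_mul]
    refine integral_congr_ae ?_
    filter_upwards [htr e _ (SimplexMesh.mem_sides_of_mem_mortarsOn he)] with x hx
    rw [hx]
  -- Because the trace is single-valued, the two sides of a mortar differ only in the factor `n₀`.
  -- The normals of an interior mortar sum to zero, and on boundary mortars the trace itself
  -- vanishes.
  have h2 : ∑ K, ∫ x in M.elem K, polyFun (u K) x * polyFun (u K) x = 0 := by
    rw [Finset.sum_congr rfl fun K _ => h1 K, M.sum_mortarsOn_eq_sum_sides fun e K i =>
      M.normal K i 0 * ∫ x in e.1, x 0 * ((wh e 0).1 x * (wh e 0).1 x) ∂(SimplexMesh.surf d)]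
    refine Finset.sum_eq_zero fun e _ => ?_
    rw [← Finset.sum_mul]
    rcases M.mem_skeleton.1 e.2 with he | he
    · have h3 := congrArg (EuclideanSpace.proj (0 : Fin d) : Eu d →L[ℝ] ℝ)
        (M.sum_normal_eq_zero hΩreg he)
      rw [map_sum, map_zero] at h3
      simp only [PiLp.proj_apply] at h3
      rw [h3, zero_mul]
    · rw [integral_eq_zero_of_ae, mul_zero]
      filter_upwards [hbd e he] with x hx
      simp [hx]
  refine M.eq_zero_of_integral_sq_eq_zero (K := K) ?_
  exact (Finset.sum_eq_zero_iff_of_nonneg fun K _ =>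
    integral_nonneg fun x => mul_self_nonneg (polyFun (u K) x)).1 h2 K (Finset.mem_univ K)

theorem sum_add_sub_half {α : Type*} (t : Finset α) {J Q Z : α → ℝ} :
    ∑ e ∈ t, (J e + Q e - (1 / 2) * Z e) =
      ∑ e ∈ t, J e + ∑ e ∈ t, Q e - (1 / 2) * ∑ e ∈ t, Z e := by
  rw [Finset.sum_sub_distrib, Finset.sum_add_distrib, Finset.mul_sum]

-- The energy identities are summed over the elements and sorted by mortars. Once the flux terms `J`
-- drop out, diffusion, reaction, the dissipation `Q` and the transport `-½ Z` of each mortar are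
-- nonnegative with sum zero, so each of them vanishes.
include hΩ hΩreg hS hβ hdivβ hcoer hb in
theorem global_unique
    (hbne : ∀ e ∈ M.skeleton, ∀ s ∈ M.sides e,
      ∀ᵐ x ∂((SimplexMesh.surf d).restrict e), b s.1 x ≠ 0)
    (hbjump : ∀ e ∈ M.interiorMortars,
      ∀ᵐ x ∂((SimplexMesh.surf d).restrict e), M.jump (fun K _ y => b K y) e x = 0)
    (hbdry : ∀ e ∈ M.boundaryMortars, e ∈ outflowMortars M b ∨ e ∈ inflowMortars M b)
    {σ : (K : ι) → Fin d → PolySpace d (p K)} {w : (K : ι) → Fin 1 → PolySpace d (p K)}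
    {wh : TraceSpace M p (Fin 1)}
    (h : SolvesHDG M p (system κ β) (normalMatrix M b) (stab b) (rho b) (outflowMortars M b)
      0 0 0 σ w wh) : σ = 0 ∧ w = 0 ∧ wh = 0 := by
  classical
  obtain ⟨hl, hm, hd⟩ := (solvesHDG_iff _ _ _ _ _ _ _).1 h
  simp only [boundaryFunctional_zero_left] at hm hd
  have hl1 : ∀ K s, auxForm M p (system κ β) (normalMatrix M b) K (σ K, w K, wh) s = 0 := fun K s => by
    have := ((solvesLocal_iff _ _ _ _ _).1 (hl K)).1 s
    simpa only [Pi.zero_apply, zero_dotProduct, integral_zero] using this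
  have hl2 : ∀ K v, solForm M p (system κ β) (normalMatrix M b) (stab b) K (σ K, w K, wh) v = 0 :=
    fun K v => by
    have := ((solvesLocal_iff _ _ _ _ _).1 (hl K)).2 v
    simpa only [Pi.zero_apply, zero_dotProduct, integral_zero] using this
  obtain ⟨k₀, hk₀, hinv⟩ := hS.G_aux_coercive
  have hinv : ∀ᵐ x ∂(volume.restrict Ω), QuadLE (k₀ • (1 : Matrix (Fin d) (Fin d) ℝ)) (κ x)⁻¹ :=
    hinv
  have hDir : ∀ e : {e // e ∈ M.skeleton}, e.1 ∈ outflowMortars M b →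
      ∀ᵐ x ∂((SimplexMesh.surf d).restrict e.1), (wh e 0).1 x = 0 := fun e he =>
    trace_eq_zero_of_dirichletForm wh (hd wh) he.1 he
  set J : {e // e ∈ M.skeleton} → ℝ := fun e => ∑ s ∈ M.sides e.1, ∫ x in e.1,
    ((∑ k, M.normal s.1 s.2 k * polyFun (σ s.1 k).1 x) + b s.1 x * polyFun (w s.1 0).1 x
      + tau (b s.1 x) * (polyFun (w s.1 0).1 x - (wh e 0).1 x)) * (wh e 0).1 x
    ∂(SimplexMesh.surf d) with hJ
  set Z : {e // e ∈ M.skeleton} → ι × Fin (d + 1) → ℝ := fun e s =>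
    ∫ x in e.1, b s.1 x * ((wh e 0).1 x * (wh e 0).1 x) ∂(SimplexMesh.surf d) with hZ
  set Q : {e // e ∈ M.skeleton} → ι × Fin (d + 1) → ℝ := fun e s =>
    ∫ x in e.1, ((1 / 2) * b s.1 x + tau (b s.1 x)) * ((polyFun (w s.1 0).1 x - (wh e 0).1 x)
      * (polyFun (w s.1 0).1 x - (wh e 0).1 x)) ∂(SimplexMesh.surf d) with hQ
  -- The trace `ŵ` itself is the test function in the conservation equation. Dirichlet mortars
  -- contribute nothing because `ŵ = 0` there. On the other boundary mortars `b < 0` almost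
  -- everywhere, so `ϱ + b = 0` and the Robin term disappears.
  have hJsum : ∑ e, J e = 0 := by
    have h1 := hm wh
    rw [mortarForm_self hb, sub_eq_zero] at h1
    rw [Finset.sum_eq_zero (s := Finset.univ) (f := fun e : {e // e ∈ M.skeleton} =>
      if e.1 ∈ M.boundaryMortars ∧ e.1 ∉ outflowMortars M b then _ else _)] at h1
    · rw [← h1]
      refine Finset.sum_congr rfl fun e _ => ?_
      by_cases he : e.1 ∈ outflowMortars M b
      · rw [if_pos he]
        refine Finset.sum_eq_zero fun s _ => integral_eq_zero_of_ae ?_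
        filter_upwards [hDir e he] with x hx
        simp [hx]
      · rw [if_neg he]
    · intro e _
      by_cases he : e.1 ∈ M.boundaryMortars ∧ e.1 ∉ outflowMortars M b
      · rw [if_pos he]
        refine Finset.sum_eq_zero fun s hs => integral_eq_zero_of_ae ?_
        filter_upwards [((hbdry e.1 he.1).resolve_left he.2).2 s hs,
          hbne e.1 e.2 s hs] with x hx hx'
        simp [rho, not_lt.2 hx, hx']
      · rw [if_neg he]
  have hZneg : ∀ e : {e // e ∈ M.skeleton}, e.1 ∈ inflowMortars M b →
      ∀ s ∈ M.sides e.1, 0 ≤ - Z e s := fun e he s hs => by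
    rw [hZ, ← integral_neg]
    refine integral_nonneg_of_ae ?_
    filter_upwards [he.2 s hs] with x hx
    exact neg_nonneg.2 (mul_nonpos_of_nonpos_of_nonneg hx (mul_self_nonneg _))
  -- Three cases: on interior mortars the transport cancels since `b` has zero jump, on Dirichlet
  -- mortars `ŵ = 0`, and on inflow mortars `b ≤ 0`.
  have hZsum : ∀ e, 0 ≤ - ∑ s ∈ M.sides e.1, Z e s := by
    intro e
    rcases M.mem_skeleton.1 e.2 with he | he
    · rw [sum_transport_eq_zero hb (hbjump e.1 he) wh, neg_zero]
    · rcases hbdry e.1 he with hout | hin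
      · refine (neg_eq_zero.2 (Finset.sum_eq_zero fun s _ => integral_eq_zero_of_ae ?_)).ge
        filter_upwards [hDir e hout] with x hx
        simp [hx]
      · rw [← Finset.sum_neg_distrib]
        exact Finset.sum_nonneg (hZneg e hin)
  have hQnn : ∀ e s, 0 ≤ Q e s := fun e s =>
    integral_nonneg fun x => mul_nonneg (half_add_tau_pos _).le (mul_self_nonneg _)
  have hA : ∀ K, 0 ≤ ∫ x in M.elem K, ((κ x)⁻¹ *ᵥ pval (σ K) x) ⬝ᵥ pval (σ K) x := fun K =>
    integral_nonneg_of_ae (ae_diffusion_nonneg (M := M) hΩreg hk₀ hinv (σ K))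
  have hD : ∀ K, 0 ≤ ∫ x in M.elem K, divβ x * (polyFun (w K 0).1 x * polyFun (w K 0).1 x) :=
    fun K => reaction_nonneg (M := M) hΩreg hcoer (w K 0).1
  have hE := Finset.sum_congr rfl fun K (_ : K ∈ Finset.univ) =>
    energy_elem hΩ hΩreg hβ hdivβ (hb K) (hl1 K (σ K)) (hl2 K (w K))
  rw [Finset.sum_add_distrib, Finset.sum_add_distrib, M.sum_mortarsOn_eq_sum_sides fun e K i =>
    ∫ x in e.1, ((wh e 0).1 x * (∑ k, M.normal K i k * polyFun (σ K k).1 x)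
          + (1 / 2) * (b K x * (polyFun (w K 0).1 x * polyFun (w K 0).1 x))
          + tau (b K x) * (polyFun (w K 0).1 x - (wh e 0).1 x) * polyFun (w K 0).1 x)
        ∂(SimplexMesh.surf d), Finset.sum_const_zero, ← Finset.mul_sum,
    Finset.sum_congr rfl fun e _ => (Finset.sum_congr rfl fun s hs =>
      integral_mortar_energy hb hs (σ s.1) (w s.1 0).1 wh).trans (sum_add_sub_half _),
    sum_add_sub_half, hJsum, zero_add] at hE
  have hAs := Finset.sum_nonneg fun K (_ : K ∈ Finset.univ) => hA K
  have hDs := Finset.sum_nonneg fun K (_ : K ∈ Finset.univ) => hD K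
  have hQe : ∀ e : {e // e ∈ M.skeleton}, 0 ≤ ∑ s ∈ M.sides e.1, Q e s := fun e =>
    Finset.sum_nonneg fun s _ => hQnn e s
  have hQs := Finset.sum_nonneg fun e (_ : e ∈ Finset.univ) => hQe e
  have hZs := Finset.sum_nonneg fun e (_ : e ∈ Finset.univ) => hZsum e
  rw [Finset.sum_neg_distrib] at hZs
  have hσ : ∀ K, σ K = 0 := fun K =>
    aux_eq_zero (M := M) hΩreg hk₀ hinv (integrable_diffusion hΩreg hS hb (σ K))
      ((Finset.sum_eq_zero_iff_of_nonneg fun K _ => hA K).1 (by linarith) K (Finset.mem_univ K))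
  have htr : ∀ e : {e // e ∈ M.skeleton}, ∀ s ∈ M.sides e.1,
      ∀ᵐ x ∂((SimplexMesh.surf d).restrict e.1), (wh e 0).1 x = polyFun (w s.1 0).1 x := by
    intro e s hs
    have h1 := (Finset.sum_eq_zero_iff_of_nonneg fun e _ => hQe e).1 (by linarith) e
      (Finset.mem_univ e)
    exact trace_eq_of_dissipation_eq_zero hb hs
      ((Finset.sum_eq_zero_iff_of_nonneg fun s _ => hQnn e s).1 h1 s hs)
  -- On inflow mortars the transport term `b ŵ²` has one sign and zero integral, so it vanishes
  -- almost everywhere; since `b ≠ 0` almost everywhere, the trace vanishes.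
  have hbd : ∀ e : {e // e ∈ M.skeleton}, e.1 ∈ M.boundaryMortars →
      ∀ᵐ x ∂((SimplexMesh.surf d).restrict e.1), (wh e 0).1 x = 0 := by
    intro e he
    rcases hbdry e.1 he with hout | hin
    · exact hDir e hout
    · obtain ⟨s, hs⟩ := M.exists_mem_sides e.2
      have h1 := (Finset.sum_eq_zero_iff_of_nonneg fun e _ => hZsum e).1
        (by rw [Finset.sum_neg_distrib]; linarith) e (Finset.mem_univ e)
      rw [← Finset.sum_neg_distrib] at h1
      have h2 := (Finset.sum_eq_zero_iff_of_nonneg (hZneg e hin)).1 h1 s hs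
      rw [hZ, ← integral_neg] at h2
      have h3 : 0 ≤ᵐ[(SimplexMesh.surf d).restrict e.1]
          -fun x => b s.1 x * ((wh e 0).1 x * (wh e 0).1 x) := by
        filter_upwards [hin.2 s hs] with x hx
        exact neg_nonneg.2 (mul_nonpos_of_nonpos_of_nonneg hx (mul_self_nonneg _))
      filter_upwards [(integral_eq_zero_iff_of_nonneg_ae h3
        (integrable_transport hb hs wh).neg).1 h2, hbne e.1 e.2 s hs] with x hx hx'
      exact mul_self_eq_zero.1 ((mul_eq_zero.1 (neg_eq_zero.1 hx)).resolve_left hx')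
  have hpd : ∀ K k, MvPolynomial.pderiv k (w K 0).1 = 0 := fun K =>
    pderiv_eq_zero (κ := κ) (β := β) (b := b) hΩ hΩreg (fun s => hσ K ▸ hl1 K s) fun i e he =>
      htr e _ (SimplexMesh.mem_sides_of_mem_mortarsOn he)
  have hw := eq_zero_of_piecewise_constant hΩ hΩreg (fun K => (w K 0).1) hpd wh htr hbd
  refine ⟨funext hσ, funext fun K => funext fun j => Subtype.ext ?_,
    funext fun e => funext fun j => ?_⟩
  · rw [Subsingleton.elim j 0]
    exact hw K
  · rw [Subsingleton.elim j 0]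
    obtain ⟨s, hs⟩ := M.exists_mem_sides e.2
    refine M.tracePoly_eq_zero_of_ae e.2 ?_
    filter_upwards [htr e s hs] with x hx
    rw [hx, hw s.1, polyFun_zero]

end Unique

end ConvDiff

/-! ### Well-posedness of the `hp`-HDG formulation. -/

theorem mainTheorem9 {d : ℕ} [NeZero d] (hd : 2 ≤ d)
    -- the domain and its mesh
    {Ω : Set (Eu d)} (hΩ : IsOpen Ω) (hΩreg : interior (closure Ω) = Ω)
    {ι : Type*} [Fintype ι] (M : SimplexMesh d Ω ι) (p : ι → ℕ)
    -- the diffusivity: bounded, symmetric, uniformly positive definite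
    (κ : Eu d → Matrix (Fin d) (Fin d) ℝ)
    (hκ : ∀ i j, MemLp (fun x => κ x i j) ∞ (volume.restrict Ω))
    (hκsymm : ∀ᵐ x ∂(volume.restrict Ω), (κ x)ᵀ = κ x)
    (κ₀ : ℝ) (hκ₀ : 0 < κ₀)
    (hκpos : ∀ᵐ x ∂(volume.restrict Ω), QuadLE (κ₀ • (1 : Matrix (Fin d) (Fin d) ℝ)) (κ x))
    -- the velocity: bounded, with bounded divergence
    (β : Eu d → Eu d) (hβ : MemLp β ∞ (volume.restrict Ω))
    (divβ : Eu d → ℝ) (hdivβ : MemLp divβ ∞ (volume.restrict Ω))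
    (hdiv : HasWeakDivergence Ω β divβ)
    (hcoer : ∀ᵐ x ∂(volume.restrict Ω), 0 ≤ (1 / 2) * divβ x)
    -- `b K` is the normal trace `β·n` on `∂K`
    (b : ι → Eu d → ℝ) (hb : ∀ K, M.IsNormalTrace K β divβ (b K))
    (hbne : ∀ e ∈ M.skeleton, ∀ s ∈ M.sides e,
      ∀ᵐ x ∂((SimplexMesh.surf d).restrict e), b s.1 x ≠ 0)
    (hbjump : ∀ e ∈ M.interiorMortars,
      ∀ᵐ x ∂((SimplexMesh.surf d).restrict e), M.jump (fun K _ y => b K y) e x = 0)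
    -- every boundary mortar belongs to one part of the boundary
    (hbdry : ∀ e ∈ M.boundaryMortars,
      e ∈ ConvDiff.outflowMortars M b ∨ e ∈ ConvDiff.inflowMortars M b) :
    -- the two-field framework with partial coercivity
    (ConvDiff.system κ β).IsPartiallyCoercive Ω ∧
    -- the upwind flux reduction, with the asserted stabilization parameter
    (∀ e ∈ M.skeleton, ∀ s ∈ M.sides e, ∀ᵐ x ∂((SimplexMesh.surf d).restrict e),
      (∃ Φ Ψ : Matrix (Fin 1) (Fin 1) ℝ,
        UpwindReduction (fun k => (ConvDiff.system κ β).B k x)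
          (ConvDiff.normalMatrix M b s.1 s.2 x) Φ Ψ ∧
        upwindStabilization (ConvDiff.normalMatrix M b s.1 s.2 x) Φ Ψ
          = ConvDiff.stab b s.1 s.2 x) ∧
      ((1 / 2 : ℝ) • (ConvDiff.normalMatrix M b s.1 s.2 x).toBlocks₂₂
        + ConvDiff.stab b s.1 s.2 x).PosDef) ∧
    -- the boundary operator is admissible
    (∀ e ∈ M.boundaryMortars, ∀ s ∈ M.sides e, ∀ᵐ x ∂((SimplexMesh.surf d).restrict e),
      AdmissibleBoundaryOperator (ConvDiff.normalMatrix M b s.1 s.2 x)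
        (boundaryOperator (ConvDiff.normalMatrix M b s.1 s.2 x)
          (ConvDiff.alpha M b e) (ConvDiff.rho b s.1 s.2 x))) ∧
    -- well-posedness of the local solver and of the complete formulation
    LocallyWellPosed M p (ConvDiff.system κ β) (ConvDiff.normalMatrix M b) (ConvDiff.stab b) ∧
    GloballyWellPosed M p (ConvDiff.system κ β) (ConvDiff.normalMatrix M b) (ConvDiff.stab b)
      (ConvDiff.rho b) (ConvDiff.outflowMortars M b) := by
  have hS := ConvDiff.isPartiallyCoercive hκ hκsymm hκ₀ hκpos hβ hdivβ hdiv hcoer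
  have hB := ConvDiff.hdgBounded hS hb
  have hn : ∀ K i, ‖M.normal K i‖ = 1 := fun K i => (M.simplex K).norm_outerNormal i
  refine ⟨hS, ?_, ?_, ?_, ?_⟩
  · intro e he s hs
    filter_upwards [hbne e he s hs] with x hx
    rw [ConvDiff.normalMatrix_eq]
    refine ⟨ConvDiff.upwindReduction hd κ β x (hn s.1 s.2) hx, ?_⟩
    rw [convDiffNormal, toBlocks_fromBlocks₂₂]
    exact ConvDiff.half_add_stab_posDef (b s.1 x)
  · intro e _ s _
    refine Filter.Eventually.of_forall fun x => ?_
    rw [ConvDiff.normalMatrix_eq]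
    refine ConvDiff.admissible _ (hn s.1 s.2) _ _ _ ?_ (ConvDiff.two_rho_add_nonneg b s.1 s.2 x)
    unfold ConvDiff.alpha
    split_ifs
    · exact Or.inl rfl
    · exact Or.inr rfl
  · exact locallyWellPosed_of_unique hΩreg hB fun K σ w h =>
      ConvDiff.local_unique hΩ hΩreg hS hβ hdivβ hcoer hb h
  · exact globallyWellPosed_of_unique hΩreg hB fun σ w wh h =>
      ConvDiff.global_unique hΩ hΩreg hS hβ hdivβ hcoer hb hbne hbjump hbdry h
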